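/- Let $\mathbb{T}^m=\mathbb{R}^m/\mathbb{Z}^m$ carry the Euclidean metric and Lebesgue measure $|\cdot|$, and identify $(\mathbb{T}^d)^n$ with $\mathbb{T}^{dn}$. For a compact set $Z\subset\mathbb{T}^{m}$ with open $r$-thickening $Z_r$, the lower Minkowski dimension of $Z$ is $\liminf_{r\to0^+}\bigl(m-\log_r|Z_r|\bigr)$ (equal to $-\infty$ if $Z=\emptyset$). For a finite Borel measure $\mu$ on $\mathbb{T}^d$ put $\widehat\mu(\xi)=\int e^{-2\pi i\xi\cdot x}\,d\mu(x)$ and $\|\mu\|_{M(\lambda)}=\sup_{\xi\in\mathbb{Z}^d}|\widehat\mu(\xi)||\xi|^{\lambda/2}$, and use the same formula for differences of such measures. The Fourier dimension of $\mu$ is the supremum of all $s\in[0,d]$ with $\|\mu\|_{M(s)}<\infty$; the Fourier dimension $\dim_{\mathbb F}(E)$ of a Borel set $E\subset\mathbb{T}^d$ is the supremum of the Fourier dimensions of the Borel probability measures $\mu$ with $\operatorname{supp}(\mu)\subset E$; and $E$ is a Salem set if $\dim_{\mathbb F}(E)$ equals the Hausdorff dimension of $E$. For $\beta\in(0,d]$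 let $\mathcal{X}_\beta$ be the set of pairs $(E,\mu)$, where $E\subset\mathbb{T}^d$ is compact and $\mu$ is a Borel probability measure with $\operatorname{supp}(\mu)\subset E$ and $\|\mu\|_{M(\lambda)}<\infty$ for all $\lambda\in[0,\beta)$, with the topology given by the Hausdorff distance in $E$ and by all the seminorm distances $\|\mu-\nu\|_{M(\lambda)}$, $\lambda\in[0,\beta)$, in $\mu$. A set is comeager if it contains a countable intersection of dense open sets. Let $d,n$ be natural numbers, let $0\le\alpha<dn$, and let $Z\subset\mathbb{T}^{dn}$ be a compact set with lower Minkowski dimension at most $\alpha$. Set \[ \beta_0=\min\left(\frac{dn-\alpha}{n-1/2},\,d\right). \] Then there exists a compact Salem set $E\subset\mathbb{T}^d$ with $\dim_{\mathbb F}(E)=\beta_0$ such that $(x_1,\dots,x_n)\notin Z$ for all distinct points $x_1,\dots,x_n\in E$. Moreover, for every $\beta$ with $0<\beta\le\beta_0$, the set of all pairs $(E,\mu)\in\mathcal{X}_\beta$ such that $E$ is Salem and $(x_1,\dots,x_n)\notin Z$ for all distinct points $x_1,\dots,x_n\in E$ is comeager in $\mathcal{X}_\beta$. -/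

import Mathlib

open scoped ENNReal Topology

noncomputable section

namespace SalemAvoidance

open MeasureTheory TopologicalSpace

/-- The torus `𝕋^ι = ℝ^ι / ℤ^ι` with its Euclidean metric
`d(x, y) = (∑ i, |x i - y i| ^ 2) ^ (1 / 2)`, where `|t|` is the distance from `t` to `0` in `ℝ/ℤ`. -/
abbrev Torus (ι : Type) [Fintype ι] : Type := PiLp 2 (fun _ : ι => UnitAddCircle)

/-- Lebesgue (normalized Haar) measure on the torus. -/
def lebesgue (ι : Type) [Fintype ι] : Measure (Torus ι) :=
  (volume : Measure (ι → UnitAddCircle)).map (WithLp.toLp 2)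

/-- The point `(x_1, …, x_n)` of `𝕋^{dn}` given by `n` points of `𝕋^d`. -/
def tuple {d n : ℕ} (x : Fin n → Torus (Fin d)) : Torus (Fin n × Fin d) :=
  WithLp.toLp 2 (fun p => x p.1 p.2)

/-- The lower Minkowski dimension `liminf_{r → 0+} (dim - log_r |E_r|)`, where `E_r` is the open
`r`-thickening of `E`. It takes values in the extended reals; `log 0 = -∞`, so the
empty set has dimension `-∞`. -/
def lowerMinkowskiDim {ι : Type} [Fintype ι] (E : Set (Torus ι)) : EReal :=
  Filter.liminf
    (fun r : ℝ => ((Fintype.card ι : ℝ) : EReal) -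
      ENNReal.log (lebesgue ι (Metric.thickening r E)) / ((Real.log r : ℝ) : EReal))
    (𝓝[>] (0 : ℝ))

/-- The Euclidean length of a frequency `ξ ∈ ℤ^d`. -/
def freqNorm {d : ℕ} (ξ : Fin d → ℤ) : ℝ := √(∑ i, (ξ i : ℝ) ^ 2)

/-- The Fourier coefficient `μ̂(ξ) = ∫ exp(-2πi ξ·x) dμ(x)`. -/
def fourierCoeff {d : ℕ} (μ : Measure (Torus (Fin d))) (ξ : Fin d → ℤ) : ℂ :=
  ∫ x, UnitAddTorus.mFourier (-ξ) (WithLp.ofLp x) ∂μ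

/-- `sup_ξ |c(ξ)| |ξ|^{s/2}` for a family `c` of Fourier coefficients (with `0 ^ 0 = 1`). Applied to
`c = μ̂` this is `‖μ‖_{M(s)}`, and applied to `c = μ̂ - ν̂` it is `‖μ - ν‖_{M(s)}`. -/
def decayNorm {d : ℕ} (s : ℝ) (c : (Fin d → ℤ) → ℂ) : ℝ≥0∞ :=
  ⨆ ξ, ENNReal.ofReal (‖c ξ‖ * freqNorm ξ ^ (s / 2))

/-- The Fourier dimension of a measure: the supremum of all `s ∈ [0, d]` with
`sup_ξ |μ̂(ξ)| |ξ|^{s/2} < ∞`. -/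
def fourierDimMeasure {d : ℕ} (μ : Measure (Torus (Fin d))) : ℝ≥0∞ :=
  ⨆ (s : ℝ) (_ : 0 ≤ s ∧ s ≤ d ∧ decayNorm s (fourierCoeff μ) < ∞), ENNReal.ofReal s

/-- The Fourier dimension of a set: the supremum of the Fourier dimensions of the Borel probability
measures whose support is contained in it. -/
def fourierDim {d : ℕ} (E : Set (Torus (Fin d))) : ℝ≥0∞ :=
  ⨆ (μ : ProbabilityMeasure (Torus (Fin d))) (_ : (μ : Measure (Torus (Fin d))).support ⊆ E),
    fourierDimMeasure (μ : Measure (Torus (Fin d)))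

/-- A Salem set: its Fourier dimension equals its Hausdorff dimension. -/
def IsSalem {d : ℕ} (E : Set (Torus (Fin d))) : Prop := fourierDim E = dimH E

/-- `E` avoids the pattern `Z`: no tuple of `n` distinct points of `E` lies in `Z`. -/
def Avoids {d n : ℕ} (E : Set (Torus (Fin d))) (Z : Set (Torus (Fin n × Fin d))) : Prop :=
  ∀ x : Fin n → Torus (Fin d), Function.Injective x → (∀ i, x i ∈ E) → tuple x ∉ Z

theorem decayNorm_zero {d : ℕ} (s : ℝ) : decayNorm (d := d) s 0 = 0 := by
  simp [decayNorm]

theorem decayNorm_neg {d : ℕ} (s : ℝ) (c : (Fin d → ℤ) → ℂ) :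
    decayNorm s (-c) = decayNorm s c := by
  simp [decayNorm]

theorem decayNorm_add_le {d : ℕ} (s : ℝ) (c c' : (Fin d → ℤ) → ℂ) :
    decayNorm s (c + c') ≤ decayNorm s c + decayNorm s c' := by
  refine iSup_le fun ξ => ?_
  have h0 : 0 ≤ freqNorm ξ ^ (s / 2) := Real.rpow_nonneg (Real.sqrt_nonneg _) _
  calc ENNReal.ofReal (‖(c + c') ξ‖ * freqNorm ξ ^ (s / 2))
      ≤ ENNReal.ofReal (‖c ξ‖ * freqNorm ξ ^ (s / 2) + ‖c' ξ‖ * freqNorm ξ ^ (s / 2)) := by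
        refine ENNReal.ofReal_le_ofReal ?_
        rw [← add_mul]
        exact mul_le_mul_of_nonneg_right (norm_add_le _ _) h0
    _ ≤ _ := ENNReal.ofReal_add_le
    _ ≤ decayNorm s c + decayNorm s c' :=
        add_le_add
          (le_iSup (fun ξ => ENNReal.ofReal (‖c ξ‖ * freqNorm ξ ^ (s / 2))) ξ)
          (le_iSup (fun ξ => ENNReal.ofReal (‖c' ξ‖ * freqNorm ξ ^ (s / 2))) ξ)

/-- The (extended) pseudometric `‖μ - ν‖_{M(s)}` on Borel probability measures. -/
abbrev decayPseudoEMetric (d : ℕ) (s : ℝ) :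
    PseudoEMetricSpace (ProbabilityMeasure (Torus (Fin d))) where
  edist μ ν := decayNorm s
    (fourierCoeff (μ : Measure (Torus (Fin d))) - fourierCoeff (ν : Measure (Torus (Fin d))))
  edist_self μ := by rw [sub_self, decayNorm_zero]
  edist_comm μ ν := by rw [← decayNorm_neg, neg_sub]
  edist_triangle μ ν ρ := by
    rw [← sub_add_sub_cancel (fourierCoeff (μ : Measure (Torus (Fin d))))
      (fourierCoeff (ν : Measure (Torus (Fin d))))]
    exact decayNorm_add_le _ _ _

/-- The space `𝓧_β` of pairs `(E, μ)`, where `E ⊆ 𝕋^d` is compact and `μ` is a Borel probability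
measure with support in `E` and `‖μ‖_{M(s)} < ∞` for all `s ∈ [0, β)`. Such an `E` is never empty,
since it contains the support of a probability measure. -/
structure XSpace (d : ℕ) (β : ℝ) where
  E : NonemptyCompacts (Torus (Fin d))
  μ : ProbabilityMeasure (Torus (Fin d))
  support_subset : (μ : Measure (Torus (Fin d))).support ⊆ (E : Set (Torus (Fin d)))
  decay : ∀ s : ℝ, 0 ≤ s → s < β →
    decayNorm s (fourierCoeff (μ : Measure (Torus (Fin d)))) < ∞

/-- The topology of `𝓧_β`, as a subspace of the product of the compact sets with the Hausdorff
metric and the space of measures with the seminorms `‖·‖_{M(s)}`, `s ∈ [0, β)`. -/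
instance XSpace.instTopologicalSpace (d : ℕ) (β : ℝ) : TopologicalSpace (XSpace d β) :=
  TopologicalSpace.induced XSpace.E
      (inferInstance : MetricSpace (NonemptyCompacts (Torus (Fin d)))).toPseudoMetricSpace.toUniformSpace.toTopologicalSpace ⊓
    ⨅ s : Set.Ico (0 : ℝ) β,
      TopologicalSpace.induced XSpace.μ (decayPseudoEMetric d s).toUniformSpace.toTopologicalSpace

end SalemAvoidance

end

/-! The proof is a Baire category argument in `XSpace d β`. Membership of (E, μ) in this space
already forces Fourier dimension at least β, and the Fourier dimension never exceeds the Hausdorff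
dimension (`fourierDim_le_dimH`). So it suffices that a generic E has `dimH E ≤ β` and avoids Z.
Both follow from the countably many conditions `IsGoodAt Z β k`; imposed on a thickening of E they
are open (`isOpen_goodAt`), and the heart of the matter is their density (`dense_goodAt`). Existence
of one set of dimension β₀ then follows because the space is nonempty and completely uniformizable
with a countable base of entourages, hence Baire (`XSpace.baireSpace`).

Density is probabilistic. Given (E₀, μ₀) and an exponent s < β, replace μ₀ by a nearby μ₁ with
bounded density and fast Fourier decay (`exists_smooth_approx`). Choose β₁ in (s, β) and draw N ≈
ρ^(-β₁) independent points with law μ₁. By Hoeffding's inequality and a union bound, the empirical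
Fourier coefficients up to a frequency polynomial in 1/ρ are correct up to τ = ρ^κ, for any fixed κ
< β₁/2; this is almost the square-root accuracy N^(-1/2). The expected number of n-tuples of sample
points in the ρ-thickening of Z is at most a constant times N^n ρ^(dn-α-ε₁). Deleting one point from
each such tuple is harmless for the Fourier coefficients as long as at most Nτ points go. Up to
small losses this asks for N^n ρ^(dn-α) ≤ N^(1/2), that is β(n - 1/2) ≤ dn - α, which is where β₀
comes from.

The surviving points are smeared by a mollifier of radius r comparable to ρ. This costs a factor
r^(-s/2) in the seminorm, and ρ^(κ-s/2) tends to 0 once κ > s/2 (`decayNorm_conv_sub_le`,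
`exists_discretization`). Since the Minkowski hypothesis is a liminf, good scales ρ are only
available frequently, while every other requirement holds for all small ρ.

The inequality between the two dimensions is an energy estimate: Fourier decay bounds the L² mean of
a Dirichlet kernel against μ × μ, which gives a ball condition on a set of positive measure and then
the mass distribution principle. -/

open scoped ENNReal Topology

noncomputable section

namespace SalemAvoidance

open MeasureTheory TopologicalSpace

/-! ### Characters, Fourier coefficients and decay seminorms on the torus -/

section Basic

variable {ι : Type} [Fintype ι] {d : ℕ}

instance instCompactSpaceTorus : CompactSpace (Torus ι) :=
  (PiLp.homeomorph 2 (fun _ : ι => UnitAddCircle)).symm.compactSpace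

instance instIsProbabilityMeasureCircle :
    IsProbabilityMeasure (volume : Measure UnitAddCircle) :=
  ⟨UnitAddCircle.measure_univ⟩

instance instIsProbabilityMeasurePiCircle :
    IsProbabilityMeasure (volume : Measure (ι → UnitAddCircle)) :=
  inferInstanceAs (IsProbabilityMeasure (Measure.pi fun _ : ι => (volume : Measure UnitAddCircle)))

theorem measurable_toLp_torus :
    Measurable (WithLp.toLp 2 : (ι → UnitAddCircle) → Torus ι) :=
  (PiLp.continuous_toLp 2 _).measurable

theorem measurable_ofLp_torus :
    Measurable (WithLp.ofLp : Torus ι → (ι → UnitAddCircle)) :=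
  (PiLp.continuous_ofLp 2 _).measurable

instance instIsProbabilityMeasureLebesgue : IsProbabilityMeasure (lebesgue ι) :=
  Measure.isProbabilityMeasure_map measurable_toLp_torus.aemeasurable

/-- The character `x ↦ exp (2πi ξ·x)` of the torus. -/
def char (ξ : ι → ℤ) (x : Torus ι) : ℂ := UnitAddTorus.mFourier ξ (WithLp.ofLp x)

theorem continuous_char (ξ : ι → ℤ) : Continuous (char ξ) :=
  (UnitAddTorus.mFourier ξ).continuous.comp (PiLp.continuous_ofLp 2 _)

theorem norm_char (ξ : ι → ℤ) (x : Torus ι) : ‖char ξ x‖ = 1 := by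
  simp only [char, UnitAddTorus.mFourier, ContinuousMap.coe_mk, norm_prod, fourier_apply]
  exact Finset.prod_eq_one fun i _ => Circle.norm_coe _

theorem char_add (ξ : ι → ℤ) (x y : Torus ι) : char ξ (x + y) = char ξ x * char ξ y := by
  simp only [char, UnitAddTorus.mFourier, ContinuousMap.coe_mk, ← Finset.prod_mul_distrib]
  refine Finset.prod_congr rfl fun i _ => ?_
  rw [WithLp.ofLp_add, Pi.add_apply]
  simp only [fourier_apply, smul_add]
  rw [AddCircle.toCircle_add, Circle.coe_mul]

theorem char_sub_left (ξ η : ι → ℤ) (x : Torus ι) :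
    char (ξ - η) x = char ξ x * char (-η) x := by
  rw [sub_eq_add_neg]; exact UnitAddTorus.mFourier_add

theorem char_neg_left (ξ : ι → ℤ) (x : Torus ι) :
    char (-ξ) x = starRingEnd ℂ (char ξ x) := UnitAddTorus.mFourier_neg

theorem char_neg_right (ξ : ι → ℤ) (x : Torus ι) : char ξ (-x) = char (-ξ) x := by
  simp [char, UnitAddTorus.mFourier, fourier_apply]

@[simp] theorem char_zero_left (x : Torus ι) : char 0 x = 1 := by
  simp [char, UnitAddTorus.mFourier]

theorem integrable_char (ξ : ι → ℤ) (μ : Measure (Torus ι)) [IsFiniteMeasure μ] :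
    Integrable (char ξ) μ :=
  Integrable.of_bound (continuous_char ξ).aestronglyMeasurable 1
    (Filter.Eventually.of_forall fun x => (norm_char ξ x).le)

theorem fourierCoeff_eq (μ : Measure (Torus (Fin d))) (ξ : Fin d → ℤ) :
    fourierCoeff μ ξ = ∫ x, char (-ξ) x ∂μ := rfl

theorem norm_fourierCoeff_le_one (μ : Measure (Torus (Fin d))) [IsProbabilityMeasure μ]
    (ξ : Fin d → ℤ) : ‖fourierCoeff μ ξ‖ ≤ 1 := by
  have := norm_integral_le_of_norm_le_const (μ := μ) (f := char (-ξ)) (C := 1)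
    (Filter.Eventually.of_forall fun x => (norm_char _ x).le)
  simpa [fourierCoeff_eq] using this

theorem fourierCoeff_zero (μ : Measure (Torus (Fin d))) [IsProbabilityMeasure μ] :
    fourierCoeff μ 0 = 1 := by
  simp [fourierCoeff_eq]

theorem fourierCoeff_conv (μ ν : Measure (Torus (Fin d))) [IsFiniteMeasure μ] [IsFiniteMeasure ν]
    (ξ : Fin d → ℤ) :
    fourierCoeff (μ ∗ ν) ξ = fourierCoeff μ ξ * fourierCoeff ν ξ := by
  simp only [fourierCoeff_eq]
  rw [integral_conv (integrable_char _ _)]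
  simp_rw [char_add, integral_const_mul, integral_mul_const]

theorem fourierCoeff_add (μ ν : Measure (Torus (Fin d))) [IsFiniteMeasure μ] [IsFiniteMeasure ν]
    (ξ : Fin d → ℤ) : fourierCoeff (μ + ν) ξ = fourierCoeff μ ξ + fourierCoeff ν ξ := by
  simp only [fourierCoeff_eq]
  exact integral_add_measure (integrable_char _ _) (integrable_char _ _)

theorem fourierCoeff_smul (c : ℝ≥0∞) (μ : Measure (Torus (Fin d))) (ξ : Fin d → ℤ) :
    fourierCoeff (c • μ) ξ = c.toReal * fourierCoeff μ ξ := by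
  simp only [fourierCoeff_eq]
  rw [integral_smul_measure]; rfl

theorem norm_fourier_sub_one_le (k : ℤ) (x : UnitAddCircle) :
    ‖(fourier k x : ℂ) - 1‖ ≤ 2 * Real.pi * (|(k : ℝ)| * ‖x‖) := by
  induction x using QuotientAddGroup.induction_on with
  | H t =>
    obtain ⟨u, hu, hut⟩ : ∃ u : ℝ, ((t : ℝ) : UnitAddCircle) = (u : UnitAddCircle) ∧
        ‖((t : ℝ) : UnitAddCircle)‖ = |u| := by
      refine ⟨t - round t, ?_, by rw [UnitAddCircle.norm_eq]⟩
      rw [AddCircle.coe_sub, eq_comm, sub_eq_self]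
      simp
    change ‖(fourier k ((t : ℝ) : UnitAddCircle) : ℂ) - 1‖ ≤ 2 * Real.pi * (|(k : ℝ)| * ‖((t : ℝ) : UnitAddCircle)‖)
    rw [hut, hu, fourier_coe_apply]
    have : (2 * Real.pi * Complex.I * k * u / (1 : ℝ) : ℂ)
        = Complex.I * ((2 * Real.pi * (k * u) : ℝ) : ℂ) := by push_cast; ring
    rw [this]
    refine (Real.norm_exp_I_mul_ofReal_sub_one_le).trans ?_
    rw [Real.norm_eq_abs, abs_mul, abs_mul, abs_mul, abs_of_pos Real.pi_pos]
    norm_num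

theorem norm_prod_sub_one_le {κ : Type*} (s : Finset κ) (f : κ → ℂ) (hf : ∀ i, ‖f i‖ ≤ 1) :
    ‖∏ i ∈ s, f i - 1‖ ≤ ∑ i ∈ s, ‖f i - 1‖ := by
  classical
  induction s using Finset.induction_on with
  | empty => simp
  | insert a s ha ih =>
    rw [Finset.prod_insert ha, Finset.sum_insert ha]
    have h : f a * ∏ i ∈ s, f i - 1 = (f a - 1) + f a * (∏ i ∈ s, f i - 1) := by ring
    rw [h]
    refine (norm_add_le _ _).trans (add_le_add le_rfl ?_)
    rw [norm_mul]
    exact (mul_le_of_le_one_left (norm_nonneg _) (hf a)).trans ih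

theorem freqNorm_nonneg (ξ : Fin d → ℤ) : 0 ≤ freqNorm ξ := Real.sqrt_nonneg _

theorem abs_le_freqNorm (ξ : Fin d → ℤ) (i : Fin d) : |(ξ i : ℝ)| ≤ freqNorm ξ := by
  rw [← Real.sqrt_sq_eq_abs]
  exact Real.sqrt_le_sqrt (Finset.single_le_sum (f := fun i => (ξ i : ℝ) ^ 2)
    (fun i _ => sq_nonneg _) (Finset.mem_univ i))

theorem one_le_freqNorm {ξ : Fin d → ℤ} (h : ξ ≠ 0) : 1 ≤ freqNorm ξ := by
  obtain ⟨i, hi⟩ := Function.ne_iff.mp h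
  refine le_trans ?_ (abs_le_freqNorm ξ i)
  exact_mod_cast Int.one_le_abs hi

@[simp] theorem freqNorm_zero : freqNorm (0 : Fin d → ℤ) = 0 := by simp [freqNorm]

theorem freqNorm_le_of_forall_abs_le {ξ : Fin d → ℤ} {M : ℝ} (hM : 0 ≤ M)
    (h : ∀ i, |(ξ i : ℝ)| ≤ M) : freqNorm ξ ≤ √d * M := by
  rw [freqNorm, ← Real.sqrt_sq hM, ← Real.sqrt_mul (Nat.cast_nonneg _)]
  refine Real.sqrt_le_sqrt ?_
  calc ∑ i, (ξ i : ℝ) ^ 2 ≤ ∑ _i : Fin d, M ^ 2 :=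
        Finset.sum_le_sum fun i _ => sq_le_sq' (abs_le.1 (h i)).1 (abs_le.1 (h i)).2
    _ = d * M ^ 2 := by simp

theorem norm_char_sub_one_le (ξ : Fin d → ℤ) (x : Torus (Fin d)) :
    ‖char ξ x - 1‖ ≤ 2 * Real.pi * freqNorm ξ * ‖x‖ := by
  have h1 : ‖char ξ x - 1‖ ≤ ∑ i, 2 * Real.pi * (|(ξ i : ℝ)| * ‖x i‖) := by
    refine (norm_prod_sub_one_le Finset.univ (fun i => (fourier (ξ i) (x i) : ℂ)) ?_).trans ?_
    · intro i; rw [fourier_apply]; exact (Circle.norm_coe _).le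
    · exact Finset.sum_le_sum fun i _ => norm_fourier_sub_one_le _ _
  refine h1.trans ?_
  rw [← Finset.mul_sum, mul_assoc (2 * Real.pi) (freqNorm ξ)]
  refine mul_le_mul_of_nonneg_left ?_ Real.two_pi_pos.le
  rw [PiLp.norm_eq_of_L2, freqNorm]
  have := Real.sum_mul_le_sqrt_mul_sqrt Finset.univ (fun i => |(ξ i : ℝ)|) (fun i => ‖x i‖)
  simpa only [sq_abs] using this

theorem ofReal_le_decayNorm (s : ℝ) (c : (Fin d → ℤ) → ℂ) (ξ : Fin d → ℤ) :
    ENNReal.ofReal (‖c ξ‖ * freqNorm ξ ^ (s / 2)) ≤ decayNorm s c :=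
  le_iSup (fun ξ => ENNReal.ofReal (‖c ξ‖ * freqNorm ξ ^ (s / 2))) ξ

theorem decayNorm_le_ofReal {s B : ℝ} {c : (Fin d → ℤ) → ℂ} (h0 : c 0 = 0)
    (h : ∀ ξ, ξ ≠ 0 → ‖c ξ‖ * freqNorm ξ ^ (s / 2) ≤ B) :
    decayNorm s c ≤ ENNReal.ofReal B := by
  refine iSup_le fun ξ => ?_
  by_cases hξ : ξ = 0
  · simp [hξ, h0]
  · exact ENNReal.ofReal_le_ofReal (h ξ hξ)

/-- Nonzero frequencies have length at least 1, so their weights increase with the exponent.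
Frequency 0 is different: its weight is 0 ^ 0 = 1 for exponent 0 and vanishes for positive
exponents, which is why `c 0 = 0` is required. -/
theorem decayNorm_mono {s t : ℝ} (hst : s ≤ t) {c : (Fin d → ℤ) → ℂ} (h0 : c 0 = 0) :
    decayNorm s c ≤ decayNorm t c := by
  refine iSup_le fun ξ => ?_
  by_cases hξ : ξ = 0
  · simp [hξ, h0]
  · refine le_trans (ENNReal.ofReal_le_ofReal ?_) (ofReal_le_decayNorm t c ξ)
    exact mul_le_mul_of_nonneg_left
      (Real.rpow_le_rpow_of_exponent_le (one_le_freqNorm hξ) (by linarith)) (norm_nonneg _)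

theorem exists_bound_of_decayNorm_lt_top {s : ℝ} {c : (Fin d → ℤ) → ℂ}
    (h : decayNorm s c < ∞) :
    ∃ B : ℝ, 0 ≤ B ∧ ∀ ξ, ‖c ξ‖ * freqNorm ξ ^ (s / 2) ≤ B := by
  refine ⟨(decayNorm s c).toReal, ENNReal.toReal_nonneg, fun ξ => ?_⟩
  exact (ENNReal.ofReal_le_iff_le_toReal h.ne).1 (ofReal_le_decayNorm s c ξ)

/-- A measure carried by a small ball around `0` has Fourier coefficients close to `1`. -/
theorem norm_fourierCoeff_sub_one_le (μ : Measure (Torus (Fin d))) [IsProbabilityMeasure μ]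
    {r : ℝ} (h : ∀ᵐ x ∂μ, ‖x‖ ≤ r) (ξ : Fin d → ℤ) :
    ‖fourierCoeff μ ξ - 1‖ ≤ 2 * Real.pi * freqNorm ξ * r := by
  have h1 : fourierCoeff μ ξ - 1 = ∫ x, (char (-ξ) x - 1) ∂μ := by
    rw [integral_sub (integrable_char _ _) (integrable_const _)]; simp [fourierCoeff_eq]
  rw [h1]
  have h2 := norm_integral_le_of_norm_le_const (μ := μ) (f := fun x => char (-ξ) x - 1)
    (C := 2 * Real.pi * freqNorm ξ * r) (by
      filter_upwards [h] with x hx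
      refine (norm_char_sub_one_le _ _).trans ?_
      have : freqNorm (-ξ) = freqNorm ξ := by simp [freqNorm]
      rw [this]
      exact mul_le_mul_of_nonneg_left hx
        (mul_nonneg (by positivity) (freqNorm_nonneg _)))
  simpa using h2

end Basic

/-! ### Domination of product measures -/

section PiMeasure

/-- The product outer measure is the largest one that is bounded by the product on boxes, so the
comparison only has to be made on boxes. -/
theorem pi_mono_measure {κ : Type*} [Fintype κ] {X : κ → Type*} [∀ i, MeasurableSpace (X i)]
    {μ ν : ∀ i, Measure (X i)} [∀ i, SigmaFinite (μ i)] [∀ i, SigmaFinite (ν i)]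
    (h : ∀ i, μ i ≤ ν i) : Measure.pi μ ≤ Measure.pi ν := by
  refine Measure.le_iff.2 fun s hs => ?_
  rw [Measure.pi, Measure.pi, toMeasure_apply _ _ hs, toMeasure_apply _ _ hs]
  have : OuterMeasure.pi (fun i => (μ i).toOuterMeasure) ≤
      OuterMeasure.pi (fun i => (ν i).toOuterMeasure) := by
    rw [OuterMeasure.le_pi]
    intro t ht
    refine (OuterMeasure.pi_pi_le _ _).trans ?_
    exact Finset.prod_le_prod' fun i _ => h i (t i)
  exact this s

theorem pi_const_smul {κ : Type*} [Fintype κ] {X : Type*} [MeasurableSpace X]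
    (ν : Measure X) [IsFiniteMeasure ν] {c : ℝ≥0∞} (hc : c ≠ ∞) :
    Measure.pi (fun _ : κ => c • ν) = c ^ Fintype.card κ • Measure.pi (fun _ : κ => ν) := by
  have : IsFiniteMeasure (c • ν) := Measure.smul_finite ν hc
  refine Measure.pi_eq fun s _ => ?_
  simp [Finset.prod_mul_distrib]

theorem pi_le_const_smul {κ : Type*} [Fintype κ] {X : Type*} [MeasurableSpace X]
    {μ ν : Measure X} [IsFiniteMeasure μ] [IsFiniteMeasure ν] {c : ℝ≥0∞} (hc : c ≠ ∞)
    (h : μ ≤ c • ν) :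
    Measure.pi (fun _ : κ => μ) ≤ c ^ Fintype.card κ • Measure.pi (fun _ : κ => ν) := by
  have : IsFiniteMeasure (c • ν) := Measure.smul_finite ν hc
  rw [← pi_const_smul ν hc]
  exact pi_mono_measure fun _ => h

end PiMeasure

/-! ### Compactly supported mollifiers from convolved cubes -/

section Mollifier

variable {d : ℕ}

/-- The uniform distribution on the arc `(0, h]`. -/
def arcMeasure (h : ℝ) : Measure UnitAddCircle :=
  ((ENNReal.ofReal h)⁻¹ • (volume : Measure ℝ).restrict (Set.Ioc 0 h)).map
    (fun t : ℝ => (t : UnitAddCircle))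

theorem measurable_coe_circle : Measurable (fun t : ℝ => (t : UnitAddCircle)) :=
  AddCircle.measurable_mk'

theorem isProbabilityMeasure_arcMeasure {h : ℝ} (hh : 0 < h) :
    IsProbabilityMeasure (arcMeasure h) := by
  have : IsProbabilityMeasure ((ENNReal.ofReal h)⁻¹ • (volume : Measure ℝ).restrict (Set.Ioc 0 h)) := by
    refine ⟨?_⟩
    simp only [Measure.smul_apply, Measure.restrict_apply MeasurableSet.univ, Set.univ_inter,
      Real.volume_Ioc, sub_zero, smul_eq_mul]
    exact ENNReal.inv_mul_cancel (by simpa using hh) ENNReal.ofReal_ne_top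
  exact Measure.isProbabilityMeasure_map measurable_coe_circle.aemeasurable

theorem arcMeasure_le {h : ℝ} (h1 : h ≤ 1) :
    arcMeasure h ≤ (ENNReal.ofReal h)⁻¹ • (volume : Measure UnitAddCircle) := by
  have h2 := (UnitAddCircle.measurePreserving_mk 0).map_eq
  rw [zero_add] at h2
  rw [arcMeasure, Measure.map_smul, ← h2]
  have h3 : Measure.map (fun t : ℝ => (t : UnitAddCircle)) (volume.restrict (Set.Ioc 0 h)) ≤
      Measure.map (fun t : ℝ => (t : UnitAddCircle)) (volume.restrict (Set.Ioc 0 1)) :=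
    Measure.map_mono (Measure.restrict_mono (Set.Ioc_subset_Ioc_right h1) le_rfl)
      measurable_coe_circle
  refine Measure.le_iff'.2 fun s => ?_
  rw [Measure.smul_apply, Measure.smul_apply]
  exact mul_le_mul' le_rfl (h3 s)

theorem ae_norm_le_arcMeasure (h : ℝ) : ∀ᵐ x ∂(arcMeasure h), ‖x‖ ≤ h := by
  rw [arcMeasure, ae_map_iff measurable_coe_circle.aemeasurable
    (measurableSet_le measurable_norm measurable_const)]
  refine Measure.ae_smul_measure ?_ _
  rw [ae_restrict_iff' measurableSet_Ioc]
  refine Filter.Eventually.of_forall fun t ht => ?_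
  rw [UnitAddCircle.norm_eq]
  refine (round_le t 0).trans ?_
  rw [Int.cast_zero, sub_zero, abs_of_pos ht.1]; exact ht.2

/-- The exponential has an explicit primitive whose two endpoint terms have equal modulus; this
gives 2 / (2π h |k|), and 2 ≤ 2π. -/
theorem norm_integral_fourier_arcMeasure_le {h : ℝ} (hh : 0 < h) {k : ℤ} (hk : k ≠ 0) :
    ‖∫ x, (fourier k x : ℂ) ∂(arcMeasure h)‖ ≤ (h * |(k : ℝ)|)⁻¹ := by
  rw [arcMeasure, integral_map measurable_coe_circle.aemeasurable
    (fourier k).continuous.aestronglyMeasurable, integral_smul_measure,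
    ← intervalIntegral.integral_of_le hh.le]
  have h1 : ∀ t : ℝ, (fourier k (t : UnitAddCircle) : ℂ)
      = Complex.exp ((2 * Real.pi * Complex.I * k) * t) := by
    intro t; rw [fourier_coe_apply]; congr 1; push_cast; ring
  simp_rw [h1]
  have hk' : (2 * Real.pi * Complex.I * k : ℂ) ≠ 0 := by
    have : (Real.pi : ℂ) ≠ 0 := by exact_mod_cast Real.pi_ne_zero
    have : (k : ℂ) ≠ 0 := by exact_mod_cast hk
    simp [*]
  rw [integral_exp_mul_complex hk', norm_smul, norm_div]
  have e1 : ∀ t : ℝ, ‖Complex.exp ((2 * Real.pi * Complex.I * k) * t)‖ = 1 := by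
    intro t
    have : (2 * Real.pi * Complex.I * k) * t = ((2 * Real.pi * k * t : ℝ) : ℂ) * Complex.I := by
      push_cast; ring
    rw [this, Complex.norm_exp_ofReal_mul_I]
  have hkpos : 0 < |(k : ℝ)| := abs_pos.2 (by exact_mod_cast hk)
  have e2 : ‖(2 * Real.pi * Complex.I * k : ℂ)‖ = 2 * Real.pi * |(k : ℝ)| := by
    simp [abs_of_pos Real.pi_pos]
  rw [e2]
  have e3 : ‖((ENNReal.ofReal h)⁻¹).toReal‖ = h⁻¹ := by
    rw [ENNReal.toReal_inv, ENNReal.toReal_ofReal hh.le, Real.norm_eq_abs,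
      abs_of_pos (inv_pos.2 hh)]
  rw [e3, mul_inv]
  refine mul_le_mul_of_nonneg_left ?_ (inv_pos.2 hh).le
  have e4 := norm_sub_le (Complex.exp ((2 * Real.pi * Complex.I * k) * h))
    (Complex.exp ((2 * Real.pi * Complex.I * k) * (0 : ℝ)))
  rw [e1, e1] at e4
  rw [div_le_iff₀ (by positivity), ]
  refine e4.trans ?_
  have : |(k : ℝ)|⁻¹ * (2 * Real.pi * |(k : ℝ)|) = 2 * Real.pi := by field_simp
  rw [this]
  linarith [Real.pi_gt_three]

/-- The uniform distribution on the cube `(0, h]^d`. -/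
def cubeMeasure (d : ℕ) (h : ℝ) : Measure (Torus (Fin d)) :=
  (Measure.pi fun _ : Fin d => arcMeasure h).map (WithLp.toLp 2)

theorem isProbabilityMeasure_cubeMeasure {h : ℝ} (hh : 0 < h) :
    IsProbabilityMeasure (cubeMeasure d h) := by
  have := isProbabilityMeasure_arcMeasure hh
  exact Measure.isProbabilityMeasure_map measurable_toLp_torus.aemeasurable

theorem cubeMeasure_le {h : ℝ} (hh : 0 < h) (h1 : h ≤ 1) :
    cubeMeasure d h ≤ ((ENNReal.ofReal h)⁻¹) ^ d • lebesgue (Fin d) := by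
  have := isProbabilityMeasure_arcMeasure hh
  have h2 := pi_le_const_smul (κ := Fin d) (c := (ENNReal.ofReal h)⁻¹) (by simpa using hh)
    (arcMeasure_le h1)
  rw [Fintype.card_fin] at h2
  rw [cubeMeasure, lebesgue, ← Measure.map_smul]
  exact Measure.map_mono h2 measurable_toLp_torus

theorem ae_norm_le_cubeMeasure {h : ℝ} (hh : 0 < h) :
    ∀ᵐ x ∂(cubeMeasure d h), ‖x‖ ≤ √d * h := by
  have := isProbabilityMeasure_arcMeasure hh
  rw [cubeMeasure, ae_map_iff measurable_toLp_torus.aemeasurable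
    (measurableSet_le measurable_norm measurable_const)]
  have : ∀ᵐ x ∂(Measure.pi fun _ : Fin d => arcMeasure h), ∀ i, ‖x i‖ ≤ h := by
    rw [ae_all_iff]
    intro i
    exact (measurePreserving_eval (fun _ : Fin d => arcMeasure h) i).quasiMeasurePreserving.ae
      (ae_norm_le_arcMeasure h)
  filter_upwards [this] with x hx
  rw [PiLp.norm_eq_of_L2, ← Real.sqrt_sq hh.le, ← Real.sqrt_mul (Nat.cast_nonneg _)]
  refine Real.sqrt_le_sqrt ?_
  calc ∑ i, ‖x i‖ ^ 2 ≤ ∑ _i : Fin d, h ^ 2 :=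
        Finset.sum_le_sum fun i _ => pow_le_pow_left₀ (norm_nonneg _) (hx i) 2
    _ = d * h ^ 2 := by simp

/-- The coefficient factors over coordinates. A coordinate of maximal modulus carries at least the
fraction 1/√d of the length of ξ, and all other factors are at most 1. -/
theorem norm_fourierCoeff_cubeMeasure_le {h : ℝ} (hh : 0 < h) {ξ : Fin d → ℤ} (hξ : ξ ≠ 0) :
    ‖fourierCoeff (cubeMeasure d h) ξ‖ ≤ √d / (h * freqNorm ξ) := by
  have := isProbabilityMeasure_arcMeasure hh
  obtain ⟨i₀, hi₀⟩ := Function.ne_iff.mp hξ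
  obtain ⟨i, -, hi⟩ := Finset.exists_max_image Finset.univ (fun i => |(ξ i : ℝ)|)
    ⟨i₀, Finset.mem_univ _⟩
  have hipos : 0 < |(ξ i : ℝ)| :=
    lt_of_lt_of_le (abs_pos.2 (by exact_mod_cast hi₀)) (hi i₀ (Finset.mem_univ _))
  have hξi : -ξ i ≠ 0 := by
    intro hz
    rw [neg_eq_zero] at hz
    simp [hz] at hipos
  have hfn : freqNorm ξ ≤ √d * |(ξ i : ℝ)| :=
    freqNorm_le_of_forall_abs_le hipos.le fun j => hi j (Finset.mem_univ _)
  have hfp : 0 < freqNorm ξ := lt_of_lt_of_le one_pos (one_le_freqNorm hξ)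
  have hprod : fourierCoeff (cubeMeasure d h) ξ
      = ∏ j, ∫ x, (fourier (-ξ j) x : ℂ) ∂(arcMeasure h) := by
    rw [fourierCoeff_eq, cubeMeasure, integral_map measurable_toLp_torus.aemeasurable
      (continuous_char _).aestronglyMeasurable]
    exact integral_fintype_prod_eq_prod (𝕜 := ℂ) (μ := fun _ : Fin d => arcMeasure h)
      (fun j x => (fourier (-ξ j) x : ℂ))
  rw [hprod, norm_prod]
  have hle1 : ∀ j, ‖∫ x, (fourier (-ξ j) x : ℂ) ∂(arcMeasure h)‖ ≤ 1 := by
    intro j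
    have := norm_integral_le_of_norm_le_const (μ := arcMeasure h)
      (f := fun x => (fourier (-ξ j) x : ℂ)) (C := 1)
      (Filter.Eventually.of_forall fun x => by rw [fourier_apply]; exact (Circle.norm_coe _).le)
    simpa using this
  rw [← Finset.mul_prod_erase Finset.univ _ (Finset.mem_univ i)]
  calc _ ≤ ‖∫ x, (fourier (-ξ i) x : ℂ) ∂(arcMeasure h)‖ * 1 :=
        mul_le_mul_of_nonneg_left
          (Finset.prod_le_one (fun j _ => norm_nonneg _) fun j _ => hle1 j) (norm_nonneg _)
    _ ≤ (h * |((-ξ i : ℤ) : ℝ)|)⁻¹ := by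
        rw [mul_one]; exact norm_integral_fourier_arcMeasure_le hh hξi
    _ ≤ √d / (h * freqNorm ξ) := by
        rw [Int.cast_neg, abs_neg, inv_eq_one_div, div_le_div_iff₀ (by positivity) (by positivity)]
        nlinarith

theorem conv_le_smul_lebesgue {μ ν : Measure (Torus (Fin d))} [IsProbabilityMeasure μ]
    [IsFiniteMeasure ν] {c : ℝ≥0∞} (h : ν ≤ c • lebesgue (Fin d)) :
    μ ∗ ν ≤ c • lebesgue (Fin d) := by
  refine Measure.le_iff.2 fun s hs => ?_
  rw [← lintegral_indicator_one hs, Measure.lintegral_conv (measurable_one.indicator hs)]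
  have : ∀ x, ∫⁻ y, s.indicator 1 (x + y) ∂ν ≤ c * lebesgue (Fin d) s := by
    intro x
    have e1 : ∀ y, s.indicator (1 : Torus (Fin d) → ℝ≥0∞) (x + y)
        = ((fun y => x + y) ⁻¹' s).indicator 1 y := fun y => rfl
    simp_rw [e1]
    have hms : MeasurableSet ((fun y => x + y) ⁻¹' s) := (measurable_const_add x) hs
    rw [lintegral_indicator_one hms]
    refine (h _).trans ?_
    rw [Measure.smul_apply, smul_eq_mul]
    refine le_of_eq ?_
    congr 1
    rw [lebesgue, Measure.map_apply measurable_toLp_torus hms,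
      Measure.map_apply measurable_toLp_torus hs]
    exact measure_preimage_add volume (WithLp.ofLp x) ((WithLp.toLp 2) ⁻¹' s)
  calc _ ≤ ∫⁻ _x, c * lebesgue (Fin d) s ∂μ := lintegral_mono this
    _ = _ := by simp

theorem ae_norm_le_conv {μ ν : Measure (Torus (Fin d))} [IsProbabilityMeasure μ]
    [IsProbabilityMeasure ν] {a b : ℝ} (hμ : ∀ᵐ x ∂μ, ‖x‖ ≤ a) (hν : ∀ᵐ x ∂ν, ‖x‖ ≤ b) :
    ∀ᵐ x ∂(μ ∗ ν), ‖x‖ ≤ a + b := by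
  rw [Measure.conv, ae_map_iff (by fun_prop)
    (measurableSet_le measurable_norm measurable_const)]
  have h1 := (Measure.quasiMeasurePreserving_fst (μ := μ) (ν := ν)).ae hμ
  have h2 := (Measure.quasiMeasurePreserving_snd (μ := μ) (ν := ν)).ae hν
  filter_upwards [h1, h2] with x hx1 hx2
  exact (norm_add_le _ _).trans (add_le_add hx1 hx2)

/-- Convolution powers of `cubeMeasure`. -/
theorem exists_cube_conv_pow (p : ℕ) {h : ℝ} (hh : 0 < h) (h1 : h ≤ 1) :
    ∃ ψ : Measure (Torus (Fin d)), IsProbabilityMeasure ψ ∧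
      (∀ᵐ x ∂ψ, ‖x‖ ≤ (p + 1) * (√d * h)) ∧
      (∀ ξ : Fin d → ℤ, ξ ≠ 0 → ‖fourierCoeff ψ ξ‖ ≤ (√d / (h * freqNorm ξ)) ^ (p + 1)) ∧
      ψ ≤ ((ENNReal.ofReal h)⁻¹) ^ d • lebesgue (Fin d) := by
  have := isProbabilityMeasure_cubeMeasure (d := d) hh
  induction p with
  | zero =>
    refine ⟨cubeMeasure d h, inferInstance, ?_, ?_, cubeMeasure_le hh h1⟩
    · simpa using ae_norm_le_cubeMeasure hh
    · intro ξ hξ; simpa using norm_fourierCoeff_cubeMeasure_le hh hξ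
  | succ p ih =>
    obtain ⟨ψ, hψ, ha, hb, hc⟩ := ih
    -- Each new factor gains one order of decay and enlarges the radius by `√d * h`; the density
    -- bound is that of the last factor alone.
    refine ⟨ψ ∗ cubeMeasure d h, inferInstance, ?_, ?_, conv_le_smul_lebesgue (cubeMeasure_le hh h1)⟩
    · filter_upwards [ae_norm_le_conv ha (ae_norm_le_cubeMeasure hh)] with x hx
      refine hx.trans (le_of_eq ?_)
      push_cast; ring
    · intro ξ hξ
      rw [fourierCoeff_conv, norm_mul, pow_succ]
      exact mul_le_mul (hb ξ hξ) (norm_fourierCoeff_cubeMeasure_le hh hξ) (norm_nonneg _)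
        (by have := freqNorm_nonneg ξ; positivity)

/-- Approximate identities on the torus with compact support, bounded density, and Fourier decay of
order `d + 1`. -/
theorem exists_mollifier (d : ℕ) : ∃ C : ℝ, 0 < C ∧ ∀ r : ℝ, 0 < r → r ≤ 1 →
    ∃ ψ : Measure (Torus (Fin d)), IsProbabilityMeasure ψ ∧ (∀ᵐ x ∂ψ, ‖x‖ ≤ r) ∧
      (∀ ξ : Fin d → ℤ, ξ ≠ 0 → ‖fourierCoeff ψ ξ‖ ≤ C / (r * freqNorm ξ) ^ (d + 1)) ∧
      ∃ K : ℝ≥0∞, K ≠ ∞ ∧ ψ ≤ K • lebesgue (Fin d) := by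
  -- With side r / a, the sum of d + 1 cube points has norm at most r. Using √d + 1 instead of √d
  -- keeps a ≥ 1 even for d = 0.
  set a : ℝ := (d + 1) * (√d + 1) with ha
  have ha1 : 1 ≤ a := by
    have := Real.sqrt_nonneg (d : ℝ)
    have : (0 : ℝ) ≤ d := Nat.cast_nonneg _
    nlinarith
  refine ⟨(a * (√d + 1)) ^ (d + 1), by positivity, fun r hr hr1 => ?_⟩
  have hh : 0 < r / a := by positivity
  obtain ⟨ψ, hψ, h1, h2, h3⟩ := exists_cube_conv_pow (d := d) d hh
    ((div_le_one (by positivity)).2 (hr1.trans ha1))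
  refine ⟨ψ, hψ, ?_, ?_, _, ?_, h3⟩
  · filter_upwards [h1] with x hx
    refine hx.trans ?_
    have : ((d : ℝ) + 1) * (√d * (r / a)) = r * (((d : ℝ) + 1) * √d / a) := by ring
    rw [this]
    refine mul_le_of_le_one_right hr.le ((div_le_one (by positivity)).2 ?_)
    rw [ha]; gcongr; linarith
  · intro ξ hξ
    have hf := one_le_freqNorm hξ
    refine (h2 ξ hξ).trans ?_
    rw [← div_pow]
    refine pow_le_pow_left₀ (by positivity) ?_ _
    have : √(d : ℝ) / (r / a * freqNorm ξ) = a * √d / (r * freqNorm ξ) := by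
      field_simp
    rw [this]
    gcongr
    linarith
  · simp [hh]

end Mollifier

/-! ### Empirical measures -/

section Empirical

variable {d : ℕ} {κ : Type*}

/-- The uniform distribution on the points `x i`, `i ∈ G`, counted with multiplicity. -/
def empirical (G : Finset κ) (x : κ → Torus (Fin d)) : Measure (Torus (Fin d)) :=
  (G.card : ℝ≥0∞)⁻¹ • ∑ i ∈ G, Measure.dirac (x i)

theorem isProbabilityMeasure_empirical {G : Finset κ} (hG : G.Nonempty)
    (x : κ → Torus (Fin d)) : IsProbabilityMeasure (empirical G x) := by
  refine ⟨?_⟩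
  rw [empirical, Measure.smul_apply, Measure.finsetSum_apply]
  simp only [measure_univ, Finset.sum_const, nsmul_eq_mul, mul_one, smul_eq_mul]
  exact ENNReal.inv_mul_cancel (by simpa using hG.ne_empty) (ENNReal.natCast_ne_top _)

theorem ae_empirical {G : Finset κ} {x : κ → Torus (Fin d)} {p : Torus (Fin d) → Prop}
    (h : ∀ i ∈ G, p (x i)) : ∀ᵐ y ∂(empirical G x), p y := by
  refine Measure.ae_smul_measure ?_ _
  rw [ae_iff, Measure.finsetSum_apply]
  refine Finset.sum_eq_zero fun i hi => ?_
  rw [← ae_iff, ae_dirac_eq]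
  exact h i hi

theorem empirical_singleton_ne_zero {G : Finset κ} (x : κ → Torus (Fin d)) {i : κ} (hi : i ∈ G) :
    empirical G x {x i} ≠ 0 := by
  rw [empirical, Measure.smul_apply, Measure.finsetSum_apply, smul_eq_mul]
  refine mul_ne_zero (by simp) fun h => ?_
  rw [Finset.sum_eq_zero_iff] at h
  simpa using h i hi

theorem fourierCoeff_empirical (G : Finset κ) (x : κ → Torus (Fin d)) (ξ : Fin d → ℤ) :
    fourierCoeff (empirical G x) ξ = (G.card : ℂ)⁻¹ * ∑ i ∈ G, char (-ξ) (x i) := by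
  rw [empirical, fourierCoeff_smul, fourierCoeff_eq,
    integral_finsetSum_measure fun i _ => integrable_char _ _]
  simp

end Empirical

/-! ### Approximation by smooth measures that charge all of E₀ -/

section Smoothing

variable {d : ℕ}

theorem ae_of_support_subset {μ : Measure (Torus (Fin d))} {E : Set (Torus (Fin d))}
    (h : μ.support ⊆ E) : ∀ᵐ x ∂μ, x ∈ E :=
  Filter.mem_of_superset Measure.support_mem_ae h

theorem ae_conv_mem {μ ν : Measure (Torus (Fin d))} [IsProbabilityMeasure μ]
    [IsProbabilityMeasure ν] {A B S : Set (Torus (Fin d))} (hS : MeasurableSet S)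
    (hA : ∀ᵐ x ∂μ, x ∈ A) (hB : ∀ᵐ x ∂ν, x ∈ B) (h : ∀ x ∈ A, ∀ y ∈ B, x + y ∈ S) :
    ∀ᵐ x ∂(μ ∗ ν), x ∈ S := by
  rw [Measure.conv, ae_map_iff (p := (· ∈ S)) (by fun_prop) hS]
  have h1 := (Measure.quasiMeasurePreserving_fst (μ := μ) (ν := ν)).ae hA
  have h2 := (Measure.quasiMeasurePreserving_snd (μ := μ) (ν := ν)).ae hB
  filter_upwards [h1, h2] with x hx1 hx2
  exact h _ hx1 _ hx2

theorem conv_ball_pos {μ ν : Measure (Torus (Fin d))} [IsProbabilityMeasure μ]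
    [IsProbabilityMeasure ν] {x y : Torus (Fin d)} (hx : μ {x} ≠ 0) {h ε : ℝ}
    (hν : ∀ᵐ z ∂ν, ‖z‖ ≤ h) (hd : dist x y + h < ε) : 0 < (μ ∗ ν) (Metric.ball y ε) := by
  rw [pos_iff_ne_zero]
  intro h0
  have h1 : ∀ᵐ z ∂(μ ∗ ν), z ∉ Metric.ball y ε := by
    rw [ae_iff]; simp only [not_not]; exact h0
  rw [Measure.conv, ae_map_iff (p := (· ∉ Metric.ball y ε)) (by fun_prop)
    Metric.isOpen_ball.measurableSet.compl] at h1
  have h2 := Measure.ae_ae_of_ae_prod h1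
  have h3 : ∀ᵐ z ∂ν, x + z ∉ Metric.ball y ε := by
    by_contra hcon
    refine hx (measure_mono_null ?_ (ae_iff.1 h2))
    rintro _ rfl
    exact hcon
  obtain ⟨z, hz1, hz2⟩ := (h3.and hν).exists
  refine hz1 (Metric.mem_ball.2 ?_)
  calc dist (x + z) y ≤ dist (x + z) x + dist x y := dist_triangle _ _ _
    _ = ‖z‖ + dist x y := by rw [dist_eq_norm]; simp
    _ < ε := by linarith

/-- The support of μ₀ may be much smaller than E₀. Mixing in a small weight of point masses on a
finite net of E₀ before mollifying makes the new measure see all of E₀, as closeness in the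
Hausdorff metric will require. -/
theorem exists_smooth_approx {μ₀ : Measure (Torus (Fin d))} [IsProbabilityMeasure μ₀]
    {E₀ : Set (Torus (Fin d))} (hE : IsCompact E₀) (hsupp : μ₀.support ⊆ E₀) {s t : ℝ}
    (hs : 0 ≤ s) (hst : s < t) (hsd : s ≤ d)
    (ht : decayNorm t (fourierCoeff μ₀) < ∞) {ε : ℝ} (hε : 0 < ε) :
    ∃ μ₁ : Measure (Torus (Fin d)), IsProbabilityMeasure μ₁ ∧
      (∃ K : ℝ≥0∞, K ≠ ∞ ∧ μ₁ ≤ K • lebesgue (Fin d)) ∧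
      (∃ C : ℝ, 0 < C ∧ ∀ ξ, ξ ≠ 0 → ‖fourierCoeff μ₁ ξ‖ ≤ C / freqNorm ξ ^ (d + 1)) ∧
      decayNorm s (fourierCoeff μ₁ - fourierCoeff μ₀) ≤ ENNReal.ofReal ε ∧
      (∀ᵐ x ∂μ₁, x ∈ Metric.thickening ε E₀) ∧ ∀ y ∈ E₀, 0 < μ₁ (Metric.ball y ε) := by
  obtain ⟨B, hB0, hB⟩ := exists_bound_of_decayNorm_lt_top ht
  obtain ⟨C, hC, hmol⟩ := exists_mollifier d
  -- The parameters are chosen in the order M, h, w. Beyond M the gap between s and t makes μ₀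
  -- itself negligible; h makes the mollifier nearly 1 on frequencies up to M; w beats the constant
  -- C / h ^ (d + 1) in the decay of the mollified net.
  obtain ⟨M, hM1, hM⟩ : ∃ M : ℝ, 1 ≤ M ∧ 2 * B * M ^ (-((t - s) / 2)) ≤ ε / 2 := by
    have h1 := (tendsto_rpow_neg_atTop (y := (t - s) / 2) (by linarith)).const_mul (2 * B)
    rw [mul_zero] at h1
    exact ((Filter.eventually_ge_atTop 1).and (h1.eventually_le_const (by linarith))).exists
  have hMp : 0 < M ^ (s / 2) := Real.rpow_pos_of_pos (by linarith) _
  obtain ⟨h, hh0, hh1, hhε, hhM⟩ : ∃ h : ℝ, 0 < h ∧ h ≤ 1 ∧ h ≤ ε / 4 ∧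
      2 * Real.pi * M * h * M ^ (s / 2) ≤ ε / 2 := by
    have hp : 0 < 2 * Real.pi * M * M ^ (s / 2) := by positivity
    refine ⟨min (min 1 (ε / 4)) (ε / 2 / (2 * Real.pi * M * M ^ (s / 2))), by positivity,
      (min_le_left _ _).trans (min_le_left _ _), (min_le_left _ _).trans (min_le_right _ _), ?_⟩
    have := (le_div_iff₀ hp).1 (min_le_right (min 1 (ε / 4))
      (ε / 2 / (2 * Real.pi * M * M ^ (s / 2))))
    linarith
  obtain ⟨ψ, hψ, hψs, hψd, K, hK, hψK⟩ := hmol h hh0 hh1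
  have hne : E₀.Nonempty :=
    (Measure.nonempty_support (IsProbabilityMeasure.ne_zero μ₀)).mono hsupp
  obtain ⟨F, hF, hcov⟩ := hE.elim_nhds_subcover (fun y => Metric.ball y (ε / 2))
    (fun y _ => Metric.ball_mem_nhds y (by linarith))
  have hFne : F.Nonempty := by
    obtain ⟨y, hy⟩ := hne
    obtain ⟨i, hi, -⟩ := Set.mem_iUnion₂.1 (hcov hy)
    exact ⟨i, hi⟩
  set ν := empirical F (id : Torus (Fin d) → Torus (Fin d)) with hν
  have hνp : IsProbabilityMeasure ν := isProbabilityMeasure_empirical hFne _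
  obtain ⟨w, hw0, hw1, hw⟩ : ∃ w : ℝ, 0 < w ∧ w < 1 ∧ w * (2 * (C / h ^ (d + 1))) ≤ ε / 2 := by
    have hp : 0 < 2 * (C / h ^ (d + 1)) := by positivity
    refine ⟨min (1 / 2) (ε / 2 / (2 * (C / h ^ (d + 1)))), by positivity,
      (min_le_left _ _).trans_lt (by norm_num), ?_⟩
    exact (le_div_iff₀ hp).1 (min_le_right _ _)
  set μ' := ENNReal.ofReal (1 - w) • μ₀ + ENNReal.ofReal w • ν with hμ'
  have hμ'p : IsProbabilityMeasure μ' := by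
    refine ⟨?_⟩
    simp only [hμ', Measure.add_apply, Measure.smul_apply, measure_univ, smul_eq_mul, mul_one]
    rw [← ENNReal.ofReal_add (by linarith) hw0.le]; simp
  have hfm1 : IsFiniteMeasure (ENNReal.ofReal (1 - w) • μ₀) :=
    Measure.smul_finite _ ENNReal.ofReal_ne_top
  have hfm2 : IsFiniteMeasure (ENNReal.ofReal w • ν) :=
    Measure.smul_finite _ ENNReal.ofReal_ne_top
  have hcoef : ∀ ξ, fourierCoeff (μ' ∗ ψ) ξ - fourierCoeff μ₀ ξ =
      fourierCoeff μ₀ ξ * (fourierCoeff ψ ξ - 1)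
        + w * (fourierCoeff ν ξ - fourierCoeff μ₀ ξ) * fourierCoeff ψ ξ := by
    intro ξ
    rw [fourierCoeff_conv, hμ', fourierCoeff_add, fourierCoeff_smul, fourierCoeff_smul,
      ENNReal.toReal_ofReal (by linarith), ENNReal.toReal_ofReal hw0.le]
    push_cast; ring
  refine ⟨μ' ∗ ψ, inferInstance, ⟨K, hK, conv_le_smul_lebesgue hψK⟩,
    ⟨C / h ^ (d + 1), by positivity, fun ξ hξ => ?_⟩, ?_, ?_, ?_⟩
  · rw [fourierCoeff_conv, norm_mul, div_div, ← mul_pow]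
    exact (mul_le_of_le_one_left (norm_nonneg _) (norm_fourierCoeff_le_one _ _)).trans (hψd ξ hξ)
  · refine decayNorm_le_ofReal (by simp [fourierCoeff_zero]) fun ξ hξ => ?_
    have hf := one_le_freqNorm hξ
    have hf0 : 0 < freqNorm ξ := by linarith
    have hfs : 0 < freqNorm ξ ^ (s / 2) := Real.rpow_pos_of_pos hf0 _
    rw [Pi.sub_apply, hcoef]
    have hA : ‖fourierCoeff μ₀ ξ * (fourierCoeff ψ ξ - 1)‖ * freqNorm ξ ^ (s / 2) ≤ ε / 2 := by
      rw [norm_mul]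
      rcases le_total (freqNorm ξ) M with hle | hle
      · calc _ ≤ 1 * (2 * Real.pi * M * h) * M ^ (s / 2) := by
              gcongr
              · exact norm_fourierCoeff_le_one _ _
              · refine (norm_fourierCoeff_sub_one_le ψ hψs ξ).trans ?_
                gcongr
          _ ≤ ε / 2 := by rw [one_mul]; exact hhM
      · have h2 : ‖fourierCoeff ψ ξ - 1‖ ≤ 2 := by
          refine (norm_sub_le _ _).trans ?_
          have := norm_fourierCoeff_le_one ψ ξ
          rw [norm_one]; linarith
        have h3 : freqNorm ξ ^ (s / 2) = freqNorm ξ ^ (t / 2) * freqNorm ξ ^ (-((t - s) / 2)) := by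
          rw [← Real.rpow_add hf0]; congr 1; ring
        have h4 : freqNorm ξ ^ (-((t - s) / 2)) ≤ M ^ (-((t - s) / 2)) :=
          Real.rpow_le_rpow_of_nonpos (by linarith) hle (by linarith)
        rw [h3]
        calc _ = (‖fourierCoeff μ₀ ξ‖ * freqNorm ξ ^ (t / 2)) * ‖fourierCoeff ψ ξ - 1‖ *
              freqNorm ξ ^ (-((t - s) / 2)) := by ring
          _ ≤ B * 2 * M ^ (-((t - s) / 2)) := by
              gcongr
              exact hB ξ
          _ ≤ ε / 2 := by linarith
    have hB' : ‖w * (fourierCoeff ν ξ - fourierCoeff μ₀ ξ) * fourierCoeff ψ ξ‖ *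
        freqNorm ξ ^ (s / 2) ≤ ε / 2 := by
      rw [norm_mul, norm_mul, Complex.norm_real, Real.norm_eq_abs, abs_of_pos hw0]
      have h2 : ‖fourierCoeff ν ξ - fourierCoeff μ₀ ξ‖ ≤ 2 := by
        refine (norm_sub_le _ _).trans ?_
        have := norm_fourierCoeff_le_one ν ξ
        have := norm_fourierCoeff_le_one μ₀ ξ
        linarith
      have h3 : freqNorm ξ ^ (s / 2) ≤ freqNorm ξ ^ (d + 1) := by
        rw [← Real.rpow_natCast]
        refine Real.rpow_le_rpow_of_exponent_le hf ?_
        push_cast; linarith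
      calc _ ≤ w * 2 * (C / (h * freqNorm ξ) ^ (d + 1)) * freqNorm ξ ^ (d + 1) := by
            gcongr
            exact hψd ξ hξ
        _ = w * (2 * (C / h ^ (d + 1))) := by
            rw [mul_pow]; field_simp
        _ ≤ ε / 2 := hw
    calc _ ≤ (‖fourierCoeff μ₀ ξ * (fourierCoeff ψ ξ - 1)‖ +
          ‖w * (fourierCoeff ν ξ - fourierCoeff μ₀ ξ) * fourierCoeff ψ ξ‖) *
          freqNorm ξ ^ (s / 2) := by gcongr; exact norm_add_le _ _
      _ ≤ ε := by rw [add_mul]; linarith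
  · refine ae_conv_mem (A := E₀) Metric.isOpen_thickening.measurableSet ?_ hψs ?_
    · rw [hμ', ae_add_measure_iff]
      exact ⟨Measure.ae_smul_measure (ae_of_support_subset hsupp) _,
        Measure.ae_smul_measure (ae_empirical fun i hi => hF i hi) _⟩
    · intro x hx y hy
      refine Metric.mem_thickening_iff.2 ⟨x, hx, ?_⟩
      have : ‖y‖ ≤ h := hy
      rw [dist_eq_norm]; simp only [add_sub_cancel_left]; linarith
  · intro y hy
    obtain ⟨i, hi, hyi⟩ := Set.mem_iUnion₂.1 (hcov hy)
    refine conv_ball_pos (x := i) ?_ hψs ?_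
    · have := empirical_singleton_ne_zero (id : Torus (Fin d) → Torus (Fin d)) hi
      simp only [hμ', Measure.add_apply, Measure.smul_apply, smul_eq_mul]
      intro h0
      rw [add_eq_zero] at h0
      exact mul_ne_zero (by simpa using hw0) this h0.2
    · rw [dist_comm]
      have := Metric.mem_ball.1 hyi
      linarith

end Smoothing

/-! ### Random sampling: Hoeffding for frequencies, Markov for bad tuples -/

section Sampling

variable {d n N : ℕ}

/-- Hoeffding's inequality: a variable with values in [-1, 1] is sub-Gaussian with variance proxy 1
after centring. -/
theorem measureReal_sum_sub_integral_ge_le {X : Type*} [MeasurableSpace X] (μ : Measure X)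
    [IsProbabilityMeasure μ] (N : ℕ) {g : X → ℝ} (hg : Measurable g) (hg1 : ∀ x, |g x| ≤ 1)
    {t : ℝ} (ht : 0 ≤ t) :
    (Measure.pi fun _ : Fin N => μ).real {x | N * t ≤ ∑ i, (g (x i) - ∫ y, g y ∂μ)} ≤
      Real.exp (-(N * t ^ 2) / 2) := by
  have hind : ProbabilityTheory.iIndepFun
      (fun (i : Fin N) (x : Fin N → X) => g (x i) - ∫ y, g y ∂μ)
      (Measure.pi fun _ : Fin N => μ) :=
    ProbabilityTheory.iIndepFun_pi (μ := fun _ : Fin N => μ)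
      (X := fun _ y => g y - ∫ y, g y ∂μ) fun i => (hg.sub_const _).aemeasurable
  have hsub : ∀ i : Fin N, ProbabilityTheory.HasSubgaussianMGF
      (fun x : Fin N → X => g (x i) - ∫ y, g y ∂μ) 1 (Measure.pi fun _ : Fin N => μ) := by
    intro i
    have h1 := ProbabilityTheory.hasSubgaussianMGF_of_mem_Icc (μ := Measure.pi fun _ : Fin N => μ)
      (X := fun x => g (x i)) (a := -1) (b := 1) (hg.comp (measurable_pi_apply i)).aemeasurable
      (Filter.Eventually.of_forall fun x => abs_le.1 (hg1 (x i)))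
    have h2 : ∫ x, g (x i) ∂(Measure.pi fun _ : Fin N => μ) = ∫ y, g y ∂μ := by
      have h3 := integral_map (μ := Measure.pi fun _ : Fin N => μ) (φ := Function.eval i)
        (measurable_pi_apply i).aemeasurable hg.aestronglyMeasurable
      rw [(measurePreserving_eval (fun _ : Fin N => μ) i).map_eq] at h3
      exact h3.symm
    rw [h2] at h1
    convert h1
    rw [show (1 : ℝ) - -1 = 2 by norm_num]
    ext; simp
  have h := ProbabilityTheory.HasSubgaussianMGF.measure_sum_ge_le_of_iIndepFun hind
    (s := Finset.univ) (c := fun _ => 1) (fun i _ => hsub i) (ε := N * t) (by positivity)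
  refine h.trans (le_of_eq ?_)
  congr 1
  rcases Nat.eq_zero_or_pos N with rfl | hN
  · simp
  · have : (N : ℝ) ≠ 0 := by positivity
    simp; field_simp

/-- A deviation above t forces the real or the imaginary part to deviate by at least t/2 in one of
two directions, so four one-sided Hoeffding bounds suffice. -/
theorem measureReal_empirical_deviation_le (μ : Measure (Torus (Fin d))) [IsProbabilityMeasure μ]
    (hN : 0 < N) (ξ : Fin d → ℤ) {t : ℝ} (ht : 0 ≤ t) :
    (Measure.pi fun _ : Fin N => μ).real
      {x | t < ‖(N : ℂ)⁻¹ * ∑ i, char (-ξ) (x i) - fourierCoeff μ ξ‖} ≤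
      4 * Real.exp (-(N * t ^ 2) / 8) := by
  set P := Measure.pi fun _ : Fin N => μ
  have hint : Integrable (char (-ξ)) μ := integrable_char _ _
  have hmeas : Measurable (char (-ξ)) := (continuous_char _).measurable
  have key : ∀ g : Torus (Fin d) → ℝ, Measurable g → (∀ x, |g x| ≤ 1) →
      P.real {x | N * (t / 2) ≤ ∑ i, (g (x i) - ∫ y, g y ∂μ)} ≤
        Real.exp (-(N * t ^ 2) / 8) := by
    intro g hg hg1
    refine (measureReal_sum_sub_integral_ge_le μ N hg hg1 (by linarith)).trans (le_of_eq ?_)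
    congr 1; ring
  set f₁ : Torus (Fin d) → ℝ := fun x => (char (-ξ) x).re
  set f₂ : Torus (Fin d) → ℝ := fun x => (char (-ξ) x).im
  have hf₁ : Measurable f₁ := Complex.measurable_re.comp hmeas
  have hf₂ : Measurable f₂ := Complex.measurable_im.comp hmeas
  have hb₁ : ∀ x, |f₁ x| ≤ 1 := fun x => (Complex.abs_re_le_norm _).trans (norm_char _ x).le
  have hb₂ : ∀ x, |f₂ x| ≤ 1 := fun x => (Complex.abs_im_le_norm _).trans (norm_char _ x).le
  have k₁ := key f₁ hf₁ hb₁
  have k₂ := key f₂ hf₂ hb₂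
  have k₃ := key (fun x => -f₁ x) hf₁.neg (by simpa using hb₁)
  have k₄ := key (fun x => -f₂ x) hf₂.neg (by simpa using hb₂)
  have hre : ∫ y, f₁ y ∂μ = (fourierCoeff μ ξ).re := by
    rw [fourierCoeff_eq]; exact integral_re hint
  have him : ∫ y, f₂ y ∂μ = (fourierCoeff μ ξ).im := by
    rw [fourierCoeff_eq]; exact integral_im hint
  rw [integral_neg, hre] at k₃
  rw [integral_neg, him] at k₄
  rw [hre] at k₁
  rw [him] at k₂
  have hN' : (0 : ℝ) < N := by exact_mod_cast hN
  refine (measureReal_mono (s₂ := ({x | N * (t / 2) ≤ ∑ i, (f₁ (x i) - (fourierCoeff μ ξ).re)} ∪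
      {x | N * (t / 2) ≤ ∑ i, (f₂ (x i) - (fourierCoeff μ ξ).im)}) ∪
      ({x | N * (t / 2) ≤ ∑ i, (-f₁ (x i) - -(fourierCoeff μ ξ).re)} ∪
      {x | N * (t / 2) ≤ ∑ i, (-f₂ (x i) - -(fourierCoeff μ ξ).im)})) ?_
      (measure_ne_top _ _)).trans ?_
  · intro x hx
    by_contra hcon
    simp only [Set.mem_union, Set.mem_ofPred_eq, not_or, not_le] at hcon hx
    obtain ⟨⟨h1, h2⟩, h3, h4⟩ := hcon
    simp only [Finset.sum_sub_distrib, Finset.sum_neg_distrib, Finset.sum_const,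
      Finset.card_univ, Fintype.card_fin, nsmul_eq_mul] at h1 h2 h3 h4
    set z := (N : ℂ)⁻¹ * ∑ i, char (-ξ) (x i) - fourierCoeff μ ξ with hz
    have hzN : (N : ℂ) * z = ∑ i, char (-ξ) (x i) - N * fourierCoeff μ ξ := by
      have : (N : ℂ) ≠ 0 := by exact_mod_cast hN.ne'
      rw [hz, mul_sub, ← mul_assoc, mul_inv_cancel₀ this, one_mul]
    have r1 : N * z.re = ∑ i, f₁ (x i) - N * (fourierCoeff μ ξ).re := by
      have := congrArg Complex.re hzN
      simpa [f₁] using this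
    have r2 : N * z.im = ∑ i, f₂ (x i) - N * (fourierCoeff μ ξ).im := by
      have := congrArg Complex.im hzN
      simpa [f₂] using this
    have a1 : |z.re| ≤ t / 2 := by
      rw [abs_le]; constructor <;> nlinarith
    have a2 : |z.im| ≤ t / 2 := by
      rw [abs_le]; constructor <;> nlinarith
    have := Complex.norm_le_abs_re_add_abs_im z
    linarith
  · refine (measureReal_union_le _ _).trans ?_
    refine (add_le_add (measureReal_union_le _ _) (measureReal_union_le _ _)).trans ?_
    linarith

/-- Distinct coordinates of the sample are independent with law μ. Injectivity is essential, and is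
the reason why bad tuples are counted over embeddings. -/
theorem map_comp_embedding_pi {X : Type*} [MeasurableSpace X] (μ : Measure X)
    [IsProbabilityMeasure μ] (f : Fin n ↪ Fin N) :
    (Measure.pi fun _ : Fin N => μ).map (fun x i => x (f i)) = Measure.pi fun _ : Fin n => μ := by
  have hind : ProbabilityTheory.iIndepFun (fun (i : Fin N) (x : Fin N → X) => x i)
      (Measure.pi fun _ : Fin N => μ) :=
    ProbabilityTheory.iIndepFun_pi (μ := fun _ : Fin N => μ)
      (X := fun _ y => y) fun i => aemeasurable_id
  have h2 := hind.precomp f.injective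
  rw [ProbabilityTheory.iIndepFun_iff_map_fun_eq_pi_map
    (fun i => (measurable_pi_apply (f i)).aemeasurable)] at h2
  refine h2.trans ?_
  congr 1
  funext i
  exact (measurePreserving_eval (fun _ : Fin N => μ) (f i)).map_eq

-- The expected number of tuples in A is at most T/2, so by Markov it reaches T with probability at
-- most 1/2. The deviation events have total probability strictly below 1/2, so some sample escapes
-- both.
open Classical in
theorem exists_sample (μ : Measure (Torus (Fin d))) [IsProbabilityMeasure μ] (hN : 0 < N)
    {S : Set (Torus (Fin d))} (hS : ∀ᵐ y ∂μ, y ∈ S)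
    {A : Set (Fin n → Torus (Fin d))} (hA : MeasurableSet A) (Ξ : Finset (Fin d → ℤ)) {t T : ℝ}
    (ht : 0 ≤ t) (hT : 0 < T)
    (hΞ : 4 * Ξ.card * Real.exp (-(N * t ^ 2) / 8) < 1 / 2)
    (hAT : (N : ℝ≥0∞) ^ n * (Measure.pi fun _ : Fin n => μ) A ≤ ENNReal.ofReal (T / 2)) :
    ∃ x : Fin N → Torus (Fin d), (∀ i, x i ∈ S) ∧
      (∀ ξ ∈ Ξ, ‖(N : ℂ)⁻¹ * ∑ i, char (-ξ) (x i) - fourierCoeff μ ξ‖ ≤ t) ∧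
      ((Finset.univ.filter fun f : Fin n ↪ Fin N => (fun i => x (f i)) ∈ A).card : ℝ) ≤ T := by
  set P := Measure.pi fun _ : Fin N => μ with hP
  set cnt : (Fin N → Torus (Fin d)) → ℝ≥0∞ := fun x =>
    ∑ f : Fin n ↪ Fin N, A.indicator 1 (fun i => x (f i)) with hcnt
  have hmc : ∀ f : Fin n ↪ Fin N, Measurable (fun (x : Fin N → Torus (Fin d)) i => x (f i)) :=
    fun f => measurable_pi_lambda _ fun i => measurable_pi_apply (f i)
  have hmi : ∀ f : Fin n ↪ Fin N, Measurable (fun x : Fin N → Torus (Fin d) =>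
      A.indicator (1 : (Fin n → Torus (Fin d)) → ℝ≥0∞) (fun i => x (f i))) :=
    fun f => (measurable_one.indicator hA).comp (hmc f)
  have hint : ∫⁻ x, cnt x ∂P ≤ ENNReal.ofReal (T / 2) := by
    rw [hcnt, lintegral_finsetSum _ fun f _ => hmi f]
    have : ∀ f : Fin n ↪ Fin N, ∫⁻ x, A.indicator 1 (fun i => x (f i)) ∂P
        = (Measure.pi fun _ : Fin n => μ) A := by
      intro f
      rw [← map_comp_embedding_pi μ f, ← lintegral_indicator_one hA,
        lintegral_map (measurable_one.indicator hA) (hmc f)]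
    simp_rw [this]
    rw [Finset.sum_const, nsmul_eq_mul]
    refine le_trans ?_ hAT
    gcongr
    rw [Finset.card_univ, Fintype.card_embedding_eq, Fintype.card_fin, Fintype.card_fin]
    exact_mod_cast Nat.descFactorial_le_pow N n
  have hmark : P {x | ENNReal.ofReal T ≤ cnt x} ≤ ENNReal.ofReal (1 / 2) := by
    have h1 := mul_meas_ge_le_lintegral (μ := P)
      (Finset.measurable_sum Finset.univ fun f _ => hmi f) (ENNReal.ofReal T)
    have h2 := h1.trans hint
    rw [show T / 2 = T * (1 / 2) by ring, ENNReal.ofReal_mul hT.le] at h2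
    exact (ENNReal.mul_le_mul_iff_right (by simpa using hT) ENNReal.ofReal_ne_top).1 h2
  have hdev : P.real (⋃ ξ ∈ Ξ, {x | t < ‖(N : ℂ)⁻¹ * ∑ i, char (-ξ) (x i) - fourierCoeff μ ξ‖})
      < 1 / 2 := by
    refine (measureReal_biUnion_finset_le _ _).trans_lt ?_
    refine (Finset.sum_le_sum fun ξ _ => measureReal_empirical_deviation_le μ hN ξ ht).trans_lt ?_
    rw [Finset.sum_const, nsmul_eq_mul]
    linarith
  have hlt : P ({x | ENNReal.ofReal T ≤ cnt x} ∪
      ⋃ ξ ∈ Ξ, {x | t < ‖(N : ℂ)⁻¹ * ∑ i, char (-ξ) (x i) - fourierCoeff μ ξ‖}) < 1 := by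
    refine (measure_union_le _ _).trans_lt ?_
    calc _ < ENNReal.ofReal (1 / 2) + ENNReal.ofReal (1 / 2) := by
          refine ENNReal.add_lt_add_of_le_of_lt (measure_ne_top _ _) hmark ?_
          rw [← ofReal_measureReal (measure_ne_top _ _)]
          exact (ENNReal.ofReal_lt_ofReal_iff (by norm_num)).2 hdev
      _ = 1 := by rw [← ENNReal.ofReal_add (by norm_num) (by norm_num)]; norm_num
  have hmem : ∀ᵐ x ∂P, ∀ i, x i ∈ S := ae_all_iff.2 fun i =>
    (measurePreserving_eval (fun _ : Fin N => μ) i).quasiMeasurePreserving.ae hS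
  obtain ⟨x, hxS, hx⟩ : ∃ x, (∀ i, x i ∈ S) ∧ x ∉ ({x | ENNReal.ofReal T ≤ cnt x} ∪
      ⋃ ξ ∈ Ξ, {x | t < ‖(N : ℂ)⁻¹ * ∑ i, char (-ξ) (x i) - fourierCoeff μ ξ‖}) := by
    -- Otherwise almost every sample would be bad, and the bad event would have probability 1.
    by_contra hcon
    push Not at hcon
    refine hlt.ne ((prob_compl_eq_zero_iff₀ ?_).1 ?_)
    · exact NullMeasurableSet.of_compl (NullMeasurableSet.of_null
        (measure_mono_null (fun x hx hS' => hx (hcon x hS')) (ae_iff.1 hmem)))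
    · exact measure_mono_null (fun x hx hS' => hx (hcon x hS')) (ae_iff.1 hmem)
  simp only [Set.mem_union, Set.mem_ofPred_eq, Set.mem_iUnion, not_or, not_exists, not_le,
    not_lt] at hx
  refine ⟨x, hxS, fun ξ hξ => hx.2 ξ hξ, ?_⟩
  have h1 : cnt x = ((Finset.univ.filter fun f : Fin n ↪ Fin N =>
      (fun i => x (f i)) ∈ A).card : ℝ≥0∞) := by
    simp only [hcnt, Set.indicator_apply, Pi.one_apply, Finset.sum_boole]
  have h2 := hx.1.le
  rw [h1, ← ENNReal.ofReal_natCast] at h2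
  exact (ENNReal.ofReal_le_ofReal_iff hT.le).1 h2

end Sampling

/-! ### Product Lebesgue measure on tuples of points -/

section Tuples

variable {d n : ℕ}

theorem measurable_tuple : Measurable (tuple : (Fin n → Torus (Fin d)) → Torus (Fin n × Fin d)) := by
  refine measurable_toLp_torus.comp (measurable_pi_lambda _ fun p => ?_)
  exact (measurable_pi_apply p.2).comp (measurable_ofLp_torus.comp (measurable_pi_apply p.1))

theorem map_tuple_pi_lebesgue :
    (Measure.pi fun _ : Fin n => lebesgue (Fin d)).map tuple = lebesgue (Fin n × Fin d) := by
  have hm : Measurable (fun (x : Fin n → Torus (Fin d)) (p : Fin n × Fin d) => x p.1 p.2) :=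
    measurable_pi_lambda _ fun p =>
      (measurable_pi_apply p.2).comp (measurable_ofLp_torus.comp (measurable_pi_apply p.1))
  have h1 : (volume : Measure (Fin n × Fin d → UnitAddCircle)) =
      (Measure.pi fun _ : Fin n => lebesgue (Fin d)).map (fun x p => x p.1 p.2) := by
    refine Measure.pi_eq fun s hs => ?_
    rw [Measure.map_apply hm (MeasurableSet.univ_pi hs)]
    have : (fun (x : Fin n → Torus (Fin d)) (p : Fin n × Fin d) => x p.1 p.2) ⁻¹' Set.univ.pi s
        = Set.univ.pi fun i => WithLp.ofLp ⁻¹' Set.univ.pi fun j => s (i, j) := by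
      ext x; simp [Set.mem_pi]
    rw [this, Measure.pi_pi, Fintype.prod_prod_type]
    refine Finset.prod_congr rfl fun i _ => ?_
    have hmi : MeasurableSet (Set.univ.pi fun j => s (i, j)) :=
      MeasurableSet.univ_pi fun j => hs (i, j)
    rw [lebesgue, Measure.map_apply measurable_toLp_torus (measurable_ofLp_torus hmi)]
    exact Measure.pi_pi _ _
  conv_rhs => rw [lebesgue, h1, Measure.map_map measurable_toLp_torus hm]
  rfl

theorem pi_preimage_tuple_le {μ : Measure (Torus (Fin d))} [IsProbabilityMeasure μ] {K : ℝ≥0∞}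
    (hK : K ≠ ∞) (h : μ ≤ K • lebesgue (Fin d)) {S : Set (Torus (Fin n × Fin d))}
    (hS : MeasurableSet S) :
    (Measure.pi fun _ : Fin n => μ) (tuple ⁻¹' S) ≤ K ^ n * lebesgue (Fin n × Fin d) S := by
  have h1 := pi_le_const_smul (κ := Fin n) hK h (tuple ⁻¹' S)
  rw [Fintype.card_fin, Measure.smul_apply, smul_eq_mul] at h1
  rwa [← map_tuple_pi_lebesgue, Measure.map_apply measurable_tuple hS]

end Tuples

/-! ### Fourier coefficients control how the support spreads -/

section Support

variable {d : ℕ}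

/-- Integrals of a fixed trigonometric polynomial depend on finitely many Fourier coefficients,
hence in a Lipschitz way on their uniform distance. -/
theorem norm_integral_span_sub_le (μ₁ : Measure (Torus (Fin d))) [IsProbabilityMeasure μ₁]
    {p : C(UnitAddTorus (Fin d), ℂ)}
    (hp : p ∈ Submodule.span ℂ (Set.range (UnitAddTorus.mFourier (d := Fin d)))) :
    ∃ C : ℝ, 0 ≤ C ∧ ∀ (δ : ℝ) (μ : Measure (Torus (Fin d))) [IsProbabilityMeasure μ],
      (∀ ξ, ‖fourierCoeff μ ξ - fourierCoeff μ₁ ξ‖ ≤ δ) →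
      ‖∫ x, p (WithLp.ofLp x) ∂μ - ∫ x, p (WithLp.ofLp x) ∂μ₁‖ ≤ C * δ := by
  have hi : ∀ (q : C(UnitAddTorus (Fin d), ℂ)) (μ : Measure (Torus (Fin d)))
      [IsProbabilityMeasure μ], Integrable (fun x : Torus (Fin d) => q (WithLp.ofLp x)) μ := by
    intro q μ _
    exact (q.continuous.comp (PiLp.continuous_ofLp 2 _)).integrable_of_hasCompactSupport
      (HasCompactSupport.of_compactSpace _)
  induction hp using Submodule.span_induction with
  | mem q hq =>
    obtain ⟨ξ, rfl⟩ := hq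
    refine ⟨1, zero_le_one, fun δ μ _ h => ?_⟩
    have := h (-ξ)
    rw [fourierCoeff, fourierCoeff, neg_neg] at this
    rwa [one_mul]
  | zero => exact ⟨0, le_rfl, fun δ μ _ h => by simp⟩
  | add p q _ _ hp hq =>
    obtain ⟨C₁, h₁, hp⟩ := hp
    obtain ⟨C₂, h₂, hq⟩ := hq
    refine ⟨C₁ + C₂, by positivity, fun δ μ _ h => ?_⟩
    simp only [ContinuousMap.add_apply]
    rw [integral_add (hi p μ) (hi q μ), integral_add (hi p μ₁) (hi q μ₁), add_sub_add_comm, add_mul]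
    exact (norm_add_le _ _).trans (add_le_add (hp δ μ h) (hq δ μ h))
  | smul a p _ hp =>
    obtain ⟨C, h, hp⟩ := hp
    refine ⟨‖a‖ * C, by positivity, fun δ μ _ h => ?_⟩
    simp only [ContinuousMap.smul_apply]
    rw [integral_smul, integral_smul, ← smul_sub, norm_smul, mul_assoc]
    exact mul_le_mul_of_nonneg_left (hp δ μ h) (norm_nonneg _)

/-- A tent function vanishing outside the larger ball has positive μ₁-integral m. Approximating it
uniformly to within m/4 by a trigonometric polynomial transfers positivity to every measure with
nearby coefficients. -/
theorem exists_tolerance_ball (μ₁ : Measure (Torus (Fin d))) [IsProbabilityMeasure μ₁]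
    (y : Torus (Fin d)) {ε : ℝ} (hε : 0 < ε) (h : 0 < μ₁ (Metric.ball y ε)) :
    ∃ δ : ℝ, 0 < δ ∧ ∀ (μ : Measure (Torus (Fin d))) [IsProbabilityMeasure μ],
      (∀ ξ, ‖fourierCoeff μ ξ - fourierCoeff μ₁ ξ‖ ≤ δ) → 0 < μ (Metric.ball y (2 * ε)) := by
  set g : Torus (Fin d) → ℝ := fun x => max 0 (2 * ε - dist x y) with hg
  have hgc : Continuous g := by fun_prop
  have hgi : ∀ (μ : Measure (Torus (Fin d))) [IsProbabilityMeasure μ], Integrable g μ :=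
    fun μ _ => hgc.integrable_of_hasCompactSupport (HasCompactSupport.of_compactSpace _)
  have hm : 0 < ∫ x, g x ∂μ₁ := by
    refine (integral_pos_iff_support_of_nonneg (f := g) (fun x => le_max_left _ _) (hgi μ₁)).2 ?_
    refine lt_of_lt_of_le h (measure_mono fun x hx => ?_)
    have := Metric.mem_ball.1 hx
    rw [Function.mem_support]
    exact (lt_max_of_lt_right (by linarith)).ne'
  set m := ∫ x, g x ∂μ₁
  set G : C(UnitAddTorus (Fin d), ℂ) :=
    ⟨fun x => (g (WithLp.toLp 2 x) : ℂ),
      Complex.continuous_ofReal.comp (hgc.comp (PiLp.continuous_toLp 2 _))⟩ with hG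
  have hcl : G ∈ closure (Submodule.span ℂ (Set.range (UnitAddTorus.mFourier (d := Fin d))) :
      Set C(UnitAddTorus (Fin d), ℂ)) := by
    rw [← Submodule.topologicalClosure_coe, UnitAddTorus.span_mFourier_closure_eq_top]
    trivial
  obtain ⟨p, hp, hpG⟩ := Metric.mem_closure_iff.1 hcl (m / 4) (by linarith)
  obtain ⟨C, hC0, hC⟩ := norm_integral_span_sub_le μ₁ hp
  have happ : ∀ (μ : Measure (Torus (Fin d))) [IsProbabilityMeasure μ],
      ‖∫ x, p (WithLp.ofLp x) ∂μ - ((∫ x, g x ∂μ : ℝ) : ℂ)‖ ≤ m / 4 := by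
    intro μ _
    have hpi : Integrable (fun x : Torus (Fin d) => p (WithLp.ofLp x)) μ :=
      (p.continuous.comp (PiLp.continuous_ofLp 2 _)).integrable_of_hasCompactSupport
        (HasCompactSupport.of_compactSpace _)
    have hgi' : Integrable (fun x : Torus (Fin d) => (g x : ℂ)) μ := (hgi μ).ofReal
    rw [← integral_complex_ofReal, ← integral_sub hpi hgi']
    have := norm_integral_le_of_norm_le_const (μ := μ)
      (f := fun x : Torus (Fin d) => p (WithLp.ofLp x) - (g x : ℂ)) (C := m / 4)
      (Filter.Eventually.of_forall fun x => by
        have h1 := ContinuousMap.norm_coe_le_norm (p - G) (WithLp.ofLp x)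
        rw [← dist_eq_norm, dist_comm] at h1
        exact h1.trans hpG.le)
    simpa using this
  refine ⟨m / (4 * (C + 1)), by positivity, fun μ _ hμ => ?_⟩
  rw [pos_iff_ne_zero]
  intro h0
  have hz : ∫ x, g x ∂μ = 0 := by
    refine integral_eq_zero_of_ae ?_
    have : ∀ᵐ x ∂μ, x ∉ Metric.ball y (2 * ε) := by
      rw [ae_iff]; simp only [not_not]; exact h0
    filter_upwards [this] with x hx
    rw [Metric.mem_ball, not_lt] at hx
    exact max_eq_left (by linarith)
  have h1 := happ μ
  have h2 := happ μ₁
  have h3 := hC _ μ hμ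
  rw [hz, Complex.ofReal_zero, sub_zero] at h1
  have h4 : C * (m / (4 * (C + 1))) ≤ m / 4 := by
    rw [← mul_div_assoc, div_le_div_iff₀ (by positivity) (by norm_num)]
    nlinarith
  have h5 : ‖((m : ℝ) : ℂ)‖ = m := by rw [Complex.norm_real, Real.norm_eq_abs, abs_of_pos hm]
  have h6 : ((m : ℝ) : ℂ) = ∫ x, p (WithLp.ofLp x) ∂μ
      - (∫ x, p (WithLp.ofLp x) ∂μ - ∫ x, p (WithLp.ofLp x) ∂μ₁)
      - (∫ x, p (WithLp.ofLp x) ∂μ₁ - ((m : ℝ) : ℂ)) := by ring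
  have h7 := norm_sub_le (∫ x, p (WithLp.ofLp x) ∂μ
      - (∫ x, p (WithLp.ofLp x) ∂μ - ∫ x, p (WithLp.ofLp x) ∂μ₁))
      (∫ x, p (WithLp.ofLp x) ∂μ₁ - ((m : ℝ) : ℂ))
  have h8 := norm_sub_le (∫ x, p (WithLp.ofLp x) ∂μ)
    (∫ x, p (WithLp.ofLp x) ∂μ - ∫ x, p (WithLp.ofLp x) ∂μ₁)
  rw [← h6, h5] at h7
  linarith

/-- If `μ₁` charges all balls around the points of a compact set `E₀`, then the support of every
measure with almost the same Fourier coefficients comes close to every point of `E₀`. -/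
theorem exists_tolerance_support (μ₁ : Measure (Torus (Fin d))) [IsProbabilityMeasure μ₁]
    {E₀ : Set (Torus (Fin d))} (hE : IsCompact E₀) {ε : ℝ} (hε : 0 < ε)
    (h : ∀ y ∈ E₀, 0 < μ₁ (Metric.ball y ε)) :
    ∃ δ : ℝ, 0 < δ ∧ ∀ (μ : Measure (Torus (Fin d))) [IsProbabilityMeasure μ],
      (∀ ξ, ‖fourierCoeff μ ξ - fourierCoeff μ₁ ξ‖ ≤ δ) →
      ∀ y ∈ E₀, ∃ z ∈ μ.support, dist y z < 3 * ε := by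
  choose! δ hδ0 hδ using fun y (hy : y ∈ E₀) => exists_tolerance_ball μ₁ y hε (h y hy)
  obtain ⟨F, hF, hcov⟩ := hE.elim_nhds_subcover (fun y => Metric.ball y ε)
    (fun y _ => Metric.ball_mem_nhds y hε)
  obtain ⟨δ₀, hδ₀, hδ₀F⟩ : ∃ δ₀ : ℝ, 0 < δ₀ ∧ ∀ y ∈ F, δ₀ ≤ δ y := by
    rcases F.eq_empty_or_nonempty with rfl | hne
    · exact ⟨1, one_pos, by simp⟩
    · obtain ⟨y, hy, hmin⟩ := F.exists_min_image δ hne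
      exact ⟨δ y, hδ0 y (hF y hy), hmin⟩
  refine ⟨δ₀, hδ₀, fun μ _ hμ y hy => ?_⟩
  obtain ⟨i, hi, hyi⟩ := Set.mem_iUnion₂.1 (hcov hy)
  have := hδ i (hF i hi) μ fun ξ => (hμ ξ).trans (hδ₀F i hi)
  obtain ⟨z, hz, hzs⟩ := Measure.nonempty_inter_support_of_pos this
  refine ⟨z, hzs, ?_⟩
  have h1 := Metric.mem_ball.1 hyi
  have h2 := Metric.mem_ball'.1 hz
  linarith [dist_triangle y i z]

end Support

/-! ### Error estimates for mollified and pruned samples -/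

section Estimates

variable {d : ℕ}

/-- The three terms are the sampling error at frequencies up to Q, the tail beyond Q where only the
decay of ψ is used, and the cost of mollifying μ₁. The factor r^(-s/2) arises because ψ cuts
frequencies off near 1/r. -/
theorem decayNorm_conv_sub_le {μ₁ ν ψ : Measure (Torus (Fin d))} [IsProbabilityMeasure μ₁]
    [IsProbabilityMeasure ν] [IsProbabilityMeasure ψ] {r s τ Q C₀ C₁ : ℝ} (hr : 0 < r)
    (hs : 0 ≤ s) (hsd : s ≤ d) (hτ : 0 ≤ τ) (hQ : 1 ≤ Q) (hC₀ : 0 < C₀) (hC₁ : 0 < C₁)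
    (hψs : ∀ᵐ x ∂ψ, ‖x‖ ≤ r)
    (hψd : ∀ ξ, ξ ≠ 0 → ‖fourierCoeff ψ ξ‖ ≤ C₀ / (r * freqNorm ξ) ^ (d + 1))
    (hμ₁ : ∀ ξ, ξ ≠ 0 → ‖fourierCoeff μ₁ ξ‖ ≤ C₁ / freqNorm ξ ^ (d + 1))
    (hν : ∀ ξ, ξ ≠ 0 → freqNorm ξ ≤ Q → ‖fourierCoeff ν ξ - fourierCoeff μ₁ ξ‖ ≤ τ) :
    decayNorm s (fourierCoeff (ν ∗ ψ) - fourierCoeff μ₁) ≤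
      ENNReal.ofReal (τ * (1 + C₀) * r ^ (-(s / 2)) +
        2 * C₀ / r ^ (d + 1) * Q ^ (-(((d : ℝ) + 1) / 2)) + 2 * Real.pi * C₁ * r) := by
  refine decayNorm_le_ofReal (by simp [fourierCoeff_zero]) fun ξ hξ => ?_
  have hf := one_le_freqNorm hξ
  set f := freqNorm ξ with hfdef
  have hf0 : 0 < f := by linarith
  have hfs : 0 < f ^ (s / 2) := Real.rpow_pos_of_pos hf0 _
  have hψ1 := norm_fourierCoeff_le_one ψ ξ
  have hQp : 0 < Q ^ (-(((d : ℝ) + 1) / 2)) := Real.rpow_pos_of_pos (by linarith) _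
  have hrp : 0 < r ^ (-(s / 2)) := Real.rpow_pos_of_pos hr _
  have hsplit : (fourierCoeff (ν ∗ ψ) - fourierCoeff μ₁) ξ =
      fourierCoeff ψ ξ * (fourierCoeff ν ξ - fourierCoeff μ₁ ξ) +
        (fourierCoeff ψ ξ - 1) * fourierCoeff μ₁ ξ := by
    rw [Pi.sub_apply, fourierCoeff_conv]; ring
  have hT1 : ‖fourierCoeff ψ ξ‖ * ‖fourierCoeff ν ξ - fourierCoeff μ₁ ξ‖ * f ^ (s / 2) ≤
      τ * (1 + C₀) * r ^ (-(s / 2)) + 2 * C₀ / r ^ (d + 1) * Q ^ (-(((d : ℝ) + 1) / 2)) := by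
    rcases le_or_gt f Q with hle | hgt
    -- Below frequency 1/r the trivial bound 1 for the coefficient is used, above it the decay of
    -- order d + 1, which beats s/2.
    · have h1 : ‖fourierCoeff ψ ξ‖ * (r * f) ^ (s / 2) ≤ 1 + C₀ := by
        rcases le_or_gt (r * f) 1 with h2 | h2
        · have := Real.rpow_le_one (by positivity) h2 (by linarith : 0 ≤ s / 2)
          have := mul_le_one₀ hψ1 (by positivity) this
          linarith
        · have h3 : (r * f) ^ (s / 2) ≤ (r * f) ^ (d + 1) := by
            rw [← Real.rpow_natCast]
            refine Real.rpow_le_rpow_of_exponent_le h2.le ?_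
            push_cast; linarith
          calc _ ≤ C₀ / (r * f) ^ (d + 1) * (r * f) ^ (d + 1) := by
                gcongr; exact hψd ξ hξ
            _ = C₀ := by field_simp
            _ ≤ 1 + C₀ := by linarith
      have h2 : f ^ (s / 2) = (r * f) ^ (s / 2) * r ^ (-(s / 2)) := by
        rw [Real.mul_rpow hr.le hf0.le, Real.rpow_neg hr.le]
        have : r ^ (s / 2) ≠ 0 := (Real.rpow_pos_of_pos hr _).ne'
        field_simp
      have h3 : 0 ≤ 2 * C₀ / r ^ (d + 1) * Q ^ (-(((d : ℝ) + 1) / 2)) := by positivity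
      rw [h2]
      calc _ = ‖fourierCoeff ν ξ - fourierCoeff μ₁ ξ‖ *
            (‖fourierCoeff ψ ξ‖ * (r * f) ^ (s / 2)) * r ^ (-(s / 2)) := by ring
        _ ≤ τ * (1 + C₀) * r ^ (-(s / 2)) := by
            gcongr
            exact hν ξ hξ hle
        _ ≤ _ := by linarith
    · have h1 : ‖fourierCoeff ν ξ - fourierCoeff μ₁ ξ‖ ≤ 2 := by
        refine (norm_sub_le _ _).trans ?_
        have := norm_fourierCoeff_le_one ν ξ
        have := norm_fourierCoeff_le_one μ₁ ξ
        linarith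
      have h2 : f ^ (s / 2) / f ^ (d + 1) ≤ Q ^ (-(((d : ℝ) + 1) / 2)) := by
        rw [← Real.rpow_natCast, ← Real.rpow_sub hf0]
        refine (Real.rpow_le_rpow_of_exponent_le hf (z := -(((d : ℝ) + 1) / 2)) ?_).trans ?_
        · push_cast; linarith
        · exact Real.rpow_le_rpow_of_nonpos (by linarith) hgt.le
            (by have : (0 : ℝ) ≤ d := Nat.cast_nonneg _
                linarith)
      have h3 : 0 ≤ τ * (1 + C₀) * r ^ (-(s / 2)) := by positivity
      calc _ ≤ C₀ / (r * f) ^ (d + 1) * 2 * f ^ (s / 2) := by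
            gcongr
            exact hψd ξ hξ
        _ = 2 * C₀ / r ^ (d + 1) * (f ^ (s / 2) / f ^ (d + 1)) := by
            rw [mul_pow]; field_simp
        _ ≤ 2 * C₀ / r ^ (d + 1) * Q ^ (-(((d : ℝ) + 1) / 2)) := by gcongr
        _ ≤ _ := by linarith
  have hT2 : ‖fourierCoeff ψ ξ - 1‖ * ‖fourierCoeff μ₁ ξ‖ * f ^ (s / 2) ≤
      2 * Real.pi * C₁ * r := by
    have h1 : f ^ (s / 2) ≤ f ^ d := by
      rw [← Real.rpow_natCast]
      exact Real.rpow_le_rpow_of_exponent_le hf (by linarith)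
    calc _ ≤ (2 * Real.pi * f * r) * (C₁ / f ^ (d + 1)) * f ^ d := by
          gcongr
          · exact norm_fourierCoeff_sub_one_le ψ hψs ξ
          · exact hμ₁ ξ hξ
      _ = 2 * Real.pi * C₁ * r := by rw [pow_succ]; field_simp
  rw [hsplit]
  calc _ ≤ (‖fourierCoeff ψ ξ‖ * ‖fourierCoeff ν ξ - fourierCoeff μ₁ ξ‖ +
        ‖fourierCoeff ψ ξ - 1‖ * ‖fourierCoeff μ₁ ξ‖) * f ^ (s / 2) := by
        gcongr
        refine (norm_add_le _ _).trans ?_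
        rw [norm_mul, norm_mul]
    _ ≤ _ := by rw [add_mul]; linarith

/-- Discarding a fraction τ of the points costs τ for the missing terms and τ for the
renormalization. -/
theorem norm_fourierCoeff_empirical_sub_le {N : ℕ} (hN : 0 < N) {G : Finset (Fin N)}
    (hG : G.Nonempty) (x : Fin N → Torus (Fin d)) {τ : ℝ} (hτ : ((Gᶜ.card : ℕ) : ℝ) ≤ N * τ)
    (ξ : Fin d → ℤ) :
    ‖fourierCoeff (empirical G x) ξ - (N : ℂ)⁻¹ * ∑ i, char (-ξ) (x i)‖ ≤ 2 * τ := by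
  have hN' : (0 : ℝ) < N := by exact_mod_cast hN
  have hp := isProbabilityMeasure_empirical hG x
  have hcard : (G.card : ℝ) + (Gᶜ.card : ℝ) = N := by
    have := Finset.card_add_card_compl G
    rw [Fintype.card_fin] at this
    exact_mod_cast this
  have hGc : (G.card : ℂ) ≠ 0 := by simpa using hG.ne_empty
  have hNc : (N : ℂ) ≠ 0 := by exact_mod_cast hN.ne'
  have h1 : (G.card : ℂ) * fourierCoeff (empirical G x) ξ = ∑ i ∈ G, char (-ξ) (x i) := by
    rw [fourierCoeff_empirical, ← mul_assoc, mul_inv_cancel₀ hGc, one_mul]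
  have hcardc : (G.card : ℂ) + (Gᶜ.card : ℂ) = N := by exact_mod_cast hcard
  have h2 : fourierCoeff (empirical G x) ξ - (N : ℂ)⁻¹ * ∑ i, char (-ξ) (x i) =
      (N : ℂ)⁻¹ * (Gᶜ.card * fourierCoeff (empirical G x) ξ - ∑ i ∈ Gᶜ, char (-ξ) (x i)) := by
    rw [← Finset.sum_add_sum_compl G, ← h1]
    field_simp
    rw [← hcardc]; ring
  rw [h2, norm_mul, norm_inv, Complex.norm_natCast]
  have h3 : ‖(Gᶜ.card : ℂ) * fourierCoeff (empirical G x) ξ - ∑ i ∈ Gᶜ, char (-ξ) (x i)‖ ≤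
      2 * (Gᶜ.card : ℝ) := by
    refine (norm_sub_le _ _).trans ?_
    have a1 : ‖(Gᶜ.card : ℂ) * fourierCoeff (empirical G x) ξ‖ ≤ Gᶜ.card := by
      rw [norm_mul, Complex.norm_natCast]
      exact mul_le_of_le_one_right (Nat.cast_nonneg _) (norm_fourierCoeff_le_one _ _)
    have a2 : ‖∑ i ∈ Gᶜ, char (-ξ) (x i)‖ ≤ Gᶜ.card := by
      refine (norm_sum_le _ _).trans ?_
      simp [norm_char]
    linarith
  rw [inv_mul_le_iff₀ hN']
  linarith

theorem dist_tuple_le {n : ℕ} {z w : Fin n → Torus (Fin d)} {δ : ℝ} (hδ : 0 ≤ δ)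
    (h : ∀ i, dist (z i) (w i) ≤ δ) : dist (tuple z) (tuple w) ≤ n * δ := by
  have h0 : dist (tuple z) (tuple w) ^ 2 = ∑ i, dist (z i) (w i) ^ 2 := by
    rw [PiLp.dist_eq_of_L2, Real.sq_sqrt (Finset.sum_nonneg fun _ _ => sq_nonneg _),
      Fintype.sum_prod_type]
    refine Finset.sum_congr rfl fun i _ => ?_
    rw [PiLp.dist_eq_of_L2, Real.sq_sqrt (Finset.sum_nonneg fun _ _ => sq_nonneg _)]
    rfl
  refine abs_le_of_sq_le_sq' ?_ (by positivity) |>.2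
  rw [h0]
  calc ∑ i, dist (z i) (w i) ^ 2 ≤ ∑ _i : Fin n, δ ^ 2 :=
        Finset.sum_le_sum fun i _ => pow_le_pow_left₀ dist_nonneg (h i) 2
    _ = n * δ ^ 2 := by simp
    _ ≤ (n * δ) ^ 2 := by
        rw [mul_pow]
        gcongr
        rcases Nat.eq_zero_or_pos n with rfl | hn
        · simp
        · have : (1 : ℝ) ≤ n := by exact_mod_cast hn
          nlinarith

end Estimates

/-! ### Volume of thickenings along a sequence of scales -/

section Minkowski

theorem frequently_lebesgue_thickening_le {ι : Type} [Fintype ι] {Z : Set (Torus ι)} {α ε : ℝ}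
    (hZ : lowerMinkowskiDim Z ≤ (α : EReal)) (hε : 0 < ε) :
    ∃ᶠ ρ in 𝓝[>] (0 : ℝ), lebesgue ι (Metric.thickening ρ Z) ≤
      ENNReal.ofReal (ρ ^ ((Fintype.card ι : ℝ) - α - ε)) := by
  have h1 : lowerMinkowskiDim Z < ((α + ε : ℝ) : EReal) :=
    hZ.trans_lt (by exact_mod_cast (by linarith : α < α + ε))
  have h2 := Filter.frequently_lt_of_liminf_lt (by isBoundedDefault) h1
  have h3 : ∀ᶠ ρ in 𝓝[>] (0 : ℝ), ρ ∈ Set.Ioo (0 : ℝ) 1 := Ioo_mem_nhdsGT one_pos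
  refine (h2.and_eventually h3).mono fun ρ ⟨hρ, hρ0, hρ1⟩ => ?_
  by_cases hz : lebesgue ι (Metric.thickening ρ Z) = 0
  · simp [hz]
  have htop : lebesgue ι (Metric.thickening ρ Z) ≠ ∞ := measure_ne_top _ _
  obtain ⟨v, hv0, hv⟩ : ∃ v : ℝ, 0 < v ∧ lebesgue ι (Metric.thickening ρ Z) = ENNReal.ofReal v :=
    ⟨_, ENNReal.toReal_pos hz htop, (ENNReal.ofReal_toReal htop).symm⟩
  rw [hv] at hρ ⊢
  refine ENNReal.ofReal_le_ofReal ?_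
  have hlog : ENNReal.log (ENNReal.ofReal v) = ((Real.log v : ℝ) : EReal) :=
    ENNReal.log_ofReal_of_pos hv0
  rw [hlog, ← EReal.coe_div, ← EReal.coe_sub, EReal.coe_lt_coe_iff] at hρ
  have hlr : Real.log ρ < 0 := Real.log_neg hρ0 hρ1
  have h4 : (Fintype.card ι : ℝ) - α - ε < Real.log v / Real.log ρ := by linarith
  rw [lt_div_iff_of_neg hlr] at h4
  rw [← Real.log_le_log_iff hv0 (Real.rpow_pos_of_pos hρ0 _), Real.log_rpow hρ0]
  exact h4.le

end Minkowski

/-! ### Limits used in the choice of the scale -/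

section Parameters

theorem tendsto_const_mul_rpow_nhdsGT (c : ℝ) {e : ℝ} (he : 0 < e) :
    Filter.Tendsto (fun ρ : ℝ => c * ρ ^ e) (𝓝[>] 0) (𝓝 0) := by
  have h := (Real.continuousAt_rpow_const 0 e (Or.inr he.le)).tendsto
  rw [Real.zero_rpow he.ne'] at h
  simpa using (h.mono_left nhdsWithin_le_nhds).const_mul c

theorem tendsto_const_mul_rpow_neg_mul_exp_nhdsGT (c : ℝ) (k : ℝ) {g : ℝ} (hg : 0 < g) :
    Filter.Tendsto (fun ρ : ℝ => c * ρ ^ (-k) * Real.exp (-ρ ^ (-g) / 8)) (𝓝[>] 0) (𝓝 0) := by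
  have h1 := tendsto_rpow_mul_exp_neg_mul_atTop_nhds_zero (k / g) (1 / 8) (by norm_num)
  have h2 : Filter.Tendsto (fun ρ : ℝ => ρ ^ (-g)) (𝓝[>] 0) Filter.atTop :=
    tendsto_rpow_neg_nhdsGT_zero (by linarith)
  have h3 := (h1.comp h2).const_mul c
  rw [mul_zero] at h3
  refine h3.congr' ?_
  filter_upwards [self_mem_nhdsWithin] with ρ hρ
  have hρ0 : 0 < ρ := hρ
  simp only [Function.comp_apply]
  rw [← Real.rpow_mul hρ0.le, mul_assoc]
  congr 3
  · field_simp
  · ring_nf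

end Parameters

/-! ### Pruned random discretization avoiding Z -/

section Discretization

variable {d n : ℕ}

/-- The cube of frequencies with entries in `[-R, R]`. -/
def freqCube (d R : ℕ) : Finset (Fin d → ℤ) :=
  Fintype.piFinset fun _ => Finset.Icc (-(R : ℤ)) R

theorem card_freqCube (d R : ℕ) : (freqCube d R).card = (2 * R + 1) ^ d := by
  rw [freqCube, Fintype.card_piFinset]
  simp only [Int.card_Icc, Finset.prod_const, Finset.card_univ, Fintype.card_fin]
  congr 1
  omega

theorem mem_freqCube {R : ℕ} {ξ : Fin d → ℤ} (h : freqNorm ξ ≤ R) : ξ ∈ freqCube d R := by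
  rw [freqCube, Fintype.mem_piFinset]
  intro i
  have := (abs_le_freqNorm ξ i).trans h
  rw [Finset.mem_Icc, ← abs_le]
  exact_mod_cast this

/-- The deterministic half of the construction, with all parameters left free: sample, delete,
mollify. `hV` bounds the expected number of bad tuples by half of the permitted deletions, and
`hexp` is the union bound over frequencies. -/
theorem exists_discretization_of_sample {N : ℕ} (hN : 0 < N) {μ₁ : Measure (Torus (Fin d))}
    [IsProbabilityMeasure μ₁] {S : Set (Torus (Fin d))} (hS : ∀ᵐ y ∂μ₁, y ∈ S)
    {C₀ C₁ K : ℝ} (hC₀ : 0 < C₀) (hC₁ : 0 < C₁) (hK : 0 ≤ K)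
    (hmol : ∀ r : ℝ, 0 < r → r ≤ 1 →
      ∃ ψ : Measure (Torus (Fin d)), IsProbabilityMeasure ψ ∧ (∀ᵐ x ∂ψ, ‖x‖ ≤ r) ∧
      (∀ ξ : Fin d → ℤ, ξ ≠ 0 → ‖fourierCoeff ψ ξ‖ ≤ C₀ / (r * freqNorm ξ) ^ (d + 1)) ∧
      ∃ K : ℝ≥0∞, K ≠ ∞ ∧ ψ ≤ K • lebesgue (Fin d))
    (hμ₁ : ∀ ξ, ξ ≠ 0 → ‖fourierCoeff μ₁ ξ‖ ≤ C₁ / freqNorm ξ ^ (d + 1))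
    (hμK : μ₁ ≤ ENNReal.ofReal K • lebesgue (Fin d))
    {Z : Set (Torus (Fin n × Fin d))} {s ρ r τ V : ℝ} {R : ℕ} (hn : 0 < n) (hs : 0 ≤ s)
    (hsd : s ≤ d)
    (hr : 0 < r) (hr1 : r ≤ 1) (hrρ : n * (2 * r) < ρ) (hτ0 : 0 < τ) (hτ1 : τ < 1) (hR : 1 ≤ R)
    (hZ : lebesgue _ (Metric.thickening ρ Z) ≤ ENNReal.ofReal V)
    (hV : (N : ℝ) ^ n * (K ^ n * V) ≤ N * τ / 2)
    (hexp : 4 * (2 * (R : ℝ) + 1) ^ d * Real.exp (-(N * τ ^ 2) / 8) < 1 / 2) :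
    ∃ (F : Finset (Torus (Fin d))) (μ : Measure (Torus (Fin d))), IsProbabilityMeasure μ ∧
      F.card ≤ N ∧ (∀ y ∈ F, y ∈ S) ∧ (∀ᵐ y ∂μ, ∃ g ∈ F, dist y g ≤ r) ∧
      (∃ C : ℝ, ∀ ξ, ξ ≠ 0 → ‖fourierCoeff μ ξ‖ ≤ C / freqNorm ξ ^ (d + 1)) ∧
      decayNorm s (fourierCoeff μ - fourierCoeff μ₁) ≤
        ENNReal.ofReal (3 * τ * (1 + C₀) * r ^ (-(s / 2)) +
          2 * C₀ / r ^ (d + 1) * (R : ℝ) ^ (-(((d : ℝ) + 1) / 2)) + 2 * Real.pi * C₁ * r) ∧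
      ∀ z : Fin n → Torus (Fin d), (∀ i j, i ≠ j → 4 * r < dist (z i) (z j)) →
        (∀ i, ∃ g ∈ F, dist (z i) g ≤ 2 * r) → tuple z ∉ Z := by
  classical
  have hN' : (0 : ℝ) < N := by exact_mod_cast hN
  have hAm : MeasurableSet ((tuple : (Fin n → Torus (Fin d)) → _) ⁻¹' Metric.thickening ρ Z) :=
    measurable_tuple Metric.isOpen_thickening.measurableSet
  obtain ⟨x, hxS, hxd, hxc⟩ := exists_sample μ₁ hN hS hAm (freqCube d R) hτ0.le
    (T := N * τ) (by positivity) (by rw [card_freqCube]; push_cast; exact hexp) (by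
      refine le_trans ?_ (ENNReal.ofReal_le_ofReal hV)
      rw [ENNReal.ofReal_mul (by positivity), ENNReal.ofReal_mul (by positivity),
        ENNReal.ofReal_pow (by positivity), ENNReal.ofReal_pow hK, ENNReal.ofReal_natCast]
      gcongr
      refine (pi_preimage_tuple_le ENNReal.ofReal_ne_top hμK
        Metric.isOpen_thickening.measurableSet).trans ?_
      gcongr)
  set bad : Finset (Fin n ↪ Fin N) := Finset.univ.filter fun f =>
    (fun i => x (f i)) ∈ (tuple : (Fin n → Torus (Fin d)) → _) ⁻¹' Metric.thickening ρ Z with hbad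
  -- Removing the first index of each bad tuple destroys all of them at the price of at most N τ
  -- points.
  set B : Finset (Fin N) := bad.image fun f => f ⟨0, hn⟩ with hB
  set G : Finset (Fin N) := Bᶜ with hG
  have hGc : ((Gᶜ.card : ℕ) : ℝ) ≤ N * τ := by
    rw [hG, compl_compl]
    refine le_trans ?_ hxc
    exact_mod_cast Finset.card_image_le
  have hGne : G.Nonempty := by
    rw [Finset.nonempty_iff_ne_empty]
    intro h0
    rw [h0, Finset.compl_empty, Finset.card_univ, Fintype.card_fin] at hGc
    nlinarith
  obtain ⟨ψ, hψ, hψs, hψd, -⟩ := hmol r hr hr1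
  have hνp := isProbabilityMeasure_empirical hGne x
  have hdev : ∀ ξ, ξ ≠ 0 → freqNorm ξ ≤ (R : ℝ) →
      ‖fourierCoeff (empirical G x) ξ - fourierCoeff μ₁ ξ‖ ≤ 3 * τ := by
    intro ξ _ hξR
    have h1 := hxd ξ (mem_freqCube hξR)
    have h2 := norm_fourierCoeff_empirical_sub_le hN hGne x hGc ξ
    have h3 := norm_add_le
      (fourierCoeff (empirical G x) ξ - (N : ℂ)⁻¹ * ∑ i, char (-ξ) (x i))
      ((N : ℂ)⁻¹ * ∑ i, char (-ξ) (x i) - fourierCoeff μ₁ ξ)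
    rw [sub_add_sub_cancel] at h3
    linarith
  refine ⟨G.image x, empirical G x ∗ ψ, inferInstance, ?_, ?_, ?_, ⟨C₀ / r ^ (d + 1), ?_⟩, ?_, ?_⟩
  · refine Finset.card_image_le.trans ((Finset.card_le_univ G).trans ?_)
    rw [Fintype.card_fin]
  · intro y hy
    obtain ⟨i, -, rfl⟩ := Finset.mem_image.1 hy
    exact hxS i
  · have hclosed : IsClosed (⋃ g ∈ G.image x, Metric.closedBall g r) :=
      (G.image x).finite_toSet.isClosed_biUnion fun g _ => Metric.isClosed_closedBall
    have := ae_conv_mem (μ := empirical G x) (ν := ψ) (A := (G.image x : Set (Torus (Fin d))))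
      hclosed.measurableSet (ae_empirical fun i hi => by
        exact_mod_cast Finset.mem_image_of_mem x hi) hψs (fun a ha y hy => by
        refine Set.mem_iUnion₂.2 ⟨a, by exact_mod_cast ha, ?_⟩
        have : ‖y‖ ≤ r := hy
        rw [Metric.mem_closedBall, dist_eq_norm]; simpa using this)
    filter_upwards [this] with y hy
    obtain ⟨g, hg, hyg⟩ := Set.mem_iUnion₂.1 hy
    exact ⟨g, hg, hyg⟩
  · intro ξ hξ
    rw [fourierCoeff_conv, norm_mul, div_div, ← mul_pow]
    exact (mul_le_of_le_one_left (norm_nonneg _) (norm_fourierCoeff_le_one _ _)).trans (hψd ξ hξ)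
  · exact decayNorm_conv_sub_le hr hs hsd (by positivity) (by exact_mod_cast hR) hC₀ hC₁ hψs hψd
      hμ₁ hdev
  · intro z hz hzF hzZ
    have : ∀ i, ∃ j ∈ G, dist (z i) (x j) ≤ 2 * r := by
      intro i
      obtain ⟨g, hg, hd⟩ := hzF i
      obtain ⟨j, hj, rfl⟩ := Finset.mem_image.1 hg
      exact ⟨j, hj, hd⟩
    choose f hfG hfd using this
    -- Points more than 4r apart cannot lie within 2r of the same sample point, so the indices form
    -- an embedding. If `tuple z` were in Z, this embedding would be bad, yet its first index
    -- survived.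
    have hinj : Function.Injective f := by
      intro i j hij
      by_contra hne
      have h1 := hz i j hne
      have h2 := dist_triangle (z i) (x (f i)) (z j)
      have h3 := hfd j
      rw [← hij, dist_comm] at h3
      linarith [hfd i]
    have hmem : (⟨f, hinj⟩ : Fin n ↪ Fin N) ∈ bad := by
      rw [hbad, Finset.mem_filter]
      refine ⟨Finset.mem_univ _, Metric.mem_thickening_iff.2 ⟨tuple z, hzZ, ?_⟩⟩
      rw [dist_comm]
      exact (dist_tuple_le (by positivity) hfd).trans_lt hrρ
    have h4 := hfG ⟨0, hn⟩
    rw [hG, Finset.mem_compl] at h4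
    exact h4 (Finset.mem_image_of_mem (fun f : Fin n ↪ Fin N => f ⟨0, hn⟩) hmem)

-- Everything is a power of one scale ρ: N ≈ ρ^(-β₁), τ = ρ^κ, frequency cutoff R ≈ ρ^(-4), radius r
-- = ρ / a. With s/2 < κ < β₁/2 < β/2, each error term is a positive power of ρ or exponentially
-- small.
set_option maxHeartbeats 1000000 in
theorem exists_discretization {μ₁ : Measure (Torus (Fin d))}
    [IsProbabilityMeasure μ₁] {S : Set (Torus (Fin d))} (hS : ∀ᵐ y ∂μ₁, y ∈ S)
    {C₁ : ℝ} (hC₁ : 0 < C₁)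
    (hμ₁ : ∀ ξ, ξ ≠ 0 → ‖fourierCoeff μ₁ ξ‖ ≤ C₁ / freqNorm ξ ^ (d + 1))
    {K : ℝ≥0∞} (hK : K ≠ ∞) (hμK : μ₁ ≤ K • lebesgue (Fin d))
    {Z : Set (Torus (Fin n × Fin d))} {α β s : ℝ} (hn : 0 < n) (hs : 0 ≤ s) (hsβ : s < β)
    (hβd : β ≤ d) (hβ : β * ((n : ℝ) - 1 / 2) ≤ d * n - α)
    (hZ : lowerMinkowskiDim Z ≤ (α : EReal)) {ε η γ : ℝ} (hε : 0 < ε) (hη : 0 < η) (hγ : 0 < γ) :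
    ∃ (F : Finset (Torus (Fin d))) (μ : Measure (Torus (Fin d))) (r : ℝ),
      IsProbabilityMeasure μ ∧ 0 < r ∧ r ≤ ε ∧ 2 * r < γ ∧
      F.card * (2 * r) ^ (β + γ) ≤ γ ∧ (∀ y ∈ F, y ∈ S) ∧ (∀ᵐ y ∂μ, ∃ g ∈ F, dist y g ≤ r) ∧
      (∃ C : ℝ, ∀ ξ, ξ ≠ 0 → ‖fourierCoeff μ ξ‖ ≤ C / freqNorm ξ ^ (d + 1)) ∧
      decayNorm s (fourierCoeff μ - fourierCoeff μ₁) ≤ ENNReal.ofReal ε ∧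
      ∀ z : Fin n → Torus (Fin d), (∀ i j, i ≠ j → η ≤ dist (z i) (z j)) →
        (∀ i, ∃ g ∈ F, dist (z i) g ≤ 2 * r) → tuple z ∉ Z := by
  obtain ⟨C₀, hC₀, hmol⟩ := exists_mollifier d
  obtain ⟨m, rfl⟩ : ∃ m, n = m + 1 := ⟨n - 1, by omega⟩
  obtain ⟨β₁, hβ₁, hβ₁β, κ, hκs, hκβ⟩ : ∃ β₁ : ℝ, s < β₁ ∧ β₁ < β ∧ ∃ κ : ℝ, s / 2 < κ ∧
      κ < β₁ / 2 := ⟨(s + β) / 2, by linarith, by linarith, (3 * s + β) / 8, by linarith,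
        by linarith⟩
  -- Since n = m + 1, this is 2n + 1, so that n * (2 * r) < ρ.
  set a : ℝ := 2 * ((m : ℝ) + 1) + 1 with ha
  have hm0 : (0 : ℝ) ≤ m := Nat.cast_nonneg _
  have ha3 : 3 ≤ a := by rw [ha]; linarith
  have hκ0 : 0 < κ := by linarith
  -- The critical inequality: as κ < β₁/2, the exponent exceeds (β - β₁)(m + 1/2) - ε₁, because β(m
  -- + 1/2) ≤ dn - α.
  obtain ⟨ε₁, hε₁, hslack⟩ : ∃ ε₁ : ℝ, 0 < ε₁ ∧
      0 < (d * ((m : ℝ) + 1) - α - ε₁) - β₁ * m - κ := by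
    refine ⟨(β - β₁) / 4, by linarith, ?_⟩
    push_cast at hβ
    nlinarith
  set e : ℝ := d * ((m : ℝ) + 1) - α - ε₁ with he
  have hfreq := frequently_lebesgue_thickening_le hZ hε₁
  have hcard : (Fintype.card (Fin (m + 1) × Fin d) : ℝ) - α - ε₁ = e := by
    rw [Fintype.card_prod, Fintype.card_fin, Fintype.card_fin, he]; push_cast; ring
  rw [hcard] at hfreq
  set k : ℝ := K.toReal with hk
  have ev0 : ∀ᶠ ρ in 𝓝[>] (0 : ℝ), ρ ∈ Set.Ioo (0 : ℝ) (min (min 1 ε) (min γ (η / 2))) :=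
    Ioo_mem_nhdsGT (by positivity)
  have ev1 := (tendsto_const_mul_rpow_neg_mul_exp_nhdsGT (4 * 5 ^ d) (4 * d) (g := β₁ - 2 * κ)
    (by linarith)).eventually_lt_const (u := 1 / 2) (by norm_num)
  have ev2 := (tendsto_const_mul_rpow_nhdsGT (2 ^ (m + 1) * k ^ (m + 1)) hslack).eventually_lt_const
    (u := 1) one_pos
  have ev3 : ∀ᶠ ρ in 𝓝[>] (0 : ℝ), 3 * (1 + C₀) * a ^ (s / 2) * ρ ^ (κ - s / 2) +
      2 * C₀ * a ^ (d + 1) * ρ ^ ((d : ℝ) + 1) + 2 * Real.pi * C₁ / a * ρ ^ (1 : ℝ) < ε := by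
    have h1 := tendsto_const_mul_rpow_nhdsGT (3 * (1 + C₀) * a ^ (s / 2)) (e := κ - s / 2)
      (by linarith)
    have h2 := tendsto_const_mul_rpow_nhdsGT (2 * C₀ * a ^ (d + 1)) (e := (d : ℝ) + 1)
      (by positivity)
    have h3 := tendsto_const_mul_rpow_nhdsGT (2 * Real.pi * C₁ / a) (e := 1) one_pos
    exact ((h1.add h2).add h3).eventually_lt_const (by simpa using hε)
  have ev4 := (tendsto_const_mul_rpow_nhdsGT 2 (e := β + γ - β₁)
    (by linarith)).eventually_lt_const hγ
  -- The volume bound for Z holds for arbitrarily small ρ only, the remaining conditions for all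
  -- small ρ, so a common scale exists.
  obtain ⟨ρ, hρZ, ⟨hρ0, hρmin⟩, h1, h2, h3, h4⟩ :=
    (hfreq.and_eventually (ev0.and (ev1.and (ev2.and (ev3.and ev4))))).exists
  simp only [lt_min_iff] at hρmin
  obtain ⟨⟨hρ1, hρε⟩, hργ, hρη⟩ := hρmin
  set N : ℕ := ⌈ρ ^ (-β₁)⌉₊ with hN
  set R : ℕ := ⌈ρ ^ (-4 : ℝ)⌉₊ with hR
  have hb1 : 1 ≤ ρ ^ (-β₁) :=
    Real.one_le_rpow_of_pos_of_le_one_of_nonpos hρ0 hρ1.le (by linarith)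
  have hb4 : 1 ≤ ρ ^ (-4 : ℝ) :=
    Real.one_le_rpow_of_pos_of_le_one_of_nonpos hρ0 hρ1.le (by norm_num)
  have hN1 : ρ ^ (-β₁) ≤ N := Nat.le_ceil _
  have hN2 : (N : ℝ) ≤ 2 * ρ ^ (-β₁) := by
    have := Nat.ceil_lt_add_one (zero_le_one.trans hb1)
    linarith
  have hR1 : ρ ^ (-4 : ℝ) ≤ R := Nat.le_ceil _
  have hR2 : (R : ℝ) ≤ 2 * ρ ^ (-4 : ℝ) := by
    have := Nat.ceil_lt_add_one (zero_le_one.trans hb4)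
    linarith
  have hNpos : 0 < N := by
    have : (0 : ℝ) < N := by linarith
    exact_mod_cast this
  have hNpos' : (0 : ℝ) < N := by exact_mod_cast hNpos
  have hRpos : 1 ≤ R := by
    have : (1 : ℝ) ≤ R := hb4.trans hR1
    exact_mod_cast this
  set r : ℝ := ρ / a with hr
  have hr0 : 0 < r := by positivity
  have hra : r * a = ρ := by rw [hr]; field_simp
  have hr2 : 2 * r ≤ ρ := by nlinarith
  have hτ0 : 0 < ρ ^ κ := Real.rpow_pos_of_pos hρ0 _
  have hτ1 : ρ ^ κ < 1 := Real.rpow_lt_one hρ0.le hρ1 hκ0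
  have hVle : (N : ℝ) ^ (m + 1) * (k ^ (m + 1) * ρ ^ e) ≤ N * ρ ^ κ / 2 := by
    have hk0 : 0 ≤ k := ENNReal.toReal_nonneg
    have hpe : 0 < ρ ^ e := Real.rpow_pos_of_pos hρ0 _
    have a1 : (N : ℝ) ^ m ≤ 2 ^ m * ρ ^ (-β₁ * m) := by
      calc (N : ℝ) ^ m ≤ (2 * ρ ^ (-β₁)) ^ m := pow_le_pow_left₀ hNpos'.le hN2 m
        _ = 2 ^ m * ρ ^ (-β₁ * m) := by
            rw [mul_pow, Real.rpow_mul hρ0.le, Real.rpow_natCast]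
    have a2 : ρ ^ (-β₁ * m) * ρ ^ e = ρ ^ (e - β₁ * m - κ) * ρ ^ κ := by
      rw [← Real.rpow_add hρ0, ← Real.rpow_add hρ0]; congr 1; ring
    calc (N : ℝ) ^ (m + 1) * (k ^ (m + 1) * ρ ^ e) = N * (N ^ m * (k ^ (m + 1) * ρ ^ e)) := by ring
      _ ≤ N * ((2 ^ m * ρ ^ (-β₁ * m)) * (k ^ (m + 1) * ρ ^ e)) := by gcongr
      _ = N * (2 ^ m * k ^ (m + 1) * (ρ ^ (-β₁ * m) * ρ ^ e)) := by ring
      _ = N * ρ ^ κ / 2 * (2 ^ (m + 1) * k ^ (m + 1) * ρ ^ (e - β₁ * m - κ)) := by rw [a2]; ring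
      _ ≤ N * ρ ^ κ / 2 * 1 := by gcongr
      _ = _ := mul_one _
  have hexp : 4 * (2 * (R : ℝ) + 1) ^ d * Real.exp (-(N * (ρ ^ κ) ^ 2) / 8) < 1 / 2 := by
    refine lt_of_le_of_lt ?_ h1
    have a1 : (2 * (R : ℝ) + 1) ^ d ≤ 5 ^ d * ρ ^ (-(4 * (d : ℝ))) := by
      calc (2 * (R : ℝ) + 1) ^ d ≤ (5 * ρ ^ (-4 : ℝ)) ^ d := by
            gcongr; linarith
        _ = _ := by
            rw [mul_pow, ← Real.rpow_natCast (ρ ^ (-4 : ℝ)), ← Real.rpow_mul hρ0.le]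
            congr 2; ring
    have a2 : ρ ^ (-(β₁ - 2 * κ)) ≤ N * (ρ ^ κ) ^ 2 := by
      calc ρ ^ (-(β₁ - 2 * κ)) = ρ ^ (-β₁) * (ρ ^ κ) ^ 2 := by
            rw [← Real.rpow_natCast (ρ ^ κ), ← Real.rpow_mul hρ0.le, ← Real.rpow_add hρ0]
            congr 1; push_cast; ring
        _ ≤ _ := by gcongr
    calc _ ≤ 4 * (5 ^ d * ρ ^ (-(4 * (d : ℝ)))) * Real.exp (-ρ ^ (-(β₁ - 2 * κ)) / 8) := by
          gcongr
      _ = _ := by ring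
  have hμK' : μ₁ ≤ ENNReal.ofReal k • lebesgue (Fin d) := by
    rwa [hk, ENNReal.ofReal_toReal hK]
  obtain ⟨F, μ, hμ, hFN, hFS, hFμ, hdec, hclose, havoid⟩ :=
    exists_discretization_of_sample hNpos hS hC₀ hC₁ ENNReal.toReal_nonneg hmol hμ₁ hμK'
      (Z := Z) (s := s) (ρ := ρ) (r := r) (τ := ρ ^ κ) (V := ρ ^ e) (R := R) hn hs (by linarith) hr0
      (by linarith) (by push_cast; rw [← hra, ha]; nlinarith) hτ0 hτ1 hRpos hρZ
      hVle hexp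
  refine ⟨F, μ, r, hμ, hr0, by linarith, by linarith, ?_, hFS, hFμ, hdec, hclose.trans ?_, ?_⟩
  · refine le_trans ?_ h4.le
    calc (F.card : ℝ) * (2 * r) ^ (β + γ) ≤ (2 * ρ ^ (-β₁)) * ρ ^ (β + γ) := by
          gcongr
          · refine le_trans ?_ hN2
            exact_mod_cast hFN
          · linarith
      _ = 2 * ρ ^ (β + γ - β₁) := by
          rw [mul_assoc, ← Real.rpow_add hρ0]; congr 2; ring
  · refine ENNReal.ofReal_le_ofReal (le_trans ?_ h3.le)
    have b1 : 3 * ρ ^ κ * (1 + C₀) * r ^ (-(s / 2)) =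
        3 * (1 + C₀) * a ^ (s / 2) * ρ ^ (κ - s / 2) := by
      rw [hr, Real.div_rpow hρ0.le (by positivity), Real.rpow_sub hρ0, Real.rpow_neg hρ0.le,
        Real.rpow_neg (by positivity : 0 ≤ a)]
      have : a ^ (s / 2) ≠ 0 := (Real.rpow_pos_of_pos (by positivity) _).ne'
      have : ρ ^ (s / 2) ≠ 0 := (Real.rpow_pos_of_pos hρ0 _).ne'
      field_simp
    have b2 : 2 * C₀ / r ^ (d + 1) * (R : ℝ) ^ (-(((d : ℝ) + 1) / 2)) ≤
        2 * C₀ * a ^ (d + 1) * ρ ^ ((d : ℝ) + 1) := by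
      -- The exponent 4 in R gives ρ^(2(d+1)), enough to absorb r^(-(d+1)) and leave ρ^(d+1).
      have c1 : (R : ℝ) ^ (-(((d : ℝ) + 1) / 2)) ≤ ρ ^ (2 * ((d : ℝ) + 1)) := by
        refine (Real.rpow_le_rpow_of_nonpos (by positivity) hR1 ?_).trans (le_of_eq ?_)
        · have : (0 : ℝ) ≤ d := Nat.cast_nonneg _
          linarith
        · rw [← Real.rpow_mul hρ0.le]; congr 1; ring
      have c2 : ρ ^ (2 * ((d : ℝ) + 1)) = ρ ^ (d + 1) * ρ ^ ((d : ℝ) + 1) := by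
        rw [← Real.rpow_natCast, ← Real.rpow_add hρ0]; congr 1; push_cast; ring
      calc _ ≤ 2 * C₀ / r ^ (d + 1) * ρ ^ (2 * ((d : ℝ) + 1)) := by gcongr
        _ = _ := by rw [c2, hr, div_pow]; field_simp
    have b3 : 2 * Real.pi * C₁ * r = 2 * Real.pi * C₁ / a * ρ ^ (1 : ℝ) := by
      rw [Real.rpow_one, hr]; ring
    rw [b1, b3]
    linarith
  · intro z hz hzF
    exact havoid z (fun i j hij => lt_of_lt_of_le (by linarith) (hz i j hij)) hzF

end Discretization

/-! ### Neighbourhoods in `XSpace` -/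

section Neighbourhoods

variable {d : ℕ} {β : ℝ}

theorem decayNorm_sub_mono {s t : ℝ} (hst : s ≤ t) (μ ν : ProbabilityMeasure (Torus (Fin d))) :
    decayNorm s (fourierCoeff (μ : Measure (Torus (Fin d))) - fourierCoeff (ν : Measure _)) ≤
      decayNorm t (fourierCoeff (μ : Measure (Torus (Fin d))) - fourierCoeff (ν : Measure _)) :=
  decayNorm_mono hst (by simp [fourierCoeff_zero])

/-- The filter of sets that contain all `q` close to `p` in the Hausdorff metric and in a single
one of the seminorms. -/
def XSpace.basicFilter (hβ : 0 < β) (p : XSpace d β) : Filter (XSpace d β) where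
  sets := {V | ∃ s ε : ℝ, 0 ≤ s ∧ s < β ∧ 0 < ε ∧ ∀ q : XSpace d β, dist q.E p.E < ε →
    decayNorm s (fourierCoeff (q.μ : Measure (Torus (Fin d))) - fourierCoeff (p.μ : Measure _)) <
      ENNReal.ofReal ε → q ∈ V}
  univ_sets := ⟨0, 1, le_rfl, hβ, one_pos, fun _ _ _ => trivial⟩
  sets_of_superset := by
    rintro V W ⟨s, ε, hs, hsβ, hε, h⟩ hVW
    exact ⟨s, ε, hs, hsβ, hε, fun q h1 h2 => hVW (h q h1 h2)⟩
  inter_sets := by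
    rintro V W ⟨s, ε, hs, hsβ, hε, h⟩ ⟨s', ε', hs', hsβ', hε', h'⟩
    refine ⟨max s s', min ε ε', le_max_of_le_left hs, max_lt hsβ hsβ', lt_min hε hε',
      fun q h1 h2 => ⟨h q (h1.trans_le (min_le_left _ _)) ?_,
        h' q (h1.trans_le (min_le_right _ _)) ?_⟩⟩
    · exact (decayNorm_sub_mono (le_max_left _ _) _ _).trans_lt
        (h2.trans_le (ENNReal.ofReal_le_ofReal (min_le_left _ _)))
    · exact (decayNorm_sub_mono (le_max_right _ _) _ _).trans_lt
        (h2.trans_le (ENNReal.ofReal_le_ofReal (min_le_right _ _)))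

theorem XSpace.le_nhds {p : XSpace d β} {L : Filter (XSpace d β)}
    (hE : Filter.Tendsto XSpace.E L (𝓝 p.E))
    (hμ : ∀ s, 0 ≤ s → s < β → ∀ ε : ℝ≥0∞, 0 < ε → ∀ᶠ q : XSpace d β in L,
      decayNorm s (fourierCoeff (q.μ : Measure (Torus (Fin d))) - fourierCoeff (p.μ : Measure _)) <
        ε) : L ≤ 𝓝 p := by
  refine le_of_le_of_eq (le_inf ?_ ?_) (nhds_inf (t₁ := TopologicalSpace.induced XSpace.E
    (inferInstance : TopologicalSpace (NonemptyCompacts (Torus (Fin d)))))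
    (t₂ := ⨅ s : Set.Ico (0 : ℝ) β, TopologicalSpace.induced XSpace.μ
      (decayPseudoEMetric d s).toUniformSpace.toTopologicalSpace)).symm
  · rwa [nhds_induced, ← Filter.tendsto_iff_comap]
  · rw [nhds_iInf]
    refine le_iInf fun s => ?_
    refine le_of_le_of_eq (Filter.tendsto_iff_comap.1 ?_) (@nhds_induced _ _
      (decayPseudoEMetric d s).toUniformSpace.toTopologicalSpace XSpace.μ p).symm
    exact (@EMetric.tendsto_nhds _ _ (decayPseudoEMetric d s) _ _ _).2 (hμ s s.2.1 s.2.2)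

/-- The seminorm distances increase with the exponent, so finitely many constraints are implied by a
single one. Only this inclusion of filters is needed for density. -/
theorem XSpace.basicFilter_le_nhds (hβ : 0 < β) (p : XSpace d β) :
    XSpace.basicFilter hβ p ≤ 𝓝 p := by
  refine XSpace.le_nhds (Metric.tendsto_nhds.2 fun ε hε =>
    ⟨0, ε, le_rfl, hβ, hε, fun q h1 _ => h1⟩) fun s hs hsβ ε hε => ?_
  obtain ⟨δ, hδ, hδε⟩ : ∃ δ : ℝ, 0 < δ ∧ ENNReal.ofReal δ ≤ ε := by
    rcases eq_or_ne ε ∞ with rfl | hne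
    · exact ⟨1, one_pos, le_top⟩
    · exact ⟨ε.toReal, ENNReal.toReal_pos hε.ne' hne, ENNReal.ofReal_toReal_le⟩
  exact ⟨s, δ, hs, hsβ, hδ, fun q _ h2 => h2.trans_le hδε⟩

theorem XSpace.exists_of_mem_nhds (hβ : 0 < β) {p : XSpace d β} {V : Set (XSpace d β)}
    (hV : V ∈ 𝓝 p) : ∃ s ε : ℝ, 0 ≤ s ∧ s < β ∧ 0 < ε ∧ ∀ q : XSpace d β, dist q.E p.E < ε →
    decayNorm s (fourierCoeff (q.μ : Measure (Torus (Fin d))) - fourierCoeff (p.μ : Measure _)) <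
      ENNReal.ofReal ε → q ∈ V :=
  XSpace.basicFilter_le_nhds hβ p hV

theorem XSpace.continuous_E : Continuous (XSpace.E : XSpace d β → NonemptyCompacts _) :=
  continuous_iff_le_induced.2 inf_le_left

end Neighbourhoods

/-! ### The generic conditions: openness, density and consequences -/

section Generic

variable {d n : ℕ} {β : ℝ}

/-- `S` contains no `1 / (k + 1)`-separated tuple in `Z`, and has an efficient cover by small
balls. -/
def IsGoodAt (Z : Set (Torus (Fin n × Fin d))) (β : ℝ) (k : ℕ) (S : Set (Torus (Fin d))) : Prop :=
  (∀ z : Fin n → Torus (Fin d), (∀ i j, i ≠ j → 1 / ((k : ℝ) + 1) ≤ dist (z i) (z j)) →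
    (∀ i, z i ∈ S) → tuple z ∉ Z) ∧
  ∃ (F : Finset (Torus (Fin d))) (ρ : ℝ), 0 < ρ ∧ ρ < 1 / ((k : ℝ) + 1) ∧
    S ⊆ ⋃ g ∈ F, Metric.closedBall g ρ ∧
    F.card * ρ ^ (β + 1 / ((k : ℝ) + 1)) ≤ 1 / ((k : ℝ) + 1)

theorem IsGoodAt.mono {Z : Set (Torus (Fin n × Fin d))} {k : ℕ} {S T : Set (Torus (Fin d))}
    (h : IsGoodAt Z β k T) (hST : S ⊆ T) : IsGoodAt Z β k S := by
  obtain ⟨h1, F, ρ, h2, h3, h4, h5⟩ := h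
  exact ⟨fun z hz hzS => h1 z hz fun i => hST (hzS i), F, ρ, h2, h3, hST.trans h4, h5⟩

theorem isOpen_goodAt (Z : Set (Torus (Fin n × Fin d))) (β : ℝ) (k : ℕ) :
    IsOpen {p : XSpace d β | ∃ ε : ℝ, 0 < ε ∧
      IsGoodAt Z β k (Metric.thickening ε (p.E : Set (Torus (Fin d))))} := by
  have : IsOpen {E : NonemptyCompacts (Torus (Fin d)) | ∃ ε : ℝ, 0 < ε ∧
      IsGoodAt Z β k (Metric.thickening ε (E : Set (Torus (Fin d))))} := by
    rw [Metric.isOpen_iff]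
    rintro E ⟨ε, hε, hE⟩
    refine ⟨ε / 2, by linarith, fun E' hE' => ⟨ε / 2, by linarith, hE.mono ?_⟩⟩
    intro x hx
    obtain ⟨y, hy, hxy⟩ := Metric.mem_thickening_iff.1 hx
    rw [Metric.mem_ball, Metric.NonemptyCompacts.dist_eq] at hE'
    obtain ⟨z, hz, hyz⟩ := Metric.exists_dist_lt_of_hausdorffDist_lt hy hE'
      (Metric.hausdorffEDist_ne_top_of_nonempty_of_bounded E'.nonempty E.nonempty
        E'.isCompact.isBounded E.isCompact.isBounded)
    refine Metric.mem_thickening_iff.2 ⟨z, hz, ?_⟩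
    linarith [dist_triangle x y z]
  exact this.preimage XSpace.continuous_E

theorem decayNorm_lt_top_of_bound {μ : Measure (Torus (Fin d))} [IsProbabilityMeasure μ] {s C : ℝ}
    (hs : 0 ≤ s) (hsd : s ≤ d) (h : ∀ ξ, ξ ≠ 0 → ‖fourierCoeff μ ξ‖ ≤ C / freqNorm ξ ^ (d + 1)) :
    decayNorm s (fourierCoeff μ) < ∞ := by
  refine lt_of_le_of_lt (iSup_le fun ξ => ENNReal.ofReal_le_ofReal (q := max 1 C) ?_)
    ENNReal.ofReal_lt_top
  by_cases hξ : ξ = 0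
  · refine le_max_of_le_left ?_
    rw [hξ, freqNorm_zero]
    exact mul_le_one₀ (norm_fourierCoeff_le_one _ _) (Real.rpow_nonneg le_rfl _)
      (Real.rpow_le_one le_rfl zero_le_one (by linarith))
  · refine le_max_of_le_right ?_
    have hf := one_le_freqNorm hξ
    have hf0 : 0 < freqNorm ξ := by linarith
    have h3 : freqNorm ξ ^ (s / 2) ≤ freqNorm ξ ^ (d + 1) := by
      rw [← Real.rpow_natCast]
      refine Real.rpow_le_rpow_of_exponent_le hf ?_
      push_cast; linarith
    calc _ ≤ C / freqNorm ξ ^ (d + 1) * freqNorm ξ ^ (d + 1) :=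
          mul_le_mul (h ξ hξ) h3 (Real.rpow_nonneg hf0.le _) ((norm_nonneg _).trans (h ξ hξ))
      _ = C := by field_simp

theorem norm_sub_le_of_decayNorm_le {μ ν : Measure (Torus (Fin d))} [IsProbabilityMeasure μ]
    [IsProbabilityMeasure ν] {s ε : ℝ} (hs : 0 ≤ s) (hε : 0 ≤ ε)
    (h : decayNorm s (fourierCoeff μ - fourierCoeff ν) ≤ ENNReal.ofReal ε) (ξ : Fin d → ℤ) :
    ‖fourierCoeff μ ξ - fourierCoeff ν ξ‖ ≤ ε := by
  by_cases hξ : ξ = 0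
  · simpa [hξ, fourierCoeff_zero] using hε
  · have h1 := (ENNReal.ofReal_le_ofReal_iff hε).1 ((ofReal_le_decayNorm _ _ ξ).trans h)
    refine le_trans ?_ h1
    rw [Pi.sub_apply]
    exact le_mul_of_one_le_right (norm_nonneg _)
      (Real.one_le_rpow (one_le_freqNorm hξ) (by linarith))

/-- The approximating set is the union of the closed r-balls about the pruned sample. It lies near
E₀ since μ₁ does; conversely E₀ lies near it because the new measure has almost the coefficients of
μ₁, so `exists_tolerance_support` applies. -/
theorem dense_goodAt {α : ℝ} (hn : 0 < n) (hβ0 : 0 < β) (hβd : β ≤ d)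
    (hβ : β * ((n : ℝ) - 1 / 2) ≤ d * n - α) {Z : Set (Torus (Fin n × Fin d))}
    (hZ : lowerMinkowskiDim Z ≤ (α : EReal)) (k : ℕ) :
    Dense {p : XSpace d β | ∃ ε : ℝ, 0 < ε ∧
      IsGoodAt Z β k (Metric.thickening ε (p.E : Set (Torus (Fin d))))} := by
  intro p
  rw [mem_closure_iff_nhds]
  intro V hV
  obtain ⟨s, ε, hs, hsβ, hε, hVs⟩ := XSpace.exists_of_mem_nhds hβ0 hV
  obtain ⟨μ₁, hμ₁p, ⟨K, hK, hμK⟩, ⟨C₁, hC₁, hμ₁⟩, hclose, hS, hpos⟩ :=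
    exists_smooth_approx p.E.isCompact p.support_subset hs
      -- The decay of the original measure is used at the larger exponent (s + β)/2; the gap makes
      -- mollification converge in the seminorm of exponent s.
      (by linarith : s < (s + β) / 2) (by linarith)
      (p.decay ((s + β) / 2) (by linarith) (by linarith)) (ε := ε / 4) (by linarith)
  obtain ⟨δ, hδ, htol⟩ := exists_tolerance_support μ₁ p.E.isCompact (ε := ε / 4) (by linarith) hpos
  have hk : (0 : ℝ) < 1 / ((k : ℝ) + 1) := by positivity
  obtain ⟨F, μ, r, hμ, hr0, hrε, hrγ, hcard, hFS, hFμ, ⟨C, hC⟩, hμμ₁, havoid⟩ :=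
    exists_discretization hS hC₁ hμ₁ hK hμK hn hs hsβ hβd hβ hZ (ε := min (ε / 4) δ)
      (lt_min (by linarith) hδ) hk hk
  have hEc : IsCompact (⋃ g ∈ F, Metric.closedBall g r) :=
    F.finite_toSet.isCompact_biUnion fun g _ => isCompact_closedBall _ _
  have hsub : μ.support ⊆ ⋃ g ∈ F, Metric.closedBall g r := by
    refine Measure.support_subset_of_isClosed hEc.isClosed ?_
    filter_upwards [hFμ] with y ⟨g, hg, hyg⟩
    exact Set.mem_iUnion₂.2 ⟨g, hg, hyg⟩
  have hEne : (⋃ g ∈ F, Metric.closedBall g r).Nonempty :=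
    (Measure.nonempty_support (IsProbabilityMeasure.ne_zero μ)).mono hsub
  obtain ⟨q, hqE, hqμ⟩ : ∃ q : XSpace d β,
      (q.E : Set (Torus (Fin d))) = ⋃ g ∈ F, Metric.closedBall g r ∧
      (q.μ : Measure (Torus (Fin d))) = μ :=
    ⟨{ E := ⟨⟨⋃ g ∈ F, Metric.closedBall g r, hEc⟩, hEne⟩
       μ := ⟨μ, hμ⟩
       support_subset := hsub
       decay := fun t ht htβ =>
        decayNorm_lt_top_of_bound (μ := μ) ht (by linarith) hC }, rfl, rfl⟩
  refine ⟨q, hVs q ?_ ?_, r, hr0, ?_⟩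
  · rw [Metric.NonemptyCompacts.dist_eq, hqE]
    refine (Metric.hausdorffDist_le_of_mem_dist (r := 3 * (ε / 4)) (by linarith) ?_ ?_).trans_lt
      (by linarith)
    · intro x hx
      obtain ⟨g, hg, hxg⟩ := Set.mem_iUnion₂.1 hx
      obtain ⟨y, hy, hgy⟩ := Metric.mem_thickening_iff.1 (hFS g hg)
      refine ⟨y, hy, ?_⟩
      have h1 := Metric.mem_closedBall.1 hxg
      have h2 := hrε.trans (min_le_left _ _)
      linarith [dist_triangle x g y]
    · intro y hy
      obtain ⟨z, hz, hyz⟩ := htol μ (fun ξ => (norm_sub_le_of_decayNorm_le hs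
        (lt_min (by linarith) hδ).le hμμ₁ ξ).trans (min_le_right _ _)) y hy
      exact ⟨z, hsub hz, hyz.le⟩
  · rw [hqμ]
    have h1 := decayNorm_add_le s (fourierCoeff μ - fourierCoeff μ₁)
      (fourierCoeff μ₁ - fourierCoeff (p.μ : Measure (Torus (Fin d))))
    rw [sub_add_sub_cancel] at h1
    refine h1.trans_lt (lt_of_le_of_lt (add_le_add (hμμ₁.trans
      (ENNReal.ofReal_le_ofReal (min_le_left _ _))) hclose) ?_)
    rw [← ENNReal.ofReal_add (by linarith) (by linarith)]
    exact (ENNReal.ofReal_lt_ofReal_iff hε).2 (by linarith)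
  rw [hqE]
  refine ⟨?_, F, 2 * r, by linarith, hrγ, ?_, hcard⟩
  · intro z hz hzS
    refine havoid z hz fun i => ?_
    obtain ⟨y, hy, hzy⟩ := Metric.mem_thickening_iff.1 (hzS i)
    obtain ⟨g, hg, hyg⟩ := Set.mem_iUnion₂.1 hy
    refine ⟨g, hg, ?_⟩
    have := Metric.mem_closedBall.1 hyg
    linarith [dist_triangle (z i) y g]
  · intro x hx
    obtain ⟨y, hy, hxy⟩ := Metric.mem_thickening_iff.1 hx
    obtain ⟨g, hg, hyg⟩ := Set.mem_iUnion₂.1 hy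
    refine Set.mem_iUnion₂.2 ⟨g, hg, Metric.mem_closedBall.2 ?_⟩
    have := Metric.mem_closedBall.1 hyg
    linarith [dist_triangle x y g]

theorem avoids_of_forall_isGoodAt {Z : Set (Torus (Fin n × Fin d))} {E : Set (Torus (Fin d))}
    (h : ∀ k, IsGoodAt Z β k E) : Avoids E Z := by
  intro x hx hxE
  have h1 : ∀ᶠ k : ℕ in Filter.atTop, ∀ i j, i ≠ j → 1 / ((k : ℝ) + 1) ≤ dist (x i) (x j) := by
    rw [Filter.eventually_all]
    intro i
    rw [Filter.eventually_all]
    intro j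
    by_cases hij : i = j
    · exact Filter.Eventually.of_forall fun _ hne => absurd hij hne
    · have := (tendsto_one_div_add_atTop_nhds_zero_nat (𝕜 := ℝ)).eventually_le_const
        (dist_pos.2 (hx.ne hij))
      exact this.mono fun k hk _ => hk
  obtain ⟨k, hk⟩ := h1.exists
  exact (h k).1 x hk hxE

/-- For t' > β the covers at large k satisfy β + 1/(k+1) < t', so their t'-sums stay bounded while
the diameters tend to 0. The Hausdorff measure of exponent t' is therefore finite. -/
theorem dimH_le_of_forall_isGoodAt {Z : Set (Torus (Fin n × Fin d))} {E : Set (Torus (Fin d))}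
    (hβ : 0 < β) (h : ∀ k, IsGoodAt Z β k E) : dimH E ≤ ENNReal.ofReal β := by
  refine le_of_forall_gt fun t ht => ?_
  obtain ⟨t', ht', htt⟩ := ENNReal.lt_iff_exists_nnreal_btwn.1 ht
  refine lt_of_le_of_lt (dimH_le_of_hausdorffMeasure_ne_top ?_) htt
  have hβt : β < t' := by
    rw [ENNReal.ofReal_lt_iff_lt_toReal hβ.le ENNReal.coe_ne_top] at ht'
    simpa using ht'
  choose F ρ hρ0 hρ1 hcov hsum using fun k => (h k).2
  have hlim : Filter.Tendsto (fun k : ℕ => ENNReal.ofReal (2 * (1 / ((k : ℝ) + 1))))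
      Filter.atTop (𝓝 0) := by
    have := (tendsto_one_div_add_atTop_nhds_zero_nat (𝕜 := ℝ)).const_mul 2
    rw [mul_zero] at this
    simpa using ENNReal.tendsto_ofReal this
  have hdiam : ∀ k (g : Torus (Fin d)), Metric.ediam (Metric.closedBall g (ρ k)) ≤
      ENNReal.ofReal (2 * ρ k) := by
    intro k g
    rw [← Metric.closedEBall_ofReal (hρ0 k).le, ENNReal.ofReal_mul (by norm_num)]
    simpa using Metric.ediam_closedEBall_le (x := g) (r := ENNReal.ofReal (ρ k))
  have hH := Measure.hausdorffMeasure_le_liminf_sum (t' : ℝ) E (l := Filter.atTop)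
    (ι := fun k => F k) _ hlim (fun k (g : F k) => Metric.closedBall (g : Torus (Fin d)) (ρ k))
    (Filter.Eventually.of_forall fun k g => (hdiam k g).trans
      (ENNReal.ofReal_le_ofReal (by linarith [hρ1 k])))
    (Filter.Eventually.of_forall fun k => (hcov k).trans (by
      intro x hx
      obtain ⟨g, hg, hxg⟩ := Set.mem_iUnion₂.1 hx
      exact Set.mem_iUnion.2 ⟨⟨g, hg⟩, hxg⟩))
  refine (hH.trans_lt ?_).ne
  refine lt_of_le_of_lt (b := ENNReal.ofReal (2 ^ (t' : ℝ))) ?_ ENNReal.ofReal_lt_top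
  refine Filter.liminf_le_of_frequently_le' (Filter.Eventually.frequently ?_)
  have hk : ∀ᶠ k : ℕ in Filter.atTop, 1 / ((k : ℝ) + 1) < t' - β :=
    tendsto_one_div_add_atTop_nhds_zero_nat.eventually_lt_const (by linarith)
  filter_upwards [hk] with k hk
  have hk1 : 1 / ((k : ℝ) + 1) ≤ 1 := by
    rw [div_le_one (by positivity)]
    linarith [(Nat.cast_nonneg k : (0 : ℝ) ≤ k)]
  calc ∑ g : F k, Metric.ediam (Metric.closedBall (g : Torus (Fin d)) (ρ k)) ^ (t' : ℝ)
      ≤ ∑ _g : F k, ENNReal.ofReal (2 ^ (t' : ℝ) * ρ k ^ (t' : ℝ)) := by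
        refine Finset.sum_le_sum fun g _ => ?_
        rw [← Real.mul_rpow (by norm_num) (hρ0 k).le,
          ← ENNReal.ofReal_rpow_of_nonneg (by linarith [hρ0 k]) t'.coe_nonneg]
        exact ENNReal.rpow_le_rpow (hdiam k g) t'.coe_nonneg
    _ = ENNReal.ofReal (2 ^ (t' : ℝ) * ((F k).card * ρ k ^ (t' : ℝ))) := by
        rw [Finset.sum_const, nsmul_eq_mul, Finset.card_univ, Fintype.card_coe,
          ← ENNReal.ofReal_natCast, ← ENNReal.ofReal_mul (by positivity)]
        congr 1; ring
    _ ≤ ENNReal.ofReal (2 ^ (t' : ℝ) * 1) := by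
        refine ENNReal.ofReal_le_ofReal ?_
        gcongr
        refine le_trans ?_ ((hsum k).trans hk1)
        gcongr ?_ * ?_
        exact Real.rpow_le_rpow_of_exponent_ge (hρ0 k) ((hρ1 k).le.trans hk1) (by linarith)
    _ = ENNReal.ofReal (2 ^ (t' : ℝ)) := by rw [mul_one]

theorem residual_dimH_le_and_avoids {α : ℝ} (hn : 0 < n) (hβ0 : 0 < β) (hβd : β ≤ d)
    (hβ : β * ((n : ℝ) - 1 / 2) ≤ d * n - α) {Z : Set (Torus (Fin n × Fin d))}
    (hZ : lowerMinkowskiDim Z ≤ (α : EReal)) :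
    {p : XSpace d β | dimH (p.E : Set (Torus (Fin d))) ≤ ENNReal.ofReal β ∧
      Avoids (p.E : Set (Torus (Fin d))) Z} ∈ residual (XSpace d β) := by
  have h1 : ∀ k : ℕ, ∀ᶠ p : XSpace d β in residual (XSpace d β), ∃ ε : ℝ, 0 < ε ∧
      IsGoodAt Z β k (Metric.thickening ε (p.E : Set (Torus (Fin d)))) :=
    fun k => residual_of_dense_open (isOpen_goodAt Z β k) (dense_goodAt hn hβ0 hβd hβ hZ k)
  filter_upwards [eventually_countable_forall.2 h1] with p hp
  have h2 : ∀ k, IsGoodAt Z β k (p.E : Set (Torus (Fin d))) := by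
    intro k
    obtain ⟨ε, hε, h⟩ := hp k
    exact h.mono (Metric.self_subset_thickening hε _)
  exact ⟨dimH_le_of_forall_isGoodAt hβ0 h2, avoids_of_forall_isGoodAt h2⟩

end Generic

/-! ### Fourier dimension is at most Hausdorff dimension -/

section Frostman

variable {d : ℕ}

/-- The mass distribution principle. -/
theorem le_dimH_of_measure_closedBall_le {X : Type*} [MetricSpace X] [MeasurableSpace X]
    [BorelSpace X] {μ : Measure X} {A E : Set X} (hA : MeasurableSet A) (hAE : μ (A ∩ E) ≠ 0)
    {t : NNReal} (ht : 0 < t) {c M : ℝ} (hc : 0 < c) (hM : 0 < M)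
    (h : ∀ x ∈ A, ∀ m : ℕ,
      μ (Metric.closedBall x (c * (1 / 2) ^ m)) ≤ ENNReal.ofReal (M * ((1 / 2) ^ m) ^ (t : ℝ))) :
    (t : ℝ≥0∞) ≤ dimH E := by
  have ht' : (0 : ℝ) < t := ht
  set C : ℝ := M * (2 / c) ^ (t : ℝ) with hC
  have hC0 : 0 < C := by positivity
  have key : ∀ s : Set X, Metric.ediam s ≤ ENNReal.ofReal c →
      (μ.restrict A) s ≤ ENNReal.ofReal C * Metric.ediam s ^ (t : ℝ) := by
    intro s hs
    rw [Measure.restrict_apply' hA]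
    rcases (s ∩ A).eq_empty_or_nonempty with h0 | ⟨x, hxs, hxA⟩
    · simp [h0]
    have hfin : Metric.ediam s ≠ ∞ := (hs.trans_lt ENNReal.ofReal_lt_top).ne
    set δ := (Metric.ediam s).toReal with hδ
    have hδs : Metric.ediam s = ENNReal.ofReal δ := (ENNReal.ofReal_toReal hfin).symm
    have hδ0 : 0 ≤ δ := ENNReal.toReal_nonneg
    have hδc : δ ≤ c := by
      rw [hδs] at hs; exact (ENNReal.ofReal_le_ofReal_iff hc.le).1 hs
    have hball : ∀ m : ℕ, δ ≤ c * (1 / 2) ^ m →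
        μ (s ∩ A) ≤ ENNReal.ofReal (M * ((1 / 2) ^ m) ^ (t : ℝ)) := by
      intro m hm
      refine (measure_mono ?_).trans (h x hxA m)
      intro y hy
      rw [Metric.mem_closedBall, dist_edist]
      refine le_trans ?_ hm
      exact ENNReal.toReal_mono hfin (Metric.edist_le_ediam_of_mem hy.1 hxs)
    -- A set of diameter 0 lies in balls of all dyadic radii, hence is null on A; otherwise the
    -- dyadic radius just above the diameter loses at most a factor 2.
    rcases hδ0.eq_or_lt with h0 | hpos
    · have hz : μ (s ∩ A) ≤ 0 := by
        have hlim : Filter.Tendsto (fun m : ℕ => ENNReal.ofReal (M * ((1 / 2 : ℝ) ^ m) ^ (t : ℝ)))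
            Filter.atTop (𝓝 0) := by
          have h1 := tendsto_pow_atTop_nhds_zero_of_lt_one (r := (1 / 2 : ℝ)) (by norm_num)
            (by norm_num)
          have h2 := (h1.rpow_const (p := (t : ℝ)) (Or.inr ht'.le)).const_mul M
          rw [Real.zero_rpow ht'.ne', mul_zero] at h2
          simpa using ENNReal.tendsto_ofReal h2
        exact ge_of_tendsto' hlim fun m => hball m (by rw [← h0]; positivity)
      exact hz.trans zero_le
    · obtain ⟨m, hm1, hm2⟩ := exists_nat_pow_near_of_lt_one (x := δ / c) (y := (1 / 2 : ℝ))
        (by positivity) ((div_le_one hc).2 hδc) (by norm_num) (by norm_num)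
      have h1 := hball m (by rw [div_le_iff₀ hc] at hm2; linarith)
      refine h1.trans ?_
      rw [hδs, ENNReal.ofReal_rpow_of_nonneg hδ0 ht'.le, ← ENNReal.ofReal_mul hC0.le]
      refine ENNReal.ofReal_le_ofReal ?_
      rw [hC, mul_assoc, ← Real.mul_rpow (by positivity) hδ0]
      refine mul_le_mul_of_nonneg_left ?_ hM.le
      refine Real.rpow_le_rpow (by positivity) ?_ ht'.le
      rw [pow_succ] at hm1
      have : 2 / c * δ = 2 * (δ / c) := by ring
      rw [this]
      linarith
  have hle : (ENNReal.ofReal C)⁻¹ • μ.restrict A ≤ μH[(t : ℝ)] := by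
    refine Measure.le_hausdorffMeasure _ _ (ENNReal.ofReal c) (by simpa using hc) fun s hs => ?_
    rw [Measure.smul_apply, smul_eq_mul, mul_comm, ← div_eq_mul_inv]
    refine ENNReal.div_le_of_le_mul ?_
    rw [mul_comm]
    exact key s hs
  refine le_dimH_of_hausdorffMeasure_ne_zero fun h0 => hAE ?_
  have h1 := (hle E).trans h0.le
  rw [Measure.smul_apply, smul_eq_mul, Measure.restrict_apply' hA, nonpos_iff_eq_zero,
    mul_eq_zero] at h1
  rw [Set.inter_comm]
  exact h1.resolve_left (by simp)

/-- The frequencies `ξ` with entries in `[0, N)`. -/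
def posCube (d N : ℕ) : Finset (Fin d → ℤ) := Fintype.piFinset fun _ => Finset.Ico (0 : ℤ) N

theorem card_posCube (d N : ℕ) : (posCube d N).card = N ^ d := by
  simp [posCube, Fintype.card_piFinset]

/-- The Dirichlet kernel of `posCube`. -/
def dirichlet (d N : ℕ) (x : Torus (Fin d)) : ℂ := ∑ ξ ∈ posCube d N, char ξ x

theorem continuous_dirichlet (d N : ℕ) : Continuous (dirichlet d N) :=
  continuous_finsetSum _ fun ξ _ => continuous_char ξ

/-- Near 0, at distance of order 1/N, all N ^ d characters are within 1/2 of 1. -/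
theorem le_norm_dirichlet {N : ℕ} {x : Torus (Fin d)}
    (hx : 2 * Real.pi * (√d * N) * ‖x‖ ≤ 1 / 2) : (N : ℝ) ^ d / 2 ≤ ‖dirichlet d N x‖ := by
  have h1 : ‖dirichlet d N x - (N : ℂ) ^ d‖ ≤ (N : ℝ) ^ d * (1 / 2) := by
    have e1 : dirichlet d N x - (N : ℂ) ^ d = ∑ ξ ∈ posCube d N, (char ξ x - 1) := by
      rw [Finset.sum_sub_distrib, Finset.sum_const, card_posCube, dirichlet]; simp
    rw [e1]
    refine (norm_sum_le _ _).trans ?_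
    refine (Finset.sum_le_card_nsmul _ _ (1 / 2) fun ξ hξ => ?_).trans (le_of_eq ?_)
    · refine (norm_char_sub_one_le ξ x).trans (le_trans ?_ hx)
      gcongr
      refine freqNorm_le_of_forall_abs_le (Nat.cast_nonneg _) fun i => ?_
      have := Finset.mem_Ico.1 (Fintype.mem_piFinset.1 hξ i)
      rw [abs_of_nonneg (by exact_mod_cast this.1)]
      exact_mod_cast this.2.le
    · rw [card_posCube, nsmul_eq_mul]; push_cast; ring
  have h2 := norm_sub_norm_le ((N : ℂ) ^ d) ((N : ℂ) ^ d - dirichlet d N x)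
  rw [sub_sub_cancel, norm_sub_rev, norm_pow, Complex.norm_natCast] at h2
  linarith

theorem integral_norm_dirichlet_sq_le (μ : Measure (Torus (Fin d))) [IsProbabilityMeasure μ]
    (N : ℕ) :
    ∫ x, ∫ y, ‖dirichlet d N (x - y)‖ ^ 2 ∂μ ∂μ ≤
      ∑ k ∈ posCube d N, ∑ l ∈ posCube d N,
        ‖fourierCoeff μ (k - l)‖ * ‖fourierCoeff μ (l - k)‖ := by
  have hpt : ∀ x y : Torus (Fin d), ((‖dirichlet d N (x - y)‖ ^ 2 : ℝ) : ℂ) =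
      ∑ k ∈ posCube d N, ∑ l ∈ posCube d N, char (k - l) x * char (l - k) y := by
    intro x y
    have e1 : ((‖dirichlet d N (x - y)‖ ^ 2 : ℝ) : ℂ) =
        dirichlet d N (x - y) * starRingEnd ℂ (dirichlet d N (x - y)) := by
      rw [Complex.mul_conj, Complex.normSq_eq_norm_sq]
    rw [e1, dirichlet, map_sum, Finset.sum_mul_sum]
    refine Finset.sum_congr rfl fun k _ => Finset.sum_congr rfl fun l _ => ?_
    rw [← char_neg_left, ← char_sub_left, sub_eq_add_neg x y, char_add, char_neg_right, neg_sub]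
  have hint : ((∫ x, ∫ y, ‖dirichlet d N (x - y)‖ ^ 2 ∂μ ∂μ : ℝ) : ℂ) =
      ∑ k ∈ posCube d N, ∑ l ∈ posCube d N,
        fourierCoeff μ (l - k) * fourierCoeff μ (k - l) := by
    rw [← integral_complex_ofReal]
    simp_rw [← integral_complex_ofReal, hpt]
    have e2 : ∀ x, ∫ y, ∑ k ∈ posCube d N, ∑ l ∈ posCube d N, char (k - l) x * char (l - k) y ∂μ =
        ∑ k ∈ posCube d N, ∑ l ∈ posCube d N, char (k - l) x * fourierCoeff μ (k - l) := by
      intro x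
      rw [integral_finsetSum _ fun k _ => integrable_finsetSum _ fun l _ =>
        (integrable_char _ _).const_mul _]
      refine Finset.sum_congr rfl fun k _ => ?_
      rw [integral_finsetSum _ fun l _ => (integrable_char _ _).const_mul _]
      refine Finset.sum_congr rfl fun l _ => ?_
      rw [integral_const_mul, fourierCoeff_eq, neg_sub]
    simp_rw [e2]
    rw [integral_finsetSum _ fun k _ => integrable_finsetSum _ fun l _ =>
      (integrable_char _ _).mul_const _]
    refine Finset.sum_congr rfl fun k _ => ?_
    rw [integral_finsetSum _ fun l _ => (integrable_char _ _).mul_const _]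
    refine Finset.sum_congr rfl fun l _ => ?_
    rw [integral_mul_const, fourierCoeff_eq μ (l - k), neg_sub]
  refine (le_abs_self _).trans ?_
  rw [← Real.norm_eq_abs, ← Complex.norm_real, hint]
  refine (norm_sum_le _ _).trans (Finset.sum_le_sum fun k _ => (norm_sum_le _ _).trans
    (Finset.sum_le_sum fun l _ => ?_))
  rw [norm_mul, mul_comm]

theorem exists_sum_freqNorm_rpow_le (hd : 0 < d) {e : ℝ} (he : 0 < e) :
    ∃ A : ℝ, 0 ≤ A ∧ ∀ R : ℕ,
      ∑ ξ ∈ (freqCube d R).erase 0, freqNorm ξ ^ (-((d : ℝ) + e)) ≤ A := by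
  have hd' : (0 : ℝ) < d := by exact_mod_cast hd
  set p : ℝ := 1 + e / d with hp
  have hp1 : 1 < p := by have : 0 < e / d := by positivity
                         linarith
  -- Here `0 ^ (-p) = 0`, so the extra 1 at j = 0 makes g dominate the factor of a vanishing
  -- coordinate. The d-dimensional sum is thereby bounded by a power of a convergent one-dimensional
  -- one.
  set g : ℤ → ℝ := fun j => |(j : ℝ)| ^ (-p) + if j = 0 then 1 else 0 with hg
  have hg0 : ∀ j, 0 ≤ g j := fun j => add_nonneg (by positivity) (by split_ifs <;> norm_num)
  have hgs : Summable g :=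
    (Real.summable_abs_int_rpow hp1).add (summable_of_ne_finset_zero (s := {0}) (by
      intro j hj
      rw [if_neg (by simpa using hj)]))
  refine ⟨(∑' j, g j) ^ d, pow_nonneg (tsum_nonneg hg0) _, fun R => ?_⟩
  calc ∑ ξ ∈ (freqCube d R).erase 0, freqNorm ξ ^ (-((d : ℝ) + e))
      ≤ ∑ ξ ∈ (freqCube d R).erase 0, ∏ i, g (ξ i) := by
        refine Finset.sum_le_sum fun ξ hξ => ?_
        have hf := one_le_freqNorm (Finset.ne_of_mem_erase hξ)
        have hf0 : 0 < freqNorm ξ := by linarith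
        have e1 : freqNorm ξ ^ (-((d : ℝ) + e)) = ∏ _i : Fin d, freqNorm ξ ^ (-p) := by
          rw [Finset.prod_const, Finset.card_univ, Fintype.card_fin, ← Real.rpow_natCast,
            ← Real.rpow_mul hf0.le]
          congr 1
          rw [hp]; field_simp
        rw [e1]
        refine Finset.prod_le_prod (fun i _ => by positivity) fun i _ => ?_
        by_cases hi : ξ i = 0
        · have : g (ξ i) = |((ξ i : ℤ) : ℝ)| ^ (-p) + 1 := by simp [hg, hi]
          rw [this]
          have h1 : freqNorm ξ ^ (-p) ≤ 1 :=
            Real.rpow_le_one_of_one_le_of_nonpos hf (by linarith)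
          have h2 : 0 ≤ |((ξ i : ℤ) : ℝ)| ^ (-p) := by positivity
          linarith
        · have : g (ξ i) = |((ξ i : ℤ) : ℝ)| ^ (-p) := by simp [hg, hi]
          rw [this]
          exact Real.rpow_le_rpow_of_nonpos (abs_pos.2 (by exact_mod_cast hi))
            (abs_le_freqNorm ξ i) (by linarith)
    _ ≤ ∑ ξ ∈ freqCube d R, ∏ i, g (ξ i) :=
        Finset.sum_le_sum_of_subset_of_nonneg (Finset.erase_subset _ _)
          fun ξ _ _ => Finset.prod_nonneg fun i _ => hg0 _
    _ = ∏ _i : Fin d, ∑ j ∈ Finset.Icc (-(R : ℤ)) R, g j := by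
        rw [freqCube, Finset.prod_univ_sum]
    _ ≤ (∑' j, g j) ^ d := by
        rw [Finset.prod_const, Finset.card_univ, Fintype.card_fin]
        exact pow_le_pow_left₀ (Finset.sum_nonneg fun j _ => hg0 j)
          (hgs.sum_le_tsum _ fun j _ => hg0 j) d

/-- The double integral is a sum over pairs k, l depending on k - l only, hence at most N ^ d times
the sum of |μ̂|² over a cube. The decay bounds the latter by N^(d+e-s), the small e paying for
summability. -/
theorem exists_integral_dirichlet_le (hd : 0 < d) {μ : Measure (Torus (Fin d))}
    [IsProbabilityMeasure μ] {s e : ℝ} (he : 0 < e) (hsd : s ≤ d)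
    (h : decayNorm s (fourierCoeff μ) < ∞) :
    ∃ C : ℝ, 0 < C ∧ ∀ N : ℕ, 0 < N →
      ∫ x, ∫ y, ‖dirichlet d N (x - y)‖ ^ 2 ∂μ ∂μ ≤ C * (N : ℝ) ^ (2 * (d : ℝ) + e - s) := by
  obtain ⟨B, hB0, hB⟩ := exists_bound_of_decayNorm_lt_top h
  obtain ⟨A, hA0, hA⟩ := exists_sum_freqNorm_rpow_le hd he
  have hd' : (0 : ℝ) < d := by exact_mod_cast hd
  refine ⟨1 + B ^ 2 * A * √d ^ ((d : ℝ) + e - s), by positivity, fun N hN => ?_⟩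
  have hN1 : (1 : ℝ) ≤ N := by exact_mod_cast hN
  have hN0 : (0 : ℝ) < N := by linarith
  set b : (Fin d → ℤ) → ℝ := fun ξ => ‖fourierCoeff μ ξ‖ * ‖fourierCoeff μ (-ξ)‖ with hb
  have hb0 : ∀ ξ, 0 ≤ b ξ := fun ξ => by positivity
  have hcube : ∑ ξ ∈ freqCube d N, b ξ ≤
      (1 + B ^ 2 * A * √d ^ ((d : ℝ) + e - s)) * (N : ℝ) ^ ((d : ℝ) + e - s) := by
    have hmem0 : (0 : Fin d → ℤ) ∈ freqCube d N := mem_freqCube (by simp)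
    rw [← Finset.add_sum_erase _ _ hmem0, add_mul]
    refine add_le_add ?_ ?_
    · have : b 0 = 1 := by simp [hb, fourierCoeff_zero]
      rw [this, one_mul]
      exact Real.one_le_rpow hN1 (by linarith)
    · have hterm : ∀ ξ ∈ (freqCube d N).erase 0, b ξ ≤
          B ^ 2 * (√d * N) ^ ((d : ℝ) + e - s) * freqNorm ξ ^ (-((d : ℝ) + e)) := by
        intro ξ hξ
        have hξ0 := Finset.ne_of_mem_erase hξ
        have hf := one_le_freqNorm hξ0
        have hf0 : 0 < freqNorm ξ := by linarith
        have hneg : freqNorm (-ξ) = freqNorm ξ := by simp [freqNorm]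
        have h1 := hB ξ
        have h2 := hB (-ξ)
        rw [hneg] at h2
        have hfN : freqNorm ξ ≤ √d * N := by
          refine freqNorm_le_of_forall_abs_le hN0.le fun i => ?_
          have := Finset.mem_Icc.1 (Fintype.mem_piFinset.1 (Finset.mem_of_mem_erase hξ) i)
          rw [abs_le]
          constructor
          · exact_mod_cast this.1
          · exact_mod_cast this.2
        have h3 : b ξ * freqNorm ξ ^ s ≤ B ^ 2 := by
          have e1 : freqNorm ξ ^ s = freqNorm ξ ^ (s / 2) * freqNorm ξ ^ (s / 2) := by
            rw [← Real.rpow_add hf0]; congr 1; ring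
          calc b ξ * freqNorm ξ ^ s = (‖fourierCoeff μ ξ‖ * freqNorm ξ ^ (s / 2)) *
                (‖fourierCoeff μ (-ξ)‖ * freqNorm ξ ^ (s / 2)) := by rw [e1, hb]; ring
            _ ≤ B * B := mul_le_mul h1 h2 (by positivity) hB0
            _ = B ^ 2 := by ring
        have h4 : freqNorm ξ ^ ((d : ℝ) + e - s) ≤ (√d * N) ^ ((d : ℝ) + e - s) :=
          Real.rpow_le_rpow hf0.le hfN (by linarith)
        have e2 : freqNorm ξ ^ s * freqNorm ξ ^ ((d : ℝ) + e - s) * freqNorm ξ ^ (-((d : ℝ) + e))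
            = 1 := by
          rw [← Real.rpow_add hf0, ← Real.rpow_add hf0]
          have : s + ((d : ℝ) + e - s) + -((d : ℝ) + e) = 0 := by ring
          rw [this, Real.rpow_zero]
        calc b ξ = b ξ * (freqNorm ξ ^ s * freqNorm ξ ^ ((d : ℝ) + e - s) *
              freqNorm ξ ^ (-((d : ℝ) + e))) := by rw [e2, mul_one]
          _ = (b ξ * freqNorm ξ ^ s) * freqNorm ξ ^ ((d : ℝ) + e - s) *
              freqNorm ξ ^ (-((d : ℝ) + e)) := by ring
          _ ≤ _ := by gcongr
      refine (Finset.sum_le_sum hterm).trans ?_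
      rw [← Finset.mul_sum, Real.mul_rpow (Real.sqrt_nonneg _) hN0.le]
      calc _ ≤ B ^ 2 * (√d ^ ((d : ℝ) + e - s) * (N : ℝ) ^ ((d : ℝ) + e - s)) * A := by
            gcongr; exact hA N
        _ = _ := by ring
  refine (integral_norm_dirichlet_sq_le μ N).trans ?_
  have hrow : ∀ k ∈ posCube d N, ∑ l ∈ posCube d N,
      ‖fourierCoeff μ (k - l)‖ * ‖fourierCoeff μ (l - k)‖ ≤ ∑ ξ ∈ freqCube d N, b ξ := by
    intro k hk
    have e1 : ∀ l, ‖fourierCoeff μ (k - l)‖ * ‖fourierCoeff μ (l - k)‖ = b (k - l) := by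
      intro l; rw [hb]; simp
    simp_rw [e1]
    rw [← Finset.sum_image (s := posCube d N) (g := fun l => k - l) (f := b)
      (fun l _ l' _ hll => sub_right_injective hll)]
    refine Finset.sum_le_sum_of_subset_of_nonneg ?_ fun ξ _ _ => hb0 ξ
    intro ξ hξ
    obtain ⟨l, hl, rfl⟩ := Finset.mem_image.1 hξ
    refine Fintype.mem_piFinset.2 fun i => ?_
    have h1 := Finset.mem_Ico.1 (Fintype.mem_piFinset.1 hk i)
    have h2 := Finset.mem_Ico.1 (Fintype.mem_piFinset.1 hl i)
    rw [Finset.mem_Icc, Pi.sub_apply]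
    constructor <;> linarith
  refine (Finset.sum_le_card_nsmul _ _ _ fun k hk => (hrow k hk).trans hcube).trans (le_of_eq ?_)
  rw [card_posCube, nsmul_eq_mul]
  have : (N : ℝ) ^ (2 * (d : ℝ) + e - s) = (N : ℝ) ^ d * (N : ℝ) ^ ((d : ℝ) + e - s) := by
    rw [← Real.rpow_natCast, ← Real.rpow_add hN0]; congr 1; ring
  rw [this]; push_cast; ring

/-- A dyadic version of the finite energy argument: Ψ plays the role of the Riesz potential of
exponent t, with squared Dirichlet kernels in place of the singular kernel, and is integrable since
t < s. -/
theorem ofReal_le_dimH_of_decay {μ : Measure (Torus (Fin d))} [IsProbabilityMeasure μ]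
    {E : Set (Torus (Fin d))} (hsupp : μ.support ⊆ E) {s t : ℝ} (ht : 0 < t) (hts : t < s)
    (hsd : s ≤ d) (h : decayNorm s (fourierCoeff μ) < ∞) : ENNReal.ofReal t ≤ dimH E := by
  have hd' : (0 : ℝ) < d := by linarith
  have hd : 0 < d := by exact_mod_cast hd'
  set e : ℝ := (s - t) / 2 with he
  have he0 : 0 < e := by rw [he]; linarith
  obtain ⟨C, hC0, hC⟩ := exists_integral_dirichlet_le hd he0 hsd h
  have hcont : ∀ N, Continuous fun z : Torus (Fin d) × Torus (Fin d) =>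
      ‖dirichlet d N (z.1 - z.2)‖ ^ 2 := fun N =>
    ((continuous_dirichlet d N).comp (continuous_fst.sub continuous_snd)).norm.pow 2
  set Φ : ℕ → Torus (Fin d) → ℝ≥0∞ := fun m x =>
    ∫⁻ y, ENNReal.ofReal (‖dirichlet d (2 ^ m) (x - y)‖ ^ 2) ∂μ with hΦ
  have hΦm : ∀ m, Measurable (Φ m) := fun m =>
    Measurable.lintegral_prod_right' (f := fun z : Torus (Fin d) × Torus (Fin d) =>
      ENNReal.ofReal (‖dirichlet d (2 ^ m) (z.1 - z.2)‖ ^ 2)) (hcont (2 ^ m)).measurable.ennreal_ofReal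
  have hΦi : ∀ m, ∫⁻ x, Φ m x ∂μ ≤ ENNReal.ofReal (C * ((2 : ℝ) ^ m) ^ (2 * (d : ℝ) + e - s)) := by
    intro m
    have hint : ∀ x, Integrable (fun y => ‖dirichlet d (2 ^ m) (x - y)‖ ^ 2) μ := fun x =>
      ((hcont (2 ^ m)).comp (Continuous.prodMk_right x)).integrable_of_hasCompactSupport
        (HasCompactSupport.of_compactSpace _)
    have hint2 : Integrable (fun x => ∫ y, ‖dirichlet d (2 ^ m) (x - y)‖ ^ 2 ∂μ) μ :=
      ((hcont (2 ^ m)).integrable_of_hasCompactSupport (μ := μ.prod μ)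
        (HasCompactSupport.of_compactSpace _)).integral_prod_left
    have e1 : ∀ x, Φ m x = ENNReal.ofReal (∫ y, ‖dirichlet d (2 ^ m) (x - y)‖ ^ 2 ∂μ) := fun x =>
      (ofReal_integral_eq_lintegral_ofReal (hint x)
        (Filter.Eventually.of_forall fun y => by positivity)).symm
    simp_rw [e1]
    rw [← ofReal_integral_eq_lintegral_ofReal hint2
      (Filter.Eventually.of_forall fun x => integral_nonneg fun y => by positivity)]
    refine ENNReal.ofReal_le_ofReal ((hC (2 ^ m) (by positivity)).trans (le_of_eq ?_))
    push_cast; rfl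
  -- With N = 2^m the kernel has size N^(2d) on a ball of radius c/N, so a bounded Ψ gives mass
  -- O(N^(-t)) there; in the integral of Ψ the m-th term is of order 2^(-em).
  set w : ℕ → ℝ := fun m => ((2 : ℝ) ^ m) ^ (t - 2 * (d : ℝ)) with hw
  have hw0 : ∀ m, 0 < w m := fun m => by positivity
  set Ψ : Torus (Fin d) → ℝ≥0∞ := fun x => ∑' m, ENNReal.ofReal (w m) * Φ m x with hΨ
  have hΨm : Measurable Ψ := Measurable.tsum fun m => (hΦm m).const_mul _
  have hΨi : ∫⁻ x, Ψ x ∂μ ≠ ∞ := by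
    rw [hΨ, lintegral_tsum fun m => ((hΦm m).const_mul _).aemeasurable]
    have e1 : ∀ m, ∫⁻ x, ENNReal.ofReal (w m) * Φ m x ∂μ ≤
        ENNReal.ofReal (C * ((2 : ℝ) ^ (-e)) ^ m) := by
      intro m
      rw [lintegral_const_mul _ (hΦm m)]
      refine (mul_le_mul' le_rfl (hΦi m)).trans ?_
      rw [← ENNReal.ofReal_mul (hw0 m).le]
      refine ENNReal.ofReal_le_ofReal (le_of_eq ?_)
      have h2 : (0 : ℝ) < (2 : ℝ) ^ m := by positivity
      have e2 : w m * ((2 : ℝ) ^ m) ^ (2 * (d : ℝ) + e - s) = ((2 : ℝ) ^ (-e)) ^ m := by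
        rw [hw, ← Real.rpow_add h2, ← Real.rpow_natCast, ← Real.rpow_natCast,
          ← Real.rpow_mul (by norm_num), ← Real.rpow_mul (by norm_num)]
        congr 1
        rw [he]; ring
      rw [← e2]; ring
    refine ((ENNReal.tsum_le_tsum e1).trans_lt ?_).ne
    have hs : Summable fun m : ℕ => C * ((2 : ℝ) ^ (-e)) ^ m :=
      (summable_geometric_of_lt_one (by positivity)
        (Real.rpow_lt_one_of_one_lt_of_neg (by norm_num) (by linarith))).mul_left C
    rw [← ENNReal.ofReal_tsum_of_nonneg (fun m => by positivity) hs]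
    exact ENNReal.ofReal_lt_top
  have hfin := ae_lt_top hΨm hΨi
  obtain ⟨M, hM⟩ : ∃ M : ℕ, μ ({x | Ψ x ≤ M} ∩ E) ≠ 0 := by
    by_contra hcon
    push Not at hcon
    have h1 : ∀ᵐ x ∂μ, ∀ M : ℕ, x ∉ ({x | Ψ x ≤ M} ∩ E) := by
      rw [ae_all_iff]
      intro M
      rw [ae_iff]; simp only [not_not]; exact hcon M
    obtain ⟨x, hx1, hx2, hx3⟩ := (hfin.and (h1.and (ae_of_support_subset hsupp))).exists
    obtain ⟨M, hM⟩ := ENNReal.exists_nat_gt hx1.ne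
    exact hx2 M ⟨hM.le, hx3⟩
  obtain ⟨c, hc0, hc⟩ : ∃ c : ℝ, 0 < c ∧ 2 * Real.pi * √d * c = 1 / 2 := by
    have : 0 < 2 * Real.pi * √d := by positivity
    exact ⟨1 / 2 / (2 * Real.pi * √d), by positivity, by field_simp⟩
  have hdim := le_dimH_of_measure_closedBall_le (μ := μ) (A := {x | Ψ x ≤ M}) (E := E)
    (measurableSet_le hΨm measurable_const) hM (t := t.toNNReal) (Real.toNNReal_pos.2 ht)
    (c := c) (M := 4 * (M + 1)) hc0 (by positivity) (by
      intro x hx m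
      rw [Real.coe_toNNReal t ht.le]
      have h2 : (0 : ℝ) < (2 : ℝ) ^ m := by positivity
      have h1 : ENNReal.ofReal (w m) * Φ m x ≤ M :=
        (ENNReal.le_tsum (f := fun m => ENNReal.ofReal (w m) * Φ m x) m).trans hx
      have h3 : ENNReal.ofReal (((2 : ℝ) ^ m) ^ (2 * d) / 4) *
          μ (Metric.closedBall x (c * (1 / 2) ^ m)) ≤ Φ m x := by
        rw [← setLIntegral_const]
        refine (setLIntegral_mono' Metric.isClosed_closedBall.measurableSet fun y hy => ?_).trans
          (setLIntegral_le_lintegral _ _)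
        refine ENNReal.ofReal_le_ofReal ?_
        have hy' : ‖x - y‖ ≤ c * (1 / 2) ^ m := by
          rw [← dist_eq_norm, dist_comm]; exact hy
        have h4 := le_norm_dirichlet (N := 2 ^ m) (x := x - y) (by
          push_cast
          calc 2 * Real.pi * (√d * 2 ^ m) * ‖x - y‖
              ≤ 2 * Real.pi * (√d * 2 ^ m) * (c * (1 / 2) ^ m) := by gcongr
            _ = (2 * Real.pi * √d * c) * ((2 : ℝ) ^ m * (1 / 2) ^ m) := by ring
            _ = 1 / 2 := by rw [hc, ← mul_pow]; norm_num)
        push_cast at h4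
        calc ((2 : ℝ) ^ m) ^ (2 * d) / 4 = (((2 : ℝ) ^ m) ^ d / 2) ^ 2 := by
              rw [div_pow, ← pow_mul, mul_comm 2 d]; norm_num [pow_mul]
          _ ≤ _ := by gcongr
      have h5 : ENNReal.ofReal (w m * (((2 : ℝ) ^ m) ^ (2 * d) / 4)) *
          μ (Metric.closedBall x (c * (1 / 2) ^ m)) ≤ ENNReal.ofReal (M + 1) := by
        rw [ENNReal.ofReal_mul (hw0 m).le, mul_assoc]
        refine ((mul_le_mul' le_rfl h3).trans h1).trans ?_
        rw [← ENNReal.ofReal_natCast]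
        exact ENNReal.ofReal_le_ofReal (by linarith)
      have e3 : w m * (((2 : ℝ) ^ m) ^ (2 * d) / 4) = ((2 : ℝ) ^ m) ^ t / 4 := by
        rw [hw, ← Real.rpow_natCast ((2 : ℝ) ^ m), mul_div_assoc', ← Real.rpow_add h2]
        congr 2; push_cast; ring
      rw [e3] at h5
      have h6 : (0 : ℝ) < ((2 : ℝ) ^ m) ^ t / 4 := by positivity
      rw [mul_comm, ← ENNReal.le_div_iff_mul_le (Or.inl (by simpa using h6))
        (Or.inl ENNReal.ofReal_ne_top), ← ENNReal.ofReal_div_of_pos h6] at h5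
      refine h5.trans (ENNReal.ofReal_le_ofReal (le_of_eq ?_))
      rw [one_div, inv_pow, Real.inv_rpow h2.le]
      field_simp)
  exact hdim

theorem fourierDim_le_dimH (E : Set (Torus (Fin d))) : fourierDim E ≤ dimH E := by
  refine iSup₂_le fun μ hμ => iSup₂_le fun s hs => ?_
  refine le_of_forall_lt fun a ha => ?_
  obtain ⟨b, hab, hbs⟩ := exists_between ha
  have hbt : b ≠ ∞ := (hbs.trans ENNReal.ofReal_lt_top).ne
  have hb0 : 0 < b := lt_of_le_of_lt zero_le hab
  refine hab.trans_le ?_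
  rw [← ENNReal.ofReal_toReal hbt]
  refine ofReal_le_dimH_of_decay hμ (ENNReal.toReal_pos hb0.ne' hbt) ?_ hs.2.1 hs.2.2
  exact (ENNReal.lt_ofReal_iff_toReal_lt hbt).1 hbs

end Frostman

/-! ### Completeness of `XSpace` and the Baire property -/

section Baire

variable {d : ℕ} {β : ℝ}

theorem decayPseudoEMetric_mono {s t : ℝ} (hst : s ≤ t) :
    (decayPseudoEMetric d t).toUniformSpace ≤ (decayPseudoEMetric d s).toUniformSpace := by
  refine ((@uniformity_basis_edist _ (decayPseudoEMetric d t)).le_basis_iff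
    (@uniformity_basis_edist _ (decayPseudoEMetric d s))).2 fun ε hε => ⟨ε, hε, ?_⟩
  rintro ⟨μ, ν⟩ h
  exact (decayNorm_sub_mono hst μ ν).trans_lt h

/-- A sequence of exponents increasing to `β`. -/
def exponentSeq (β : ℝ) (k : ℕ) : ℝ := β * (1 - 1 / ((k : ℝ) + 1))

theorem exponentSeq_nonneg (hβ : 0 < β) (k : ℕ) : 0 ≤ exponentSeq β k := by
  refine mul_nonneg hβ.le (sub_nonneg.2 ?_)
  rw [div_le_one (by positivity)]
  linarith [(Nat.cast_nonneg k : (0 : ℝ) ≤ k)]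

theorem exponentSeq_lt (hβ : 0 < β) (k : ℕ) : exponentSeq β k < β := by
  have : (0 : ℝ) < 1 / ((k : ℝ) + 1) := by positivity
  rw [exponentSeq]
  nlinarith

theorem exists_le_exponentSeq {s : ℝ} (hs : s < β) : ∃ k, s ≤ exponentSeq β k := by
  have h1 : Filter.Tendsto (exponentSeq β) Filter.atTop (𝓝 β) := by
    have := ((tendsto_one_div_add_atTop_nhds_zero_nat (𝕜 := ℝ)).const_sub 1).const_mul β
    rw [sub_zero, mul_one] at this
    exact this
  exact (h1.eventually_const_le hs).exists

/-- A uniform structure, with countably generated uniformity, for the topology of `XSpace`. -/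
abbrev XSpace.uniform (d : ℕ) (β : ℝ) : UniformSpace (XSpace d β) :=
  UniformSpace.comap XSpace.E inferInstance ⊓
    ⨅ k : ℕ, UniformSpace.comap XSpace.μ (decayPseudoEMetric d (exponentSeq β k)).toUniformSpace

theorem XSpace.uniform_toTopologicalSpace (hβ : 0 < β) :
    (XSpace.uniform d β).toTopologicalSpace = XSpace.instTopologicalSpace d β := by
  rw [XSpace.uniform, UniformSpace.toTopologicalSpace_inf, UniformSpace.toTopologicalSpace_iInf]
  refine congrArg₂ (· ⊓ ·) rfl (le_antisymm ?_ ?_)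
  · refine le_iInf fun s => ?_
    obtain ⟨k, hk⟩ := exists_le_exponentSeq s.2.2
    exact (iInf_le _ k).trans
      (induced_mono (UniformSpace.toTopologicalSpace_mono (decayPseudoEMetric_mono hk)))
  · exact le_iInf fun k =>
      iInf_le_of_le ⟨exponentSeq β k, exponentSeq_nonneg hβ k, exponentSeq_lt hβ k⟩ le_rfl

theorem XSpace.isCountablyGenerated_uniformity :
    (@uniformity _ (XSpace.uniform d β)).IsCountablyGenerated := by
  rw [XSpace.uniform, inf_uniformity, iInf_uniformity]
  have h : ∀ k : ℕ, (@uniformity _ (UniformSpace.comap (XSpace.μ : XSpace d β → _)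
      (decayPseudoEMetric d (exponentSeq β k)).toUniformSpace)).IsCountablyGenerated := by
    intro k
    have := @EMetric.instIsCountablyGeneratedUniformity _ (decayPseudoEMetric d (exponentSeq β k))
    exact Filter.comap.isCountablyGenerated _ _
  have h' : (@uniformity _ (UniformSpace.comap (XSpace.E : XSpace d β → _)
      inferInstance)).IsCountablyGenerated := Filter.comap.isCountablyGenerated _ _
  infer_instance

theorem tendsto_fourierCoeff {ι : Type*} {L : Filter ι}
    {μs : ι → ProbabilityMeasure (Torus (Fin d))} {ν : ProbabilityMeasure (Torus (Fin d))}
    (h : Filter.Tendsto μs L (𝓝 ν)) (ξ : Fin d → ℤ) :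
    Filter.Tendsto (fun i => fourierCoeff (μs i : Measure (Torus (Fin d))) ξ) L
      (𝓝 (fourierCoeff (ν : Measure (Torus (Fin d))) ξ)) :=
  (ProbabilityMeasure.tendsto_iff_forall_integral_rclike_tendsto ℂ).1 h
    (BoundedContinuousFunction.mkOfCompact ⟨char (-ξ), continuous_char _⟩)

/-- By the portmanteau theorem the limit measure gives full mass to every closed thickening of E,
and these shrink to E. -/
theorem support_subset_of_tendsto {ι : Type*} {L : Filter ι} [L.NeBot]
    {μs : ι → ProbabilityMeasure (Torus (Fin d))} {ν : ProbabilityMeasure (Torus (Fin d))}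
    {Es : ι → NonemptyCompacts (Torus (Fin d))} {E : NonemptyCompacts (Torus (Fin d))}
    (hμ : Filter.Tendsto μs L (𝓝 ν)) (hE : Filter.Tendsto Es L (𝓝 E))
    (hs : ∀ i, (μs i : Measure (Torus (Fin d))).support ⊆ Es i) :
    (ν : Measure (Torus (Fin d))).support ⊆ E := by
  rw [← E.isCompact.isClosed.closure_eq, Metric.closure_eq_iInter_cthickening]
  refine Set.subset_iInter₂ fun δ hδ => ?_
  refine Measure.support_subset_of_isClosed Metric.isClosed_cthickening ?_
  rw [mem_ae_iff_prob_eq_one Metric.isClosed_cthickening.measurableSet]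
  refine le_antisymm prob_le_one ?_
  refine le_trans ?_ (ProbabilityMeasure.limsup_measure_closed_le_of_tendsto hμ
    (Metric.isClosed_cthickening (δ := δ) (E := (E : Set (Torus (Fin d))))))
  refine Filter.le_limsup_of_frequently_le' (Filter.Eventually.frequently ?_)
  filter_upwards [Metric.tendsto_nhds.1 hE δ hδ] with i hi
  have h1 : ∀ᵐ x ∂(μs i : Measure (Torus (Fin d))),
      x ∈ Metric.cthickening δ (E : Set (Torus (Fin d))) := by
    filter_upwards [ae_of_support_subset (hs i)] with x hx
    rw [Metric.NonemptyCompacts.dist_eq] at hi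
    obtain ⟨z, hz, hxz⟩ := Metric.exists_dist_lt_of_hausdorffDist_lt hx hi
      (Metric.hausdorffEDist_ne_top_of_nonempty_of_bounded (Es i).nonempty E.nonempty
        (Es i).isCompact.isBounded E.isCompact.isBounded)
    exact Metric.mem_cthickening_of_dist_le _ _ _ _ hz hxz.le
  exact ((mem_ae_iff_prob_eq_one Metric.isClosed_cthickening.measurableSet).1 h1).ge

/-- Weak compactness supplies a candidate ν along an ultrafilter. Coefficients converge along it, so
passing to the limit in one index of the Cauchy estimate, frequency by frequency, gives convergence
of the full sequence in every seminorm. -/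
theorem XSpace.exists_tendsto_of_cauchySeq {u : ℕ → XSpace d β}
    (hE : CauchySeq fun n => (u n).E)
    (hμ : ∀ (k : ℕ) (ε : ℝ≥0∞), 0 < ε → ∃ N, ∀ m, N ≤ m → ∀ n, N ≤ n →
      decayNorm (exponentSeq β k) (fourierCoeff ((u m).μ : Measure (Torus (Fin d))) -
        fourierCoeff ((u n).μ : Measure _)) < ε) :
    ∃ p, Filter.Tendsto u Filter.atTop (𝓝 p) := by
  obtain ⟨E, hElim⟩ := cauchySeq_tendsto_of_complete hE
  have hle : ((Filter.hyperfilter ℕ : Ultrafilter ℕ) : Filter ℕ) ≤ Filter.atTop :=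
    Nat.hyperfilter_le_atTop
  obtain ⟨ν, -, hν⟩ := isCompact_univ.ultrafilter_le_nhds
    ((Filter.hyperfilter ℕ).map fun n => (u n).μ) (by simp)
  have hν' : Filter.Tendsto (fun n => (u n).μ) (Filter.hyperfilter ℕ : Ultrafilter ℕ) (𝓝 ν) := hν
  have hlim : ∀ (k : ℕ) (ε : ℝ≥0∞), 0 < ε → ∃ N, ∀ m, N ≤ m →
      decayNorm (exponentSeq β k) (fourierCoeff ((u m).μ : Measure (Torus (Fin d))) -
        fourierCoeff (ν : Measure _)) ≤ ε := by
    intro k ε hε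
    obtain ⟨N, hN⟩ := hμ k ε hε
    refine ⟨N, fun m hm => iSup_le fun ξ => ?_⟩
    have h1 : Filter.Tendsto (fun n => ENNReal.ofReal
        (‖(fourierCoeff ((u m).μ : Measure (Torus (Fin d))) -
          fourierCoeff ((u n).μ : Measure (Torus (Fin d)))) ξ‖ *
          freqNorm ξ ^ (exponentSeq β k / 2))) (Filter.hyperfilter ℕ : Ultrafilter ℕ)
        (𝓝 (ENNReal.ofReal (‖(fourierCoeff ((u m).μ : Measure (Torus (Fin d))) -
          fourierCoeff (ν : Measure (Torus (Fin d)))) ξ‖ *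
          freqNorm ξ ^ (exponentSeq β k / 2)))) :=
      ENNReal.tendsto_ofReal
        (((tendsto_fourierCoeff hν' ξ).const_sub _).norm.mul_const _)
    refine le_of_tendsto h1 ?_
    filter_upwards [hle (Filter.eventually_ge_atTop N)] with n hn
    exact (ofReal_le_decayNorm _ _ ξ).trans (hN m hm n hn).le
  have hdec : ∀ s : ℝ, 0 ≤ s → s < β →
      decayNorm s (fourierCoeff (ν : Measure (Torus (Fin d)))) < ∞ := by
    intro s hs hsβ
    obtain ⟨k, hk⟩ := exists_le_exponentSeq hsβ
    obtain ⟨N, hN⟩ := hlim k 1 one_pos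
    have h1 := decayNorm_add_le s (fourierCoeff (ν : Measure (Torus (Fin d))) -
      fourierCoeff ((u N).μ : Measure (Torus (Fin d))))
      (fourierCoeff ((u N).μ : Measure (Torus (Fin d))))
    rw [sub_add_cancel, ← neg_sub, decayNorm_neg] at h1
    refine h1.trans_lt (ENNReal.add_lt_top.2 ⟨?_, (u N).decay s hs hsβ⟩)
    exact ((decayNorm_sub_mono hk _ _).trans (hN N le_rfl)).trans_lt ENNReal.one_lt_top
  refine ⟨⟨E, ν, support_subset_of_tendsto hν' (hElim.mono_left hle)
    fun n => (u n).support_subset, hdec⟩, ?_⟩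
  refine XSpace.le_nhds (p := ⟨E, ν, _, _⟩) (Filter.tendsto_map'_iff.2 hElim)
    fun s hs hsβ ε hε => ?_
  obtain ⟨k, hk⟩ := exists_le_exponentSeq hsβ
  obtain ⟨δ, hδ0, hδε⟩ := exists_between hε
  obtain ⟨N, hN⟩ := hlim k δ hδ0
  rw [Filter.eventually_map]
  filter_upwards [Filter.eventually_ge_atTop N] with n hn
  exact ((decayNorm_sub_mono hk _ _).trans (hN n hn)).trans_lt hδε

theorem baireSpace_of_completeSpace {X : Type*} [UniformSpace X] [CompleteSpace X]
    [(uniformity X).IsCountablyGenerated] : BaireSpace X :=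
  inferInstance

theorem XSpace.baireSpace (hβ : 0 < β) : BaireSpace (XSpace d β) := by
  have hcg := XSpace.isCountablyGenerated_uniformity (d := d) (β := β)
  have hcomplete : @CompleteSpace _ (XSpace.uniform d β) := by
    refine @UniformSpace.complete_of_cauchySeq_tendsto _ (XSpace.uniform d β) hcg fun u hu => ?_
    rw [XSpace.uniform_toTopologicalSpace hβ]
    refine XSpace.exists_tendsto_of_cauchySeq ?_ fun k ε hε => ?_
    · exact @UniformContinuous.comp_cauchySeq _ _ (XSpace.uniform d β) _ _ _ XSpace.E
        (uniformContinuous_iff_le_comap.2 inf_le_left) u hu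
    · have h1 : @CauchySeq _ _ (decayPseudoEMetric d (exponentSeq β k)).toUniformSpace _
          (fun n => (u n).μ) :=
        @UniformContinuous.comp_cauchySeq _ _ (XSpace.uniform d β) _
          (decayPseudoEMetric d (exponentSeq β k)).toUniformSpace _ XSpace.μ
          ((@uniformContinuous_iff_le_comap _ _ (XSpace.uniform d β)
            (decayPseudoEMetric d (exponentSeq β k)).toUniformSpace XSpace.μ).2
            (inf_le_right.trans (iInf_le _ k))) u hu
      exact (@EMetric.cauchySeq_iff _ _ (decayPseudoEMetric d (exponentSeq β k)) _ _ _).1 h1 ε hε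
  have hbaire := @baireSpace_of_completeSpace _ (XSpace.uniform d β) hcomplete hcg
  rwa [XSpace.uniform_toTopologicalSpace hβ] at hbaire

theorem XSpace.nonempty (hβ : β ≤ d) : Nonempty (XSpace d β) := by
  obtain ⟨C, -, hmol⟩ := exists_mollifier d
  obtain ⟨ψ, hψ, -, hψd, -⟩ := hmol 1 one_pos le_rfl
  refine ⟨⟨⟨⟨Set.univ, isCompact_univ⟩, Set.univ_nonempty⟩, ⟨ψ, hψ⟩, Set.subset_univ _,
    fun s hs hsβ => decayNorm_lt_top_of_bound (μ := ψ) (C := C) hs (by linarith) ?_⟩⟩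
  simpa using hψd

theorem XSpace.ofReal_le_fourierDim (hβ : β ≤ d) (p : XSpace d β) :
    ENNReal.ofReal β ≤ fourierDim (p.E : Set (Torus (Fin d))) := by
  refine le_of_forall_lt fun a ha => ?_
  obtain ⟨b, hab, hbβ⟩ := exists_between ha
  have hbt : b ≠ ∞ := (hbβ.trans ENNReal.ofReal_lt_top).ne
  have hb : b.toReal < β := (ENNReal.lt_ofReal_iff_toReal_lt hbt).1 hbβ
  refine hab.trans_le ?_
  rw [← ENNReal.ofReal_toReal hbt]
  refine le_iSup₂_of_le p.μ p.support_subset ?_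
  exact le_iSup₂_of_le (f := fun (s : ℝ) (_ : 0 ≤ s ∧ s ≤ d ∧
    decayNorm s (fourierCoeff (p.μ : Measure (Torus (Fin d)))) < ∞) => ENNReal.ofReal s)
    b.toReal ⟨ENNReal.toReal_nonneg, by linarith, p.decay _ ENNReal.toReal_nonneg hb⟩ le_rfl

theorem XSpace.isSalem_of_dimH_le (hβ : β ≤ d) {p : XSpace d β}
    (h : dimH (p.E : Set (Torus (Fin d))) ≤ ENNReal.ofReal β) :
    IsSalem (p.E : Set (Torus (Fin d))) ∧
      fourierDim (p.E : Set (Torus (Fin d))) = ENNReal.ofReal β := by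
  have h1 := p.ofReal_le_fourierDim hβ
  have h2 := fourierDim_le_dimH (p.E : Set (Torus (Fin d)))
  exact ⟨le_antisymm h2 (h.trans h1), le_antisymm (h2.trans h) h1⟩

end Baire

end SalemAvoidance

end

/-! ### The main theorem -/

theorem theorem1 (d n : ℕ) (α : ℝ) (hα0 : 0 ≤ α) (hα : α < (d : ℝ) * n)
    (Z : Set (SalemAvoidance.Torus (Fin n × Fin d))) (hZc : IsCompact Z)
    (hZ : SalemAvoidance.lowerMinkowskiDim Z ≤ (α : EReal))
    (β₀ : ℝ) (hβ₀ : β₀ = min (((d : ℝ) * n - α) / ((n : ℝ) - 1 / 2)) (d : ℝ)) :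
    (∃ E : Set (SalemAvoidance.Torus (Fin d)),
      IsCompact E ∧ SalemAvoidance.IsSalem E ∧
        SalemAvoidance.fourierDim E = ENNReal.ofReal β₀ ∧ SalemAvoidance.Avoids E Z) ∧
    (∀ β : ℝ, 0 < β → β ≤ β₀ →
      {p : SalemAvoidance.XSpace d β |
        SalemAvoidance.IsSalem (p.E : Set (SalemAvoidance.Torus (Fin d))) ∧
          SalemAvoidance.Avoids (p.E : Set (SalemAvoidance.Torus (Fin d))) Z} ∈
        residual (SalemAvoidance.XSpace d β)) := by
  have hdn : (0 : ℝ) < d * n := hα0.trans_lt hα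
  have hd : 0 < d := Nat.pos_of_ne_zero fun h => by simp [h] at hdn
  have hn : 0 < n := Nat.pos_of_ne_zero fun h => by simp [h] at hdn
  have hn1 : (1 : ℝ) ≤ n := by exact_mod_cast hn
  have hnh : (0 : ℝ) < (n : ℝ) - 1 / 2 := by linarith
  have hβ₀0 : 0 < β₀ := by
    rw [hβ₀]
    exact lt_min (div_pos (by linarith) hnh) (by exact_mod_cast hd)
  have hβ₀d : β₀ ≤ d := hβ₀ ▸ min_le_right _ _
  have hβ₀n : ∀ β ≤ β₀, β * ((n : ℝ) - 1 / 2) ≤ d * n - α := by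
    intro β hβ
    rw [← le_div_iff₀ hnh]
    exact hβ.trans (hβ₀ ▸ min_le_left _ _)
  have hres : ∀ β, 0 < β → β ≤ β₀ → _ := fun β h0 hβ =>
    SalemAvoidance.residual_dimH_le_and_avoids (β := β) hn h0 (hβ.trans hβ₀d) (hβ₀n β hβ) hZ
  refine ⟨?_, fun β h0 hβ => ?_⟩
  -- In a nonempty Baire space the comeager set for β = β₀ is dense, hence has an element.
  · have := SalemAvoidance.XSpace.baireSpace (d := d) hβ₀0
    have := SalemAvoidance.XSpace.nonempty hβ₀d
    obtain ⟨p, hp, hpA⟩ := (dense_of_mem_residual (hres β₀ hβ₀0 le_rfl)).nonempty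
    obtain ⟨h1, h2⟩ := SalemAvoidance.XSpace.isSalem_of_dimH_le hβ₀d hp
    exact ⟨p.E, p.E.isCompact, h1, h2, hpA⟩
  · filter_upwards [hres β h0 hβ] with p hp
    exact ⟨(SalemAvoidance.XSpace.isSalem_of_dimH_le (hβ.trans hβ₀d) hp.1).1, hp.2⟩
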